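/- Let $V$ be a (purely even) vertex algebra over $\mathbb C$ with vacuum $|0\rangle$, translation operator $\partial$ and fields $a(z)=\sum_{n\in\mathbb Z}a_{(n)}z^{-n-1}$, which is conformal: there is a vector $L\in V$ whose modes $L_n=L_{(n+1)}$ satisfy the Virasoro relations with some central charge $c\in\mathbb C$, $L_{-1}=\partial$, and $L_0$ is diagonalizable. Assume that the eigenvalues of $L_0$ are integers bounded below (for instance nonnegative integers); write $V=\bigoplus_{n\in\mathbb Z} V_n$ for the eigenspace decomposition. Let $\eta$ be the anti-involution of the Fourier modes given by $\eta(b(z))=\bigl(e^{zL_1}(-z^{-2})^{L_0}b\bigr)(z^{-1})$, i.e. $\eta(b_{(n)})=\sum_{j\ge0}\frac{(-1)^{p}}{j!}(L_1^jb)_{(2p-j-n-2)}$ for $b\in V_p$. Let $D(V)=\bigoplus_n V_n^*$ be the restricted dual, that is, the space of functionals on $V$ vanishing on all but finitely many $V_n$, on which a mode $X$ acts by $(Xy)(v)=y(\eta(X)v)$. Let $m\ge2$ and let $z_2,\dots,z_{m-1}\in\mathbb C\setminus\{0\}$ be pairwise distinct; put $z_1=\infty$, $z_m=0$. For $B\in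 V$ and a rational function $f$ on $\mathbb{CP}^1$ without poles outside $\{\infty,z_2,\dots,z_{m-1},0\}$ put, for $2\le t\le m$, $i_{z_t}(B\otimes f)=\sum_k f_kB_{(k)}$ where $f=\sum_kf_k(z-z_t)^k$ is the Laurent expansion at $z_t$, and $i_\infty(B\otimes f)=-\sum_kf_k\,\eta(B_{(k)})$ where $f=\sum_kf_kz^k$ is the Laurent expansion at $\infty$. The Lie algebra $\mathrm{Lie}(V)_{out}$ consists of the sums of such sections $B\otimes f$ modulo total derivatives $\partial B\otimes f+B\otimes f'$ and modulo the sections $|0\rangle\otimes f$. The space of conformal blocks $\langle D(V),V,\dots,V\rangle(\infty,z_2,\dots,z_{m-1},0)$ is the space of linear functionals $\varphi$ on $D(V)\otimes V^{\otimes(m-1)}$ such that $$\sum_{t=1}^m\varphi\bigl(v_1\otimes\cdots\otimes i_{z_t}(X)v_t\otimes\cdots\otimes v_m\bigr)=0$$ for all $v_1\in D(V)$, $v_2,\dots,v_m\in V$ and all sections $X=B\otimes f$ as above. Then there is a family of linear functionals $\Phi_{z_2,\dots,z_{m-1}}$ on $D(V)\otimes V^{\otimes(m-1)}$, unique on the configuration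 space of pairwise distinct nonzero $z_2,\dots,z_{m-1}$, which is the matrix element $$\Phi_{z_2,\dots,z_{m-1}}(a_1,\dots,a_m)=a_1\bigl(a_2(z_2)a_3(z_3)\cdots a_{m-1}(z_{m-1})a_m\bigr),\qquad a_1\in D(V),\ a_2,\dots,a_m\in V,$$ in the following sense: for $|z_2|>\cdots>|z_{m-1}|>0$ the multiple Laurent series on the right converges absolutely to $\Phi_{z_2,\dots,z_{m-1}}(a_1,\dots,a_m)$, and on the whole configuration space $\Phi_{z_2,\dots,z_{m-1}}(a_1,\dots,a_m)$ is a rational function of $z_2,\dots,z_{m-1}$ whose only poles are at $z_i=0$ and $z_i=z_j$. Moreover, for all pairwise distinct nonzero $z_2,\dots,z_{m-1}$: 1. $\Phi_{z_2,\dots,z_{m-1}}$ belongs to $\langle D(V),V,\dots,V\rangle(\infty,z_2,\dots,z_{m-1},0)$; 2. $\Phi$ is a horizontal section of the connection $\partial/\partial z_t-L_{-1}^{(t)}$, $2\le t\le m-1$: for every $\xi\in D(V)\otimes V^{\otimes(m-1)}$ one has $\frac{\partial}{\partial z_t}\Phi_{z_2,\dots,z_{m-1}}(\xi)=\Phi_{z_2,\dots,z_{m-1}}(L_{-1}^{(t)}\xi)$,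 where $L_{-1}^{(t)}$ acts as $L_{-1}$ on the $t$-th tensor factor. -/

import Mathlib

open scoped TensorProduct

noncomputable section

/-- A (purely even) vertex algebra over `ℂ`. The Fourier mode `a_(n)` of the field
`a(z) = ∑ a_(n) z^(-n-1)` is `mode n a`. -/
structure VertexAlgebra (V : Type*) [AddCommGroup V] [Module ℂ V] where
  /-- the vacuum vector `|0⟩` -/
  vac : V
  /-- `mode n a b = a_(n) b` -/
  mode : ℤ → V →ₗ[ℂ] Module.End ℂ V
  /-- the translation operator `∂` -/
  del : Module.End ℂ V
  /-- each `a(z)` is a field: `a_(n) b = 0` for `n ≫ 0` -/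
  field : ∀ a b : V, ∃ N : ℤ, ∀ n : ℤ, N ≤ n → mode n a b = 0
  /-- `|0⟩(z) = Id` -/
  mode_vac : ∀ n : ℤ, mode n vac = if n = -1 then 1 else 0
  del_vac : del vac = 0
  mode_apply_vac : ∀ (a : V) (n : ℤ), 0 ≤ n → mode n a vac = 0
  mode_neg_one_vac : ∀ a : V, mode (-1) a vac = a
  /-- `[∂, a(z)] = ∂_z a(z)` -/
  translation : ∀ (a : V) (n : ℤ), ⁅del, mode n a⁆ = (-n : ℂ) • mode (n - 1) a
  /-- `(z - w)^N [a(z), b(w)] = 0` for some `N`, written out in coefficients -/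
  locality : ∀ a b : V, ∃ N : ℕ, ∀ m n : ℤ,
    ∑ j ∈ Finset.range (N + 1), ((-1 : ℂ) ^ j * (N.choose j : ℂ)) •
      ⁅mode (m + N - j) a, mode (n + j) b⁆ = 0

/-- A conformal vertex algebra of central charge `c`; the Virasoro modes are
`L_n = L_(n+1)`. -/
structure ConformalVertexAlgebra (V : Type*) [AddCommGroup V] [Module ℂ V] extends
    VertexAlgebra V where
  /-- the conformal vector `L` -/
  conf : V
  /-- the central charge -/
  c : ℂ
  virasoro : ∀ m n : ℤ, ⁅mode (m + 1) conf, mode (n + 1) conf⁆ =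
    ((m : ℂ) - n) • mode (m + n + 1) conf +
      (if m = -n then ((m : ℂ) ^ 3 - m) / 12 * c else 0) • (1 : Module.End ℂ V)
  /-- `L_{-1} = ∂` -/
  conf_zero : mode 0 conf = del
  /-- `L_0` is diagonalizable -/
  diag : ⨆ μ : ℂ, Module.End.eigenspace (mode 1 conf) μ = ⊤

/-- A conformal vertex algebra whose conformal weights (the eigenvalues of `L_0`) are integers
and are bounded below. (This includes the algebras whose weights are nonnegative integers.) -/
structure BoundedConformalVertexAlgebra (V : Type*) [AddCommGroup V] [Module ℂ V] extends
    ConformalVertexAlgebra V where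
  weights : ∃ N : ℤ, ∀ μ : ℂ, Module.End.HasEigenvalue (mode 1 conf) μ →
    ∃ n : ℤ, N ≤ n ∧ μ = n

/-! ### Modes shift the conformal weight -/

section Shift

variable {E : Type*} [AddCommGroup E] [Module ℂ E]

/-- Translation of the argument, as a linear operator on functions. -/
def shiftOp {ι : Type*} [AddCommGroup ι] (v : ι) : Module.End ℂ (ι → E) where
  toFun f := fun u => f (u + v)
  map_add' _ _ := rfl
  map_smul' _ _ := rfl

theorem shiftOp_apply {ι : Type*} [AddCommGroup ι] (v : ι) (f : ι → E) (u : ι) :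
    shiftOp v f u = f (u + v) := rfl

theorem shiftOp_commute {ι : Type*} [AddCommGroup ι] (v w : ι) :
    Commute (shiftOp (E := E) v) (shiftOp w) := by
  ext f u
  simp only [Module.End.mul_apply, shiftOp_apply]
  congr 1
  abel

theorem shiftOp_pow_apply {ι : Type*} [AddCommGroup ι] (v : ι) (n : ℕ) (f : ι → E) (u : ι) :
    (shiftOp v ^ n) f u = f (u + n • v) := by
  induction n generalizing u with
  | zero => simp
  | succ n ih =>
    rw [pow_succ', Module.End.mul_apply, shiftOp_apply, ih, succ_nsmul]
    congr 1
    abel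

theorem shiftOp_sub_pow_apply {ι : Type*} [AddCommGroup ι] (v w : ι) (N : ℕ) (f : ι → E)
    (u : ι) :
    ((shiftOp (E := E) v - shiftOp (E := E) w) ^ N) f u =
      ∑ j ∈ Finset.range (N + 1), ((-1 : ℂ) ^ j * (N.choose j : ℂ)) •
        f (u + (N - j) • v + j • w) := by
  have h : Commute (-shiftOp (E := E) w) (shiftOp (E := E) v) :=
    (shiftOp_commute (E := E) w v).neg_left
  rw [sub_eq_neg_add, h.add_pow, LinearMap.sum_apply, Finset.sum_apply]
  refine Finset.sum_congr rfl fun j _ => ?_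
  have e : ((-shiftOp (E := E) w) ^ j * shiftOp (E := E) v ^ (N - j) *
      (N.choose j : Module.End ℂ (ι → E)))
      = ((-1 : ℂ) ^ j * (N.choose j : ℂ)) •
        (shiftOp (E := E) w ^ j * shiftOp (E := E) v ^ (N - j)) := by
    have e1 : (-shiftOp (E := E) w) = (-1 : ℂ) • shiftOp (E := E) w := by
      ext; simp
    have e2 : (N.choose j : Module.End ℂ (ι → E)) = (N.choose j : ℂ) • 1 := by
      rw [← Algebra.algebraMap_eq_smul_one, map_natCast]
    rw [e1, smul_pow, e2, smul_mul_assoc, smul_mul_assoc, mul_smul_comm, mul_one, smul_smul]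
  rw [e, LinearMap.smul_apply, Pi.smul_apply, Module.End.mul_apply, shiftOp_pow_apply,
    shiftOp_pow_apply]
  congr 2
  abel

/-- If `A^N G = 0`, `B^N H₁ = 0`, `(B - A)^N H₂ = 0` and `G = H₁ + H₂`, then a power of `B - A`
kills `G`. -/
theorem dong_aux {F : Type*} [AddCommGroup F] [Module ℂ F] (A B : Module.End ℂ F)
    (hAB : Commute A B) (N : ℕ) (G H₁ H₂ : F) (hG : G = H₁ + H₂) (h0 : (A ^ N) G = 0)
    (h1 : (B ^ N) H₁ = 0) (h2 : ((B - A) ^ N) H₂ = 0) : ((B - A) ^ (3 * N)) G = 0 := by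
  have hC : Commute (-A) B := hAB.neg_left
  have hCB : Commute (B - A) B := (Commute.refl B).sub_left hAB
  have hCA : Commute (B - A) (-A) := (hAB.symm.sub_left (Commute.refl A)).neg_right
  have key : ∀ j ∈ Finset.range (2 * N + 1),
      ((B - A) ^ N * ((-A) ^ j * B ^ (2 * N - j))) G = 0 := by
    intro j _
    by_cases hj : N ≤ j
    · obtain ⟨i, rfl⟩ := Nat.exists_eq_add_of_le' hj
      have e : (B - A) ^ N * ((-A) ^ (i + N) * B ^ (2 * N - (i + N)))
          = ((B - A) ^ N * B ^ (2 * N - (i + N)) * (-A) ^ i * (-1) ^ N) * A ^ N := by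
        rw [(hC.pow_pow _ _).eq, pow_add, neg_pow A N]
        simp only [mul_assoc]
      rw [e, Module.End.mul_apply, h0, map_zero]
    · obtain ⟨i, hi⟩ : ∃ i, 2 * N - j = i + N := ⟨N - j, by omega⟩
      rw [hi, hG, map_add]
      have e1 : (B - A) ^ N * ((-A) ^ j * B ^ (i + N))
          = ((B - A) ^ N * (-A) ^ j * B ^ i) * B ^ N := by
        rw [pow_add]; simp only [mul_assoc]
      have e2 : (B - A) ^ N * ((-A) ^ j * B ^ (i + N))
          = ((-A) ^ j * B ^ (i + N)) * (B - A) ^ N :=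
        ((hCA.pow_pow _ _).mul_right (hCB.pow_pow _ _)).eq
      nth_rewrite 1 [e1]
      rw [e2, Module.End.mul_apply, Module.End.mul_apply _ ((B - A) ^ N), h1, h2, map_zero,
        map_zero, add_zero]
  have e : (B - A) ^ (3 * N) = (B - A) ^ N * (B - A) ^ (2 * N) := by
    rw [← pow_add]; congr 1; ring
  rw [e]
  nth_rewrite 2 [sub_eq_neg_add]
  rw [hC.add_pow, Finset.mul_sum, LinearMap.sum_apply]
  refine Finset.sum_eq_zero fun j hj => ?_
  rw [← mul_assoc, ← (Nat.cast_commute ((2 * N).choose j) _).eq, Module.End.mul_apply, key j hj,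
    map_zero]

end Shift

section Locality

variable {V : Type*} [AddCommGroup V] [Module ℂ V]

/-- The coefficients of `[f(z), g(w)]`. -/
def brk (f g : ℤ → Module.End ℂ V) : ℤ × ℤ → Module.End ℂ V := fun u => ⁅f u.1, g u.2⁆

/-- Multiplication by `z - w` on the coefficients of formal distributions. -/
def mulZW : Module.End ℂ (ℤ × ℤ → Module.End ℂ V) :=
  shiftOp ((1, 0) : ℤ × ℤ) - shiftOp ((0, 1) : ℤ × ℤ)

theorem mulZW_pow_apply (N : ℕ) (f : ℤ × ℤ → Module.End ℂ V) (m n : ℤ) :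
    (mulZW ^ N) f (m, n) = ∑ j ∈ Finset.range (N + 1), ((-1 : ℂ) ^ j * (N.choose j : ℂ)) •
        f (m + N - j, n + j) := by
  rw [mulZW, shiftOp_sub_pow_apply]
  refine Finset.sum_congr rfl fun j hj => ?_
  have hj' : j ≤ N := by simpa [Nat.lt_succ_iff] using hj
  congr 2
  ext
  · simp [Nat.cast_sub hj']; ring
  · simp

theorem mulZW_mono {N M : ℕ} (h : N ≤ M) {f : ℤ × ℤ → Module.End ℂ V}
    (hf : (mulZW ^ N) f = 0) : (mulZW ^ M) f = 0 := by
  obtain ⟨k, rfl⟩ := Nat.exists_eq_add_of_le' h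
  rw [pow_add, Module.End.mul_apply, hf, map_zero]

/-- Multiplication of the coefficients by the first index. -/
def idxOp : Module.End ℂ (ℤ × ℤ → Module.End ℂ V) where
  toFun f := fun u => (u.1 : ℂ) • f u
  map_add' _ _ := by ext1 u; simp
  map_smul' c f := by ext1 u; simp [smul_comm c]

theorem mulZW_idxOp (N : ℕ) {f : ℤ × ℤ → Module.End ℂ V} (hf : (mulZW ^ N) f = 0) :
    (mulZW ^ (N + 1)) (idxOp f) = 0 := by
  have h1 : ∀ g : ℤ × ℤ → Module.End ℂ V,
      mulZW (idxOp g) = idxOp (mulZW g) + shiftOp ((1, 0) : ℤ × ℤ) g := by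
    intro g
    ext1 u
    simp only [mulZW, LinearMap.sub_apply, Pi.sub_apply, Pi.add_apply, shiftOp_apply, idxOp,
      LinearMap.coe_mk, AddHom.coe_mk, Prod.fst_add, smul_sub]
    push_cast
    rw [add_zero, add_smul, one_smul]
    abel
  have h2 : Commute (mulZW (V := V)) (shiftOp ((1, 0) : ℤ × ℤ)) :=
    (Commute.refl _).sub_left (shiftOp_commute _ _)
  have h3 : ∀ n : ℕ, (mulZW ^ (n + 1)) (idxOp f) = idxOp ((mulZW ^ (n + 1)) f) +
      ((n : ℂ) + 1) • shiftOp ((1, 0) : ℤ × ℤ) ((mulZW ^ n) f) := by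
    intro n
    induction n with
    | zero => simp [h1]
    | succ n ih =>
      rw [pow_succ', Module.End.mul_apply, ih, map_add, h1, map_smul]
      have e : mulZW (shiftOp ((1, 0) : ℤ × ℤ) ((mulZW ^ n) f)) =
          shiftOp ((1, 0) : ℤ × ℤ) ((mulZW ^ (n + 1)) f) := by
        rw [← Module.End.mul_apply, h2.eq, Module.End.mul_apply, pow_succ', Module.End.mul_apply]
      rw [e, ← Module.End.mul_apply mulZW, ← pow_succ', add_assoc]
      congr 1
      push_cast
      module
  rw [h3 N, hf, pow_succ', Module.End.mul_apply, hf]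
  simp

namespace VertexAlgebra

variable (A : VertexAlgebra V)

theorem sum_lie_eq_zero {s : Finset ℕ} {k : ℕ → ℂ} {T : ℕ → Module.End ℂ V}
    (h : ∑ j ∈ s, k j • T j = 0) (y : Module.End ℂ V) :
    ∑ j ∈ s, k j • ⁅T j, y⁆ = 0 ∧ ∑ j ∈ s, k j • ⁅y, T j⁆ = 0 := by
  have h1 : ∑ j ∈ s, k j • (T j * y) = 0 := by
    simp_rw [← smul_mul_assoc]; rw [← Finset.sum_mul, h, zero_mul]
  have h2 : ∑ j ∈ s, k j • (y * T j) = 0 := by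
    simp_rw [← mul_smul_comm]; rw [← Finset.mul_sum, h, mul_zero]
  simp only [Ring.lie_def, smul_sub, Finset.sum_sub_distrib, h1, h2, sub_zero, and_self]

theorem exists_mulZW (a b : V) :
    ∃ N : ℕ, (mulZW ^ N) (brk (fun n => A.mode n a) fun n => A.mode n b) = 0 := by
  obtain ⟨N, hN⟩ := A.locality a b
  refine ⟨N, ?_⟩
  ext1 ⟨m, n⟩
  rw [mulZW_pow_apply]
  exact hN m n

theorem exists_mulZW_comm (x a b : V) (p : ℤ) :
    ∃ N : ℕ, (mulZW ^ N)
      (brk (fun n => ⁅A.mode p x, A.mode n a⁆) fun n => A.mode n b) = 0 := by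
  obtain ⟨N₁, h₁⟩ := A.exists_mulZW x a
  obtain ⟨N₂, h₂⟩ := A.exists_mulZW x b
  obtain ⟨N₃, h₃⟩ := A.exists_mulZW a b
  set N := max N₁ (max N₂ N₃)
  replace h₁ := mulZW_mono (M := N) (by omega) h₁
  replace h₂ := mulZW_mono (M := N) (by omega) h₂
  replace h₃ := mulZW_mono (M := N) (by omega) h₃
  let eX : ℤ × ℤ × ℤ := (1, 0, 0)
  let eZ : ℤ × ℤ × ℤ := (0, 1, 0)
  let eW : ℤ × ℤ × ℤ := (0, 0, 1)
  let S : ℤ × ℤ × ℤ → Module.End ℂ (ℤ × ℤ × ℤ → Module.End ℂ V) := fun v => shiftOp v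
  let G : ℤ × ℤ × ℤ → Module.End ℂ V :=
    fun u => ⁅⁅A.mode u.1 x, A.mode u.2.1 a⁆, A.mode u.2.2 b⁆
  let H₁ : ℤ × ℤ × ℤ → Module.End ℂ V :=
    fun u => ⁅⁅A.mode u.1 x, A.mode u.2.2 b⁆, A.mode u.2.1 a⁆
  let H₂ : ℤ × ℤ × ℤ → Module.End ℂ V :=
    fun u => ⁅A.mode u.1 x, ⁅A.mode u.2.1 a, A.mode u.2.2 b⁆⁆
  have hc : ∀ v w, Commute (S v) (S w) := fun v w => shiftOp_commute v w
  have hD := dong_aux (S eX - S eZ) (S eX - S eW)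
    (((hc _ _).sub_right (hc _ _)).sub_left ((hc _ _).sub_right (hc _ _))) N G H₁ H₂
    (by
      ext1 u
      simp only [G, H₁, H₂, Pi.add_apply]
      simp only [Ring.lie_def]
      noncomm_ring)
    (by
      ext1 ⟨p, q, r⟩
      have t := congrFun h₁ (p, q)
      rw [mulZW_pow_apply] at t
      rw [shiftOp_sub_pow_apply]
      rw [Pi.zero_apply, ← (sum_lie_eq_zero t (A.mode r b)).1]
      refine Finset.sum_congr rfl fun j hj => ?_
      have hj' : j ≤ N := by simpa [Nat.lt_succ_iff] using hj
      simp [G, eX, eZ, brk, Nat.cast_sub hj', add_sub_assoc])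
    (by
      ext1 ⟨p, q, r⟩
      have t := congrFun h₂ (p, r)
      rw [mulZW_pow_apply] at t
      rw [shiftOp_sub_pow_apply]
      rw [Pi.zero_apply, ← (sum_lie_eq_zero t (A.mode q a)).1]
      refine Finset.sum_congr rfl fun j hj => ?_
      have hj' : j ≤ N := by simpa [Nat.lt_succ_iff] using hj
      simp [H₁, eX, eW, brk, Nat.cast_sub hj', add_sub_assoc])
    (by
      ext1 ⟨p, q, r⟩
      have t := congrFun h₃ (q, r)
      rw [mulZW_pow_apply] at t
      rw [sub_sub_sub_cancel_left, shiftOp_sub_pow_apply]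
      rw [Pi.zero_apply, ← (sum_lie_eq_zero t (A.mode p x)).2]
      refine Finset.sum_congr rfl fun j hj => ?_
      have hj' : j ≤ N := by simpa [Nat.lt_succ_iff] using hj
      simp [H₂, eZ, eW, brk, Nat.cast_sub hj', add_sub_assoc])
  refine ⟨3 * N, ?_⟩
  ext1 ⟨q, r⟩
  have t := congrFun hD (p, q, r)
  rw [sub_sub_sub_cancel_left, shiftOp_sub_pow_apply] at t
  rw [mulZW_pow_apply, Pi.zero_apply]
  refine Eq.trans ?_ t
  refine Finset.sum_congr rfl fun j hj => ?_
  have hj' : j ≤ 3 * N := by simpa [Nat.lt_succ_iff] using hj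
  simp [G, eZ, eW, brk, Nat.cast_sub hj', add_sub_assoc]

/-- A field that is local with every field of `A` and kills the vacuum is zero. -/
theorem eq_zero_of_local (F : ℤ → Module.End ℂ V)
    (hF : ∀ b : V, ∃ N : ℕ, (mulZW ^ N) (brk F fun n => A.mode n b) = 0)
    (h0 : ∀ n, F n A.vac = 0) (n : ℤ) : F n = 0 := by
  ext b
  obtain ⟨N, hN⟩ := hF b
  have t := congrArg (fun T : Module.End ℂ V => T A.vac) (congrFun hN (n - N, -1))
  rw [mulZW_pow_apply] at t
  simp only [LinearMap.sum_apply, Pi.zero_apply, LinearMap.zero_apply, LinearMap.smul_apply,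
    brk, Ring.lie_def, LinearMap.sub_apply, Module.End.mul_apply, h0, map_zero, sub_zero] at t
  rw [Finset.sum_eq_single 0] at t
  · simpa [A.mode_neg_one_vac] using t
  · intro j _ hj
    rw [A.mode_apply_vac b (-1 + j) (by omega), map_zero, smul_zero]
  · simp

end VertexAlgebra

namespace ConformalVertexAlgebra

variable (A : ConformalVertexAlgebra V)

/-- The Virasoro modes `L_n`. -/
def vir (n : ℤ) : Module.End ℂ V := A.mode (n + 1) A.conf

theorem vir_comm_mode (a : V) (n : ℤ) :
    ⁅A.mode 1 A.conf, A.mode n a⁆ =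
      A.mode n (A.mode 1 A.conf a) - ((n : ℂ) + 1) • A.mode n a := by
  let F : ℤ → Module.End ℂ V := fun n => ⁅A.mode 1 A.conf, A.mode n a⁆ +
    (((n : ℂ) • A.mode n a + A.mode n a) - A.mode n (A.mode 1 A.conf a))
  have hL : ⁅A.mode 1 A.conf, A.del⁆ = A.del := by
    have := A.virasoro 0 (-1)
    simpa [A.conf_zero] using this
  suffices h : F n = 0 by
    rw [eq_sub_iff_add_eq, ← sub_eq_zero, ← h, add_smul, one_smul]
    simp only [F]
    abel
  refine A.eq_zero_of_local F ?_ ?_ n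
  · intro b
    obtain ⟨N₁, h₁⟩ := A.exists_mulZW_comm A.conf a b 1
    obtain ⟨N₂, h₂⟩ := A.exists_mulZW a b
    obtain ⟨N₃, h₃⟩ := A.exists_mulZW (A.mode 1 A.conf a) b
    have h₄ := mulZW_idxOp N₂ h₂
    set N := max N₁ (max (N₂ + 1) N₃)
    refine ⟨N, ?_⟩
    have e : (brk F fun n => A.mode n b) =
        (brk (fun n => ⁅A.mode 1 A.conf, A.mode n a⁆) fun n => A.mode n b) +
        ((idxOp (brk (fun n => A.mode n a) fun n => A.mode n b) +
          (brk (fun n => A.mode n a) fun n => A.mode n b)) -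
          (brk (fun n => A.mode n (A.mode 1 A.conf a)) fun n => A.mode n b)) := by
      ext1 u
      simp only [F, brk, idxOp, LinearMap.coe_mk, AddHom.coe_mk, Pi.add_apply, Pi.sub_apply,
        Ring.lie_def, smul_sub]
      simp only [add_mul, sub_mul, mul_add, mul_sub, smul_mul_assoc, mul_smul_comm]
      abel
    rw [e, map_add, map_sub, map_add, mulZW_mono (by omega) h₁, mulZW_mono (by omega) h₂,
      mulZW_mono (by omega) h₃, mulZW_mono (by omega) h₄]
    simp
  · have hv : A.mode 1 A.conf A.vac = 0 := A.mode_apply_vac _ 1 (by norm_num)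
    have hF : ∀ n : ℤ, F n A.vac = A.mode 1 A.conf (A.mode n a A.vac) +
        (((n : ℂ) • A.mode n a A.vac + A.mode n a A.vac) -
          A.mode n (A.mode 1 A.conf a) A.vac) := by
      intro n
      simp [F, Ring.lie_def, hv]
    have hdel : ∀ (x : V) (n : ℤ), A.del (A.mode n x A.vac) =
        (-n : ℂ) • A.mode (n - 1) x A.vac := by
      intro x n
      have := congrArg (fun T : Module.End ℂ V => T A.vac) (A.translation x n)
      simpa [Ring.lie_def, A.del_vac] using this
    have hneg : ∀ k : ℕ, F (-1 - k) A.vac = 0 := by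
      intro k
      induction k with
      | zero => rw [hF]; simp [A.mode_neg_one_vac]
      | succ k ih =>
        have hk : ((k : ℂ) + 1) ≠ 0 := by exact_mod_cast Nat.succ_ne_zero k
        rw [hF] at ih ⊢
        have t := congrArg A.del ih
        have c := fun x : V => congrArg (fun T : Module.End ℂ V => T x) hL
        have c' := c (A.mode (-1 - k) a A.vac)
        simp only [Ring.lie_def, LinearMap.sub_apply, Module.End.mul_apply] at c'
        have d : (-((-1 - k : ℤ) : ℂ)) = (k : ℂ) + 1 := by push_cast; ring
        have i : (-1 - k - 1 : ℤ) = -1 - ((k + 1 : ℕ) : ℤ) := by push_cast; ring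
        rw [hdel, map_smul] at c'
        rw [map_zero, map_add, map_sub, map_add, map_smul, hdel, hdel] at t
        rw [d, i] at t c'
        refine (smul_eq_zero_iff_right hk).1 (Eq.trans ?_ t)
        rw [sub_eq_iff_eq_add] at c'
        rw [smul_add, c']
        push_cast
        module
    intro n
    rcases lt_or_ge n 0 with h | h
    · obtain ⟨k, rfl⟩ : ∃ k : ℕ, n = -1 - k := ⟨(-1 - n).toNat, by omega⟩
      exact hneg k
    · rw [hF]
      simp [A.mode_apply_vac _ n h]

/-- The weight space `V_n`, the eigenspace of `L_0` with eigenvalue `n`. -/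
def wt (n : ℤ) : Submodule ℂ V := Module.End.eigenspace (A.vir 0) (n : ℂ)

theorem mem_wt {n : ℤ} {v : V} : v ∈ A.wt n ↔ A.mode 1 A.conf v = (n : ℂ) • v := by
  rw [wt, Module.End.mem_eigenspace_iff]; simp [vir]

theorem mode_mem_wt {p q : ℤ} {a v : V} (ha : a ∈ A.wt p) (hv : v ∈ A.wt q) (n : ℤ) :
    A.mode n a v ∈ A.wt (p + q - n - 1) := by
  rw [mem_wt] at *
  have := congrArg (fun T : Module.End ℂ V => T v) (A.vir_comm_mode a n)
  simp only [Ring.lie_def, LinearMap.sub_apply, Module.End.mul_apply, LinearMap.smul_apply, ha,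
    hv, map_smul] at this
  rw [sub_eq_iff_eq_add] at this
  rw [this]
  push_cast
  module

end ConformalVertexAlgebra

end Locality

/-! ### The Lie algebra of modes, the anti-involution and the restricted dual -/

namespace BoundedConformalVertexAlgebra

variable {V : Type*} [AddCommGroup V] [Module ℂ V] (A : BoundedConformalVertexAlgebra V)

theorem isInternal_wt : DirectSum.IsInternal A.wt := by
  refine DirectSum.isInternal_submodule_of_iSupIndep_of_iSup_eq_top ?_ ?_
  · exact (Module.End.eigenspaces_iSupIndep (A.vir 0)).comp Int.cast_injective
  · rw [eq_top_iff, ← A.diag]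
    refine iSup_le fun μ => ?_
    by_cases h : Module.End.HasEigenvalue (A.mode 1 A.conf) μ
    · obtain ⟨_, hN⟩ := A.weights
      obtain ⟨n, -, rfl⟩ := hN μ h
      exact le_iSup_of_le n (le_of_eq (by simp [ConformalVertexAlgebra.wt,
        ConformalVertexAlgebra.vir]))
    · rw [Module.End.hasEigenvalue_iff, not_not] at h
      rw [h]
      exact bot_le

/-- The component of weight `n` of a vector, with respect to `V = ⨁ V_n`. -/
def comp (n : ℤ) (v : V) : V :=
  ((LinearEquiv.ofBijective (DirectSum.coeLinearMap A.wt) A.isInternal_wt).symm v n : A.wt n)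

/-- Finite formal combinations `∑ b_(n)` of Fourier modes: `Finsupp.single n b` stands for
`b_(n)`. -/
abbrev Modes (_ : BoundedConformalVertexAlgebra V) : Type _ := ℤ →₀ V

/-- The operator on `V` defined by a combination of modes; its range is the Lie algebra
`Lie(V) ⊆ End(V)` of all Fourier modes. -/
def op (X : A.Modes) : Module.End ℂ V := X.sum fun n b => A.mode n b

/-- The anti-involution `η` induced by the coordinate change `z ↦ 1/z`, that is
`η(b(z)) = ((e^{z L_1} (-z^{-2})^{L_0} b))(z^{-1})`. For `b` of weight `p` this reads
`η(b_(n)) = ∑_j (-1)^p / j! (L_1^j b)_(2p - j - n - 2)`. The family in the inner sum has finite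
support, since `L_1` lowers the weight by one. -/
def eta (X : A.Modes) : A.Modes :=
  X.sum fun n b => ∑ᶠ r : ℤ × ℕ, Finsupp.single (2 * r.1 - r.2 - n - 2)
    (((-1 : ℂ) ^ r.1 / (r.2.factorial : ℂ)) • ((A.vir 1) ^ r.2) (A.comp r.1 b))

/-- The restricted dual `D(V) = ⨁ (V_n)^*`: the functionals on `V` that vanish on all but
finitely many of the weight spaces `V_n`. -/
def restrictedDual : Submodule ℂ (Module.Dual ℂ V) where
  carrier := {y | {n : ℤ | ∃ v ∈ A.wt n, y v ≠ 0}.Finite}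
  zero_mem' := by simp
  add_mem' := by
    intro y y' h h'
    refine (h.union h').subset ?_
    rintro n ⟨v, hv, hn⟩
    by_contra hc
    simp only [Set.mem_union, Set.mem_ofPred_eq, not_or, not_exists, not_and, not_not] at hc
    exact hn (by rw [LinearMap.add_apply, hc.1 v hv, hc.2 v hv, add_zero])
  smul_mem' := by
    intro c y h
    refine h.subset ?_
    rintro n ⟨v, hv, hn⟩
    exact ⟨v, hv, fun h0 => hn (by rw [LinearMap.smul_apply, h0, smul_zero])⟩

theorem comp_mode_mem (y : A.restrictedDual) (n : ℤ) (b : V) :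
    (y : Module.Dual ℂ V) ∘ₗ A.mode n b ∈ A.restrictedDual := by
  have hb : b ∈ ⨆ p : ℤ, A.wt p := by
    rw [A.isInternal_wt.submodule_iSup_eq_top]; trivial
  induction hb using Submodule.iSup_induction' with
  | mem p b hb =>
    refine (y.2.image fun q => q - p + n + 1).subset ?_
    rintro q ⟨v, hv, hn⟩
    exact ⟨p + q - n - 1, ⟨_, A.mode_mem_wt hb hv n, hn⟩, by ring⟩
  | zero => simp
  | add b b' _ _ h h' =>
    rw [map_add, LinearMap.comp_add]
    exact add_mem h h'

theorem comp_op_mem (y : A.restrictedDual) (X : A.Modes) :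
    (y : Module.Dual ℂ V) ∘ₗ A.op X ∈ A.restrictedDual := by
  have e : (y : Module.Dual ℂ V) ∘ₗ A.op X =
      ∑ n ∈ X.support, (y : Module.Dual ℂ V) ∘ₗ A.mode n (X n) := by
    ext v; simp [op, Finsupp.sum]
  rw [e]
  exact sum_mem fun n _ => A.comp_mode_mem y n (X n)

/-- The action of modes on `D(V)`: `(X y)(v) = y(η(X) v)`. -/
def dualAct (X : A.Modes) (y : A.restrictedDual) : A.restrictedDual :=
  ⟨(y : Module.Dual ℂ V) ∘ₗ A.op (A.eta X), A.comp_op_mem y _⟩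

/-! ### Sections outside of the marked points and their localizations -/

/-- The Laurent expansion of a rational function `f(z)` in the coordinate `T = z - p`. -/
def expandAt (p : ℂ) (f : RatFunc ℂ) : LaurentSeries ℂ :=
  f.eval (algebraMap ℂ (LaurentSeries ℂ)) (HahnSeries.single 1 1 + algebraMap ℂ _ p)

/-- The Laurent expansion of a rational function `f(z)` in the coordinate `T = 1/z`. -/
def expandInfty (f : RatFunc ℂ) : LaurentSeries ℂ :=
  f.eval (algebraMap ℂ (LaurentSeries ℂ)) (HahnSeries.single (-1) 1)

/-- The action on `V`, placed at the point `p` with coordinate `z - p`, of the localization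
`i_p(B ⊗ f) = ∑_k f_k B_(k)`, where `f = ∑_k f_k (z - p)^k`. The sum applied to a vector is
finite. -/
def actAt (p : ℂ) (B : V) (f : RatFunc ℂ) (v : V) : V :=
  ∑ᶠ k : ℤ, (expandAt p f).coeff k • A.mode k B v

/-- The action on `D(V)`, placed at `∞` with coordinate `1/z`, of the localization
`i_∞(B ⊗ f) = ∑_k f_k (-η(B_(k)))`, where `f = ∑_k f_k z^k` near `∞`. The sum applied to an
element of `D(V)` is finite. -/
def actInfty (B : V) (f : RatFunc ℂ) (y : A.restrictedDual) : A.restrictedDual :=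
  ∑ᶠ k : ℤ, (expandInfty f).coeff (-k) • A.dualAct (-A.eta (Finsupp.single k B)) y

/-- The space `D(V) ⊗ V^{⊗(k+1)}`. -/
abbrev Tens (k : ℕ) : Type _ := A.restrictedDual ⊗[ℂ] (⨂[ℂ] _ : Fin (k + 1), V)

/-- The pure tensor `y ⊗ a_0 ⊗ ⋯ ⊗ a_k`. -/
def pure {k : ℕ} (y : A.restrictedDual) (a : Fin (k + 1) → V) : A.Tens k :=
  y ⊗ₜ[ℂ] PiTensorProduct.tprod ℂ a

end BoundedConformalVertexAlgebra

/-- The finite marked points `z_0, …, z_{k-1}, 0`. -/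
def markedPts {k : ℕ} (z : Fin k → ℂ) : Fin (k + 1) → ℂ := Fin.snoc z 0

/-- The configuration space of pairwise distinct points of `ℂ \ {0}`. -/
def Config (k : ℕ) : Set (Fin k → ℂ) := {z | Function.Injective z ∧ ∀ i, z i ≠ 0}

/-- The region `|z_0| > |z_1| > ⋯ > |z_{k-1}| > 0`. -/
def OrderedRegion (k : ℕ) : Set (Fin k → ℂ) :=
  {z | (∀ i j, i < j → ‖z j‖ < ‖z i‖) ∧ ∀ i, z i ≠ 0}

/-- Rational functions on `ℂℙ¹` without poles outside of `∞, z_0, …, z_{k-1}, 0`. -/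
def RegularOutside {k : ℕ} (z : Fin k → ℂ) (f : RatFunc ℂ) : Prop :=
  ∀ x : ℂ, f.denom.eval x = 0 → x ∈ Set.range (markedPts z)

namespace BoundedConformalVertexAlgebra

variable {V : Type*} [AddCommGroup V] [Module ℂ V] (A : BoundedConformalVertexAlgebra V)

/-- The space of conformal blocks `⟨D(V), V, …, V⟩(∞, z_0, …, z_{k-1}, 0)`: the functionals on
`D(V) ⊗ V^{⊗(k+1)}` that are invariant under `Lie(V)_out`. The elements of `Lie(V)_out` are the
sums of sections `B ⊗ f`, with `B ∈ V` and `f` a rational function regular outside of the marked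
points, taken modulo total derivatives `∂B ⊗ f + B ⊗ f'` and modulo the sections `|0⟩ ⊗ f`.
Invariance is required here under all sections `B ⊗ f`, hence under every class. -/
def conformalBlocks {k : ℕ} (z : Fin k → ℂ) : Submodule ℂ (Module.Dual ℂ (A.Tens k)) where
  carrier := {φ | ∀ (B : V) (f : RatFunc ℂ), RegularOutside z f →
    ∀ (y : A.restrictedDual) (a : Fin (k + 1) → V),
      φ (A.pure (A.actInfty B f y) a) +
        ∑ t, φ (A.pure y (Function.update a t (A.actAt (markedPts z t) B f (a t)))) = 0}
  zero_mem' := by intro B f _ y a; simp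
  add_mem' := by
    intro φ ψ h h' B f hf y a
    have e := congrArg₂ (· + ·) (h B f hf y a) (h' B f hf y a)
    simp only [add_zero] at e
    simp only [LinearMap.add_apply, Finset.sum_add_distrib]
    rw [← e]; abel
  smul_mem' := by
    intro c φ h B f hf y a
    simp only [LinearMap.smul_apply, ← Finset.smul_sum, ← smul_add]
    rw [h B f hf y a, smul_zero]

/-- The vector `(a_0)_(n_0) ((a_1)_(n_1) ⋯ ((a_{k-1})_(n_{k-1}) a_k))`. -/
def iterMode {k : ℕ} (a : Fin (k + 1) → V) (n : Fin k → ℤ) : V :=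
  (List.ofFn fun i : Fin k => A.mode (n i) (a i.castSucc)).prod (a (Fin.last k))

/-- `Φ_z(y, a_0, …, a_k)` is the matrix element `y(a_0(z_0) a_1(z_1) ⋯ a_{k-1}(z_{k-1}) a_k)`:
for `|z_0| > ⋯ > |z_{k-1}| > 0` it is the sum of the (absolutely convergent) multiple Laurent
series, and on the configuration space it is given by a rational function, whose only poles are
at `z_i = 0` and `z_i = z_j`. -/
structure IsMatrixElement {k : ℕ} (Φ : (Fin k → ℂ) → Module.Dual ℂ (A.Tens k)) : Prop where
  hasSum : ∀ z ∈ OrderedRegion k, ∀ (y : A.restrictedDual) (a : Fin (k + 1) → V),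
    HasSum (fun n : Fin k → ℤ =>
      (∏ i, z i ^ (-n i - 1)) * (y : Module.Dual ℂ V) (A.iterMode a n)) (Φ z (A.pure y a))
  rational : ∀ (y : A.restrictedDual) (a : Fin (k + 1) → V),
    ∃ (N : ℕ) (P : MvPolynomial (Fin k) ℂ), ∀ z ∈ Config k,
      Φ z (A.pure y a) = MvPolynomial.eval z P /
        ((∏ i, z i ^ N) * ∏ i, ∏ j ∈ Finset.Ioi i, (z i - z j) ^ N)

/-- The operator `L_{-1}^{(t)}` on `D(V) ⊗ V^{⊗(k+1)}`: `L_{-1}` acting on the factor `V`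
attached to the point `z_t`. -/
def virNegOneAt {k : ℕ} (t : Fin k) : A.Tens k →ₗ[ℂ] A.Tens k :=
  LinearMap.lTensor _
    (PiTensorProduct.map (Function.update (fun _ => LinearMap.id) t.castSucc (A.vir (-1))))

/-- A family `Φ_z` of functionals on `D(V) ⊗ V^{⊗(k+1)}` is a horizontal section of the bundle of
conformal blocks over the configuration space: each `Φ_z` is a conformal block, and
`(∂/∂z_t - L_{-1}^{(t)}) Φ = 0` for every `t`, where `L_{-1}^{(t)}` acts on functionals by
`(L_{-1}^{(t)} φ)(ξ) = φ(L_{-1}^{(t)} ξ)`. -/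
structure IsHorizontalSection {k : ℕ} (Φ : (Fin k → ℂ) → Module.Dual ℂ (A.Tens k)) : Prop where
  mem : ∀ z ∈ Config k, Φ z ∈ A.conformalBlocks z
  horizontal : ∀ z ∈ Config k, ∀ (t : Fin k) (ξ : A.Tens k),
    HasDerivAt (fun w : ℂ => Φ (Function.update z t w) ξ) (Φ z (A.virNegOneAt t ξ)) (z t)

end BoundedConformalVertexAlgebra

end

/-!
The matrix element is constructed without appeal to the convergence of iterated series. For
`k` fields at pairwise distinct points, `corr k z y a` is defined by recursion: the first field
`a_0(z_0)` is split into creation modes, which are moved to the left and absorbed into the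
functional `y`, and annihilation modes, which are moved to the right through the remaining fields
and produce the singular terms `(z_0 - z_s)^(-j-1) (a_0)_(j) a_s` of the commutator formula. Since
the weights are bounded below, all sums are finite, so `corr` is visibly a rational function with
poles only on the diagonals (`corr_mem_confAlg`). Expanding the factors `(z_0 - z_s)^(-j-1)` in the
region `|z_0| > |z_1| > ⋯` shows that the multiple Laurent series of `y(a_0(z_0) ⋯ a_{k-1}(z_{k-1})
|0⟩)` converges absolutely to it (`hasSum_corr`). The functional of the theorem is `corr` at the
points `z_0, …, z_{k-1}, 0`: at the last point only the mode `a_(-1)` contributes, and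
`a_(-1)|0⟩ = a`.

The remaining properties rest on the identity principle `eq_of_ordered`: a rational function with
poles on the diagonals is determined by its values in the ordered region. It gives multilinearity
(`corrLin`) and, in the form for the configuration space of nonzero points, uniqueness
(`IsMatrixElement.eq`). Locality enters through `hasSum_peel_ins`: inserting `B(x)` by the formula of
the recursion to the left of `a_0(z_0)`, but expanding for `|x| < |z_0|`, amounts to inserting it to
the right of `a_0(z_0)`, because the commutators of the creation part of `B(x)` with `a_0(z_0)` sum up
to the singular terms at `x = z_0`. Hence `corr` is symmetric in its first two fields (`corr_swap`).
Peeling and swapping reduce the normally ordered product `(B_(-1) a_t)(z_t)` to the case of a single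
field, which is a computation with the vacuum; this gives `corr_normal`, and then `corr_mode_neg`,
which evaluates a function with `B_(-m-1)` acting at `z_t` in terms of `B` acting on `y` and at the
other points.

The Ward identity (`ward`) is linear in the section `B ⊗ f`, so by partial fractions
(`mem_partialFractions`) it suffices to treat `f = z^n` and `f = (z - z_t)^(-m-1)`. The former says
that a nonnegative mode moves through all the fields to the vacuum, which it kills
(`corr_rmul_nat`), the latter is `corr_mode_neg`. Here `η` being an involution
(`dualAct_neg_eta_single`) turns the action at `∞` into composition of `y` with modes of `B`.
Horizontality (`hasDerivAt_corr`) results from writing the field at `z_t` as `a_(-1)|0⟩`, and its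
derivative as `a_(-2)|0⟩`: since the position of a vacuum is irrelevant, `corr_mode_neg` displays the
dependence on `z_t` explicitly.
-/

noncomputable section

/-! ### Newton interpolation on `ℤ` -/

section Newton

variable {E : Type*} [AddCommGroup E] [Module ℂ E]

/-- The forward difference operator on functions on `ℤ`. -/
def diffOp : Module.End ℂ (ℤ → E) := shiftOp (1 : ℤ) - shiftOp (0 : ℤ)

theorem diffOp_apply (g : ℤ → E) (m : ℤ) : diffOp g m = g (m + 1) - g m := by
  simp [diffOp, shiftOp_apply]

/-- Newton's interpolation formula: a function on `ℤ` killed by a power of the difference operator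
is a polynomial, also at negative arguments. -/
theorem newton_interpolation (N : ℕ) (g : ℤ → E) (h : (diffOp ^ N) g = 0) (m : ℤ) :
    g m = ∑ j ∈ Finset.range N, ((Ring.choose m j : ℤ) : ℂ) • (diffOp ^ j) g 0 := by
  induction N generalizing g m with
  | zero => simpa using congrFun h m
  | succ N ih =>
    have h1 := ih (diffOp g) (by rw [← Module.End.mul_apply, ← pow_succ]; exact h)
    have h2 : ∀ j, (diffOp ^ j) (diffOp g) = (diffOp ^ (j + 1)) g := fun j => by
      rw [← Module.End.mul_apply, ← pow_succ]
    simp only [h2] at h1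
    set G : ℤ → E := fun m =>
      ∑ j ∈ Finset.range (N + 1), ((Ring.choose m j : ℤ) : ℂ) • (diffOp ^ j) g 0 with hG
    have h3 : ∀ m, G (m + 1) - G m = g (m + 1) - g m := by
      intro m
      rw [← diffOp_apply g, h1, hG]
      simp only [Finset.sum_range_succ' _ N, Ring.choose_zero_right]
      rw [add_sub_add_right_eq_sub, ← Finset.sum_sub_distrib]
      refine Finset.sum_congr rfl fun j _ => ?_
      rw [Ring.choose_succ_succ, Int.cast_add, add_smul, add_sub_cancel_right]
    have h0 : G 0 = g 0 := by
      simp only [hG]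
      rw [Finset.sum_range_succ', Finset.sum_eq_zero]
      · simp
      · intro j _
        rw [Ring.choose_zero_succ]; simp
    change g m = G m
    induction m with
    | zero => exact h0.symm
    | succ i hi =>
      have := h3 i
      rw [hi] at this
      exact (sub_left_inj.1 this).symm
    | pred i hi =>
      have := h3 (-i - 1)
      rw [sub_add_cancel, hi] at this
      exact (sub_right_inj.1 this).symm

end Newton

/-! ### The commutator formula -/

section Commutator

variable {V : Type*} [AddCommGroup V] [Module ℂ V]

theorem mulZW_brk_shift {N : ℕ} {f g : ℤ → Module.End ℂ V} (h : (mulZW ^ N) (brk f g) = 0)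
    (d : ℤ) : (mulZW ^ N) (brk (fun n => f (n + d)) g) = 0 := by
  have e : brk (fun n => f (n + d)) g = shiftOp ((d, 0) : ℤ × ℤ) (brk f g) := by
    ext1 u; simp [brk, shiftOp_apply]
  have c : Commute (mulZW (V := V)) (shiftOp ((d, 0) : ℤ × ℤ)) :=
    (shiftOp_commute _ _).sub_left (shiftOp_commute _ _)
  rw [e, ← Module.End.mul_apply, (c.pow_left N).eq, Module.End.mul_apply, h, map_zero]

namespace VertexAlgebra

variable (A : VertexAlgebra V)

/-- A sequence of operators is local with `A` if it is local with every field of `A`. -/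
def LocalWith (F : ℤ → Module.End ℂ V) : Prop :=
  ∀ b : V, ∃ N : ℕ, (mulZW ^ N) (brk F fun n => A.mode n b) = 0

variable {A}

theorem LocalWith.shift {F : ℤ → Module.End ℂ V} (h : A.LocalWith F) (d : ℤ) :
    A.LocalWith fun n => F (n + d) := fun b => by
  obtain ⟨N, hN⟩ := h b
  exact ⟨N, mulZW_brk_shift hN d⟩

theorem LocalWith.add {F G : ℤ → Module.End ℂ V} (hF : A.LocalWith F) (hG : A.LocalWith G) :
    A.LocalWith fun n => F n + G n := fun b => by
  obtain ⟨N, hN⟩ := hF b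
  obtain ⟨M, hM⟩ := hG b
  refine ⟨max N M, ?_⟩
  have e : brk (fun n => F n + G n) (fun n => A.mode n b) =
      brk F (fun n => A.mode n b) + brk G fun n => A.mode n b := by
    ext1 u
    simp only [brk, Pi.add_apply, Ring.lie_def, add_mul, mul_add]
    abel
  rw [e, map_add, mulZW_mono (le_max_left _ _) hN, mulZW_mono (le_max_right _ _) hM, add_zero]

theorem LocalWith.smul {F : ℤ → Module.End ℂ V} (hF : A.LocalWith F) (c : ℂ) :
    A.LocalWith fun n => c • F n := fun b => by
  obtain ⟨N, hN⟩ := hF b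
  refine ⟨N, ?_⟩
  have e : brk (fun n => c • F n) (fun n => A.mode n b) = c • brk F (fun n => A.mode n b) := by
    ext1 u; simp [brk, Ring.lie_def, smul_sub]
  rw [e, map_smul, hN, smul_zero]

theorem LocalWith.sum {ι : Type*} (s : Finset ι) {F : ι → ℤ → Module.End ℂ V}
    (h : ∀ i ∈ s, A.LocalWith (F i)) : A.LocalWith fun n => ∑ i ∈ s, F i n := by
  classical
  induction s using Finset.induction_on with
  | empty => exact fun b => ⟨0, by ext1 u; simp [brk, Ring.lie_def]⟩
  | insert i s hi ih =>
    simp only [Finset.sum_insert hi]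
    exact (h i (by simp)).add (ih fun j hj => h j (by simp [hj]))

variable (A)

theorem localWith_mode (a : V) : A.LocalWith fun n => A.mode n a := A.exists_mulZW a

theorem localWith_comm (x a : V) (p : ℤ) : A.LocalWith fun n => ⁅A.mode p x, A.mode n a⁆ :=
  fun b => A.exists_mulZW_comm x a b p

theorem del_mode_apply (a : V) (n : ℤ) (v : V) :
    A.del (A.mode n a v) = A.mode n a (A.del v) - (n : ℂ) • A.mode (n - 1) a v := by
  have := congrArg (fun T : Module.End ℂ V => T v) (A.translation a n)
  simp only [Ring.lie_def, LinearMap.sub_apply, Module.End.mul_apply, LinearMap.smul_apply] at this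
  rw [sub_eq_iff_eq_add] at this
  rw [this]
  module

theorem del_mode_vac (a : V) (n : ℤ) :
    A.del (A.mode n a A.vac) = -(n : ℂ) • A.mode (n - 1) a A.vac := by
  rw [del_mode_apply, A.del_vac, map_zero]
  module

/-- The operator product `Res_z (z - w)^j [a(z), b(w)]`, for `j ≥ 0`, is the field of `a_(j) b`:
both fields are local with `A` and create the same vectors from the vacuum. -/
theorem sum_comm_eq_mode (a b : V) (j : ℕ) (n : ℤ) :
    ∑ i ∈ Finset.range (j + 1), ((-1 : ℂ) ^ i * (j.choose i : ℂ)) •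
      ⁅A.mode (j - i) a, A.mode (n + i) b⁆ = A.mode n (A.mode j a b) := by
  set F : ℤ → Module.End ℂ V := fun n => (∑ i ∈ Finset.range (j + 1),
      ((-1 : ℂ) ^ i * (j.choose i : ℂ)) • ⁅A.mode (j - i) a, A.mode (n + i) b⁆) +
        (-1 : ℂ) • A.mode n (A.mode j a b) with hFdef
  suffices h : F n = 0 by
    rw [← sub_eq_zero, ← h, hFdef]
    simp only [neg_one_smul, sub_eq_add_neg]
  have hF : ∀ n, F n A.vac = (∑ i ∈ Finset.range (j + 1),
      ((-1 : ℂ) ^ i * (j.choose i : ℂ)) • A.mode (j - i) a (A.mode (n + i) b A.vac)) -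
        A.mode n (A.mode j a b) A.vac := by
    intro n
    rw [show F n = _ from rfl, LinearMap.add_apply, LinearMap.sum_apply, LinearMap.smul_apply,
      neg_one_smul, ← sub_eq_add_neg]
    congr 1
    refine Finset.sum_congr rfl fun i hi => ?_
    have hi' : i ≤ j := by simpa [Nat.lt_succ_iff] using hi
    rw [LinearMap.smul_apply, Ring.lie_def, LinearMap.sub_apply, Module.End.mul_apply,
      Module.End.mul_apply, A.mode_apply_vac a (j - i) (by omega), map_zero, sub_zero]
  refine A.eq_zero_of_local F ?_ ?_ n
  · have h1 : ∀ i ∈ Finset.range (j + 1), A.LocalWith fun n =>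
        ((-1 : ℂ) ^ i * (j.choose i : ℂ)) • ⁅A.mode (j - i) a, A.mode (n + i) b⁆ := fun i _ =>
      ((A.localWith_comm a b (j - i)).shift (i : ℤ)).smul ((-1 : ℂ) ^ i * (j.choose i : ℂ))
    have h2 := (A.localWith_mode (A.mode j a b)).smul (-1)
    exact (LocalWith.sum _ h1).add h2
  · have hdel : ∀ n, A.del (F n A.vac) = -(n : ℂ) • F (n - 1) A.vac := by
      intro n
      rw [hF, hF, map_sub, del_mode_vac, smul_sub]
      congr 1
      rw [map_sum, Finset.smul_sum]
      set f : ℕ → V := fun i => ((-1 : ℂ) ^ i * (j.choose i : ℂ) * i) •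
        A.mode (j - i) a (A.mode (n - 1 + i) b A.vac) with hf
      have h1 : ∑ i ∈ Finset.range (j + 1), f (i + 1) = ∑ i ∈ Finset.range (j + 1), f i := by
        have := Finset.sum_range_succ' f (j + 1)
        rw [Finset.sum_range_succ] at this
        simpa [hf] using this.symm
      have h2 : ∀ i ∈ Finset.range (j + 1), A.del (((-1 : ℂ) ^ i * (j.choose i : ℂ)) •
          A.mode (j - i) a (A.mode (n + i) b A.vac)) = f (i + 1) + (-(n : ℂ) •
          ((-1 : ℂ) ^ i * (j.choose i : ℂ)) •
            A.mode (j - i) a (A.mode (n - 1 + i) b A.vac) - f i) := by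
        intro i hi
        have hi' : i ≤ j := by simpa [Nat.lt_succ_iff] using hi
        have hc : ((j.choose (i + 1) : ℕ) : ℂ) * ((i : ℂ) + 1) = (j.choose i : ℂ) * (j - i) := by
          have := Nat.choose_succ_right_eq j i
          rw [← Nat.cast_sub hi']
          exact_mod_cast this
        simp only [hf]
        rw [map_smul, del_mode_apply, del_mode_vac, map_smul]
        have e1 : n + (i : ℤ) - 1 = n - 1 + i := by ring
        have e2 : n - 1 + ((i + 1 : ℕ) : ℤ) = n + i := by push_cast; ring
        have e3 : (j : ℤ) - ((i + 1 : ℕ) : ℤ) = j - i - 1 := by push_cast; ring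
        rw [e1, e2, e3, pow_succ, Nat.cast_succ, mul_assoc ((-1 : ℂ) ^ i * -1), hc]
        push_cast
        module
      rw [Finset.sum_congr rfl h2, Finset.sum_add_distrib, Finset.sum_sub_distrib, h1]
      abel
    have hneg : ∀ r : ℕ, F (-1 - r) A.vac = 0 := by
      intro r
      induction r with
      | zero =>
        rw [hF, Finset.sum_eq_single_of_mem 0 (by simp)]
        · simp [A.mode_neg_one_vac]
        · intro i _ hi
          rw [A.mode_apply_vac b _ (by push_cast; omega), map_zero, smul_zero]
      | succ r ih =>
        have := hdel (-1 - r)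
        have hr : (-((-1 - r : ℤ) : ℂ)) ≠ 0 := by
          push_cast
          rw [neg_sub, sub_neg_eq_add]
          exact_mod_cast Nat.succ_ne_zero r
        rw [ih, map_zero, eq_comm, smul_eq_zero_iff_right hr] at this
        rw [← this]
        congr 2
        push_cast; ring
    intro n
    rcases lt_or_ge n 0 with h | h
    · obtain ⟨r, rfl⟩ : ∃ r : ℕ, n = -1 - r := ⟨(-1 - n).toNat, by omega⟩
      exact hneg r
    · rw [hF, A.mode_apply_vac _ n h, sub_zero]
      refine Finset.sum_eq_zero fun i _ => ?_
      rw [A.mode_apply_vac b _ (by omega), map_zero, smul_zero]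

theorem exists_mode_nat_eq_zero (a b : V) : ∃ J : ℕ, ∀ j : ℕ, J ≤ j → A.mode j a b = 0 := by
  obtain ⟨N, hN⟩ := A.field a b
  exact ⟨N.toNat, fun j hj => hN j (by omega)⟩

/-- The commutator formula `[a_(m), b_(n)] = ∑_j (m choose j) (a_(j) b)_(m+n-j)`. -/
theorem comm_mode (a b : V) {J : ℕ} (hJ : ∀ j : ℕ, J ≤ j → A.mode j a b = 0) (m n : ℤ) :
    ⁅A.mode m a, A.mode n b⁆ = ∑ j ∈ Finset.range J,
      ((Ring.choose m j : ℤ) : ℂ) • A.mode (m + n - j) (A.mode j a b) := by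
  obtain ⟨N, hN⟩ := A.locality a b
  set g : ℤ → Module.End ℂ V := fun p => ⁅A.mode p a, A.mode (m + n - p) b⁆ with hg
  have hd : ∀ (j : ℕ) (p : ℤ), (diffOp ^ j) g p = ∑ i ∈ Finset.range (j + 1),
      ((-1 : ℂ) ^ i * (j.choose i : ℂ)) • ⁅A.mode (p + j - i) a, A.mode (m + n - p - j + i) b⁆ := by
    intro j p
    rw [diffOp, shiftOp_sub_pow_apply]
    refine Finset.sum_congr rfl fun i hi => ?_
    have hi' : i ≤ j := by simpa [Nat.lt_succ_iff] using hi
    simp only [hg, nsmul_eq_mul, mul_one, mul_zero, add_zero, Nat.cast_sub hi']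
    congr 3
    · congr 1; ring
    · congr 1; ring
  have h0 : (diffOp ^ N) g = 0 := by
    ext1 p
    rw [hd, Pi.zero_apply, ← hN p (m + n - p - N)]
  have hz : ∀ j : ℕ, (diffOp ^ j) g 0 = A.mode (m + n - j) (A.mode j a b) := by
    intro j
    rw [hd, ← sum_comm_eq_mode]
    simp
  have key : ∀ M : ℕ, N ≤ M → ⁅A.mode m a, A.mode n b⁆ = ∑ j ∈ Finset.range M,
      ((Ring.choose m j : ℤ) : ℂ) • A.mode (m + n - j) (A.mode j a b) := by
    intro M hM
    have h1 : (diffOp ^ M) g = 0 := by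
      obtain ⟨i, rfl⟩ := Nat.exists_eq_add_of_le' hM
      rw [pow_add, Module.End.mul_apply, h0, map_zero]
    have := newton_interpolation M g h1 m
    simp only [hz] at this
    rw [← this]
    simp [hg]
  rw [key (max N J) (le_max_left _ _)]
  symm
  refine Finset.sum_subset (Finset.range_subset_range.2 (le_max_right _ _)) fun j _ hj => ?_
  rw [hJ j (by simpa using hj), map_zero, smul_zero]

end VertexAlgebra

namespace ConformalVertexAlgebra

variable (A : ConformalVertexAlgebra V)

/-- `(∂a)_(n) = -n a_(n-1)`: the commutator formula for `∂ = L_{-1}` compared with translation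
covariance. -/
theorem mode_del (a : V) (n : ℤ) : A.mode n (A.del a) = -(n : ℂ) • A.mode (n - 1) a := by
  obtain ⟨J, hJ⟩ := A.exists_mode_nat_eq_zero A.conf a
  have h := A.comm_mode A.conf a (J := J + 1) (fun j hj => hJ j (by omega)) 0 n
  rw [Finset.sum_range_succ', Finset.sum_eq_zero, A.conf_zero, A.translation] at h
  · simpa [A.conf_zero] using h.symm
  · intro j _
    rw [Ring.choose_zero_succ]; simp

/-- The coefficients of `(B_(-1) a)(z)|0⟩ = B_+(z) a(z)|0⟩`, where `B_+(z) = ∑_{n<0} B_(n) z^{-n-1}`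
is the creation part of `B(z)`. Both
sides satisfy the recursion in `N` that results from applying `∂`, and they agree for `N = 0`. -/
theorem mode_mode_neg_one_vac (B a : V) (N : ℕ) :
    A.mode (-N - 1) (A.mode (-1) B a) A.vac =
      ∑ p ∈ Finset.HasAntidiagonal.antidiagonal N, A.mode (-p.1 - 1) B (A.mode (-p.2 - 1) a A.vac) := by
  induction N with
  | zero => simp [A.mode_neg_one_vac]
  | succ N ih =>
    have h := congrArg A.del ih
    have hN : ((N : ℂ) + 1) ≠ 0 := by exact_mod_cast Nat.succ_ne_zero N
    rw [A.del_mode_vac, map_sum] at h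
    have e : ∀ n : ℕ, (-(n : ℤ) - 1 - 1) = -((n + 1 : ℕ) : ℤ) - 1 := fun n => by push_cast; ring
    have c : ∀ n : ℕ, -((-(n : ℤ) - 1 : ℤ) : ℂ) = (n : ℂ) + 1 := fun n => by push_cast; ring
    rw [e, c] at h
    rw [← smul_right_injective V hN |>.eq_iff, h]
    set f : ℕ × ℕ → V := fun p => A.mode (-p.1 - 1) B (A.mode (-p.2 - 1) a A.vac) with hf
    have h1 : ∀ p ∈ Finset.HasAntidiagonal.antidiagonal N, A.del (f p) =
        (((p.1 + 1 : ℕ) : ℂ)) • f (p.1 + 1, p.2) + ((p.2 + 1 : ℕ) : ℂ) • f (p.1, p.2 + 1) := by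
      intro p _
      simp only [hf]
      rw [A.del_mode_apply, A.del_mode_vac, map_smul, e, e, c, sub_eq_add_neg, ← neg_smul, c,
        add_comm]
      push_cast
      rfl
    change ∑ p ∈ Finset.HasAntidiagonal.antidiagonal N, A.del (f p) =
      ((N : ℂ) + 1) • ∑ p ∈ Finset.HasAntidiagonal.antidiagonal (N + 1), f p
    rw [Finset.sum_congr rfl h1, Finset.sum_add_distrib]
    have s1 : ∑ p ∈ Finset.HasAntidiagonal.antidiagonal N, ((p.1 + 1 : ℕ) : ℂ) • f (p.1 + 1, p.2) =
        ∑ p ∈ Finset.HasAntidiagonal.antidiagonal (N + 1), (p.1 : ℂ) • f p := by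
      rw [Finset.Nat.sum_antidiagonal_succ (f := fun p => (p.1 : ℂ) • f p)]
      simp
    have s2 : ∑ p ∈ Finset.HasAntidiagonal.antidiagonal N, ((p.2 + 1 : ℕ) : ℂ) • f (p.1, p.2 + 1) =
        ∑ p ∈ Finset.HasAntidiagonal.antidiagonal (N + 1), (p.2 : ℂ) • f p := by
      rw [Finset.Nat.sum_antidiagonal_succ' (f := fun p => (p.2 : ℂ) • f p)]
      simp
    rw [s1, s2, ← Finset.sum_add_distrib, Finset.smul_sum]
    refine Finset.sum_congr rfl fun p hp => ?_
    rw [← add_smul, ← Nat.cast_add, Finset.HasAntidiagonal.mem_antidiagonal.1 hp, Nat.cast_succ]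

end ConformalVertexAlgebra

end Commutator

/-! ### Rational functions of several variables -/

section Rational

open MvPolynomial

variable {σ τ : Type*}

/-- The functions on `ℂ^σ` that coincide with `P / D^N`, for a polynomial `P` and some `N`, where
`D` does not vanish. There is no condition on the values at the zeros of `D`. -/
def ratAlg (D : MvPolynomial σ ℂ) : Subalgebra ℂ ((σ → ℂ) → ℂ) where
  carrier := {F | ∃ (N : ℕ) (P : MvPolynomial σ ℂ), ∀ z, eval z D ≠ 0 →
    F z = eval z P / eval z D ^ N}
  mul_mem' := by
    rintro F G ⟨N, P, hP⟩ ⟨M, Q, hQ⟩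
    refine ⟨N + M, P * Q, fun z hz => ?_⟩
    rw [Pi.mul_apply, hP z hz, hQ z hz, map_mul, pow_add, div_mul_div_comm]
  add_mem' := by
    rintro F G ⟨N, P, hP⟩ ⟨M, Q, hQ⟩
    refine ⟨N + M, P * D ^ M + Q * D ^ N, fun z hz => ?_⟩
    rw [Pi.add_apply, hP z hz, hQ z hz, map_add, map_mul, map_mul, map_pow, map_pow, pow_add,
      div_add_div _ _ (pow_ne_zero _ hz) (pow_ne_zero _ hz), mul_comm (eval z D ^ N) (eval z Q)]
  algebraMap_mem' c := ⟨0, C c, fun z _ => by simp⟩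

variable {D : MvPolynomial σ ℂ}

theorem eval_mem_ratAlg (P : MvPolynomial σ ℂ) : (fun z => eval z P) ∈ ratAlg D :=
  ⟨0, P, fun z _ => by simp⟩

theorem const_mem_ratAlg (c : ℂ) : (fun _ : σ → ℂ => c) ∈ ratAlg D :=
  (ratAlg D).algebraMap_mem c

theorem inv_mem_ratAlg {Q : MvPolynomial σ ℂ} (h : Q ∣ D) :
    (fun z => (eval z Q)⁻¹) ∈ ratAlg D := by
  obtain ⟨R, rfl⟩ := h
  refine ⟨1, R, fun z hz => ?_⟩
  rw [map_mul] at hz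
  rw [map_mul, pow_one, mul_comm, div_mul_cancel_left₀ (right_ne_zero_of_mul hz)]

/-- Substitution of polynomials preserves rationality, if the new denominators divide a power of
the given one. -/
theorem comp_mem_ratAlg {D' : MvPolynomial τ ℂ} (φ : σ → MvPolynomial τ ℂ) {M : ℕ}
    (h : bind₁ φ D ∣ D' ^ M) {F : (σ → ℂ) → ℂ} (hF : F ∈ ratAlg D) :
    (fun z : τ → ℂ => F fun i => eval z (φ i)) ∈ ratAlg D' := by
  obtain ⟨N, P, hP⟩ := hF
  obtain ⟨R, hR⟩ := h
  have e : ∀ (Q : MvPolynomial σ ℂ) (z : τ → ℂ),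
      eval (fun i => eval z (φ i)) Q = eval z (bind₁ φ Q) := fun Q z =>
    (eval₂Hom_bind₁ (RingHom.id ℂ) z φ Q).symm
  refine ⟨M * N, bind₁ φ P * R ^ N, fun z hz => ?_⟩
  have h1 : eval z D' ^ M = eval z (bind₁ φ D) * eval z R := by rw [← map_pow, hR, map_mul]
  have h2 : eval z (bind₁ φ D) * eval z R ≠ 0 := h1 ▸ pow_ne_zero M hz
  have h3 := left_ne_zero_of_mul h2
  have h4 := right_ne_zero_of_mul h2
  beta_reduce
  rw [hP _ (by rw [e]; exact h3), e, e, pow_mul, h1, map_mul, map_pow, mul_pow,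
    mul_div_mul_right _ _ (pow_ne_zero _ h4)]

/-- Two rational functions that agree on a product of infinite sets agree wherever the denominators
do not vanish. -/
theorem eqOn_of_mem_ratAlg [Finite σ] (hD : D ≠ 0) {F G : (σ → ℂ) → ℂ} (hF : F ∈ ratAlg D)
    (hG : G ∈ ratAlg D) (s : σ → Set ℂ) (hs : ∀ i, (s i).Infinite)
    (h : ∀ z ∈ Set.univ.pi s, eval z D ≠ 0 → F z = G z) {z : σ → ℂ} (hz : eval z D ≠ 0) :
    F z = G z := by
  obtain ⟨N, P, hP⟩ := hF
  obtain ⟨M, Q, hQ⟩ := hG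
  have key : P * D ^ M * D = Q * D ^ N * D := by
    refine funext_set s hs fun x hx => ?_
    by_cases h0 : eval x D = 0
    · simp [h0]
    · have := h x hx h0
      rw [hP x h0, hQ x h0, div_eq_div_iff (pow_ne_zero _ h0) (pow_ne_zero _ h0)] at this
      simp only [map_mul, map_pow, this]
  have key' := congrArg (eval z) (mul_right_cancel₀ hD key)
  simp only [map_mul, map_pow] at key'
  rw [hP z hz, hQ z hz, div_eq_div_iff (pow_ne_zero _ hz) (pow_ne_zero _ hz), key']

/-- The product of all differences `z_i - z_j`, `i ≠ j`. -/
def discr (k : ℕ) : MvPolynomial (Fin k) ℂ :=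
  ∏ p ∈ (Finset.univ : Finset (Fin k)).offDiag, (X p.1 - X p.2)

theorem eval_discr_ne_zero {k : ℕ} {z : Fin k → ℂ} :
    eval z (discr k) ≠ 0 ↔ Function.Injective z := by
  simp only [discr, map_prod, map_sub, eval_X, Finset.prod_ne_zero_iff, Finset.mem_offDiag,
    Finset.mem_univ, true_and, sub_ne_zero, Prod.forall]
  exact ⟨fun h i j hij => by_contra fun hne => h i j hne hij, fun h i j hij e => hij (h e)⟩

theorem sub_dvd_discr {k : ℕ} {i j : Fin k} (h : i ≠ j) : (X i - X j) ∣ discr k :=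
  Finset.dvd_prod_of_mem (fun p : Fin k × Fin k => (X p.1 - X p.2 : MvPolynomial (Fin k) ℂ))
    (a := (i, j)) (by simp [h])

theorem bind_discr_dvd {k : ℕ} {D' : MvPolynomial τ ℂ} (φ : Fin k → MvPolynomial τ ℂ)
    (h : ∀ i j, i ≠ j → (φ i - φ j) ∣ D') :
    bind₁ φ (discr k) ∣ D' ^ (Finset.univ : Finset (Fin k)).offDiag.card := by
  rw [discr, map_prod, ← Finset.prod_const]
  refine Finset.prod_dvd_prod_of_dvd _ _ fun p hp => ?_
  rw [map_sub, bind₁_X_right, bind₁_X_right]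
  exact h _ _ (Finset.mem_offDiag.1 hp).2.2

/-- Regular functions on the configuration space of `k` distinct points of `ℂ`. -/
abbrev confAlg (k : ℕ) : Subalgebra ℂ ((Fin k → ℂ) → ℂ) := ratAlg (discr k)

theorem coord_mem_confAlg {k : ℕ} (i : Fin k) : (fun z => z i) ∈ confAlg k := by
  simpa using eval_mem_ratAlg (D := discr k) (X i)

theorem inv_sub_mem_confAlg {k : ℕ} (i j : Fin k) : (fun z => (z i - z j)⁻¹) ∈ confAlg k := by
  by_cases h : i = j
  · subst h
    simpa using const_mem_ratAlg (D := discr k) 0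
  · simpa using inv_mem_ratAlg (sub_dvd_discr h)

theorem comp_mem_confAlg {k l : ℕ} (e : Fin k → Fin l) (he : Function.Injective e)
    {F : (Fin k → ℂ) → ℂ} (hF : F ∈ confAlg k) : (fun z => F fun i => z (e i)) ∈ confAlg l := by
  simpa using comp_mem_ratAlg (D' := discr l) (fun i => X (e i))
    (bind_discr_dvd _ fun i j hij => sub_dvd_discr (he.ne hij)) hF

/-- The points with strictly decreasing absolute values. -/
def Ordered {k : ℕ} (z : Fin k → ℂ) : Prop := ∀ i j, i < j → ‖z j‖ < ‖z i‖

theorem Ordered.tail {k : ℕ} {z : Fin (k + 1) → ℂ} (h : Ordered z) : Ordered (Fin.tail z) :=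
  fun i j hij => h i.succ j.succ (Fin.succ_lt_succ_iff.2 hij)

theorem Ordered.injective {k : ℕ} {z : Fin k → ℂ} (h : Ordered z) : Function.Injective z := by
  intro i j hij
  rcases lt_trichotomy i j with hlt | rfl | hlt
  · exact absurd (hij ▸ h i j hlt) (lt_irrefl _)
  · rfl
  · exact absurd (hij ▸ h j i hlt) (lt_irrefl _)

/-- A product of infinite sets inside of the region of ordered nonzero points. -/
def orderedBox (k : ℕ) (i : Fin k) : Set ℂ := {w | (k : ℝ) - i - 1 < ‖w‖ ∧ ‖w‖ < (k : ℝ) - i}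

theorem infinite_orderedBox {k : ℕ} (i : Fin k) : (orderedBox k i).Infinite := by
  have hi : (i : ℝ) + 1 ≤ k := by exact_mod_cast i.2
  have h : Set.Ioo ((k : ℝ) - i - 1) (k - i) ⊆ (fun w : ℂ => ‖w‖) '' orderedBox k i := by
    intro r hr
    have h0 : 0 ≤ r := by linarith [hr.1]
    exact ⟨r, by simpa [orderedBox, abs_of_nonneg h0] using hr, by simp [abs_of_nonneg h0]⟩
  exact Set.Infinite.of_image _ ((Set.Ioo_infinite (by linarith)).mono h)

theorem ordered_of_mem_box {k : ℕ} {z : Fin k → ℂ} (h : z ∈ Set.univ.pi (orderedBox k)) :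
    Ordered z ∧ ∀ i, z i ≠ 0 := by
  have hz : ∀ i, (k : ℝ) - i - 1 < ‖z i‖ ∧ ‖z i‖ < (k : ℝ) - i := fun i => h i trivial
  refine ⟨fun i j hij => ?_, fun i => ?_⟩
  · have : (i : ℝ) + 1 ≤ j := by exact_mod_cast hij
    linarith [(hz i).1, (hz j).2]
  · have : (i : ℝ) + 1 ≤ k := by exact_mod_cast i.2
    rw [← norm_pos_iff]
    linarith [(hz i).1]

theorem exists_ordered (k : ℕ) : ∃ z : Fin k → ℂ, Ordered z ∧ ∀ i, z i ≠ 0 := by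
  choose z hz using fun i => (infinite_orderedBox (k := k) i).nonempty
  exact ⟨z, ordered_of_mem_box fun i _ => hz i⟩

/-- The identity principle: a regular function on the configuration space is determined by its
values at ordered points. -/
theorem eq_of_ordered {k : ℕ} {F G : (Fin k → ℂ) → ℂ} (hF : F ∈ confAlg k) (hG : G ∈ confAlg k)
    (h : ∀ z, Ordered z → (∀ i, z i ≠ 0) → F z = G z) {z : Fin k → ℂ}
    (hz : Function.Injective z) : F z = G z := by
  refine eqOn_of_mem_ratAlg ?_ hF hG _ infinite_orderedBox
    (fun x hx _ => h x (ordered_of_mem_box hx).1 (ordered_of_mem_box hx).2)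
    (eval_discr_ne_zero.2 hz)
  obtain ⟨x, hx, -⟩ := exists_ordered k
  intro h0
  exact eval_discr_ne_zero.2 hx.injective (by rw [h0, map_zero])

end Rational

/-! ### Correlation functions -/

namespace BoundedConformalVertexAlgebra

variable {V : Type*} [AddCommGroup V] [Module ℂ V] (A : BoundedConformalVertexAlgebra V)

/-- The functional `v ↦ y (B_(n) v)`. -/
def rmul (n : ℤ) (B : V) (y : A.restrictedDual) : A.restrictedDual :=
  ⟨(y : Module.Dual ℂ V) ∘ₗ A.mode n B, A.comp_mode_mem y n B⟩

theorem rmul_apply (n : ℤ) (B : V) (y : A.restrictedDual) (v : V) :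
    (A.rmul n B y : Module.Dual ℂ V) v = (y : Module.Dual ℂ V) (A.mode n B v) := rfl

theorem rmul_zero_right (n : ℤ) (B : V) : A.rmul n B 0 = 0 := by
  ext v; simp [rmul_apply]

theorem rmul_zero_left (n : ℤ) (y : A.restrictedDual) : A.rmul n 0 y = 0 := by
  ext v; simp [rmul_apply]

theorem wt_eq_bot_of_lt : ∃ N : ℤ, ∀ n < N, A.wt n = ⊥ := by
  obtain ⟨N, hN⟩ := A.weights
  refine ⟨N, fun n hn => ?_⟩
  by_contra h
  have h' : Module.End.HasEigenvalue (A.mode 1 A.conf) (n : ℂ) := by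
    rw [Module.End.hasEigenvalue_iff]
    simpa [ConformalVertexAlgebra.wt, ConformalVertexAlgebra.vir] using h
  obtain ⟨m, hm, hmn⟩ := hN _ h'
  have : n = m := by exact_mod_cast hmn
  omega

theorem iSup_wt : ⨆ p : ℤ, A.wt p = ⊤ := A.isInternal_wt.submodule_iSup_eq_top

/-- An element of `D(V)` sees only finitely many weights, and the weights of `V` are bounded below,
while `B_(-n-1)` raises the weight by an amount that grows with `n`; so only finitely many of these
modes contribute. -/
theorem exists_rmul_eq_zero (B : V) (y : A.restrictedDual) :
    ∃ N : ℕ, ∀ n : ℕ, N ≤ n → A.rmul (-n - 1) B y = 0 := by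
  obtain ⟨N₀, hN₀⟩ := A.wt_eq_bot_of_lt
  obtain ⟨M, hM⟩ : ∃ M : ℤ, ∀ n : ℤ, M < n → ∀ v ∈ A.wt n, (y : Module.Dual ℂ V) v = 0 := by
    obtain ⟨M, hM⟩ := y.2.bddAbove
    exact ⟨M, fun n hn v hv => by_contra fun h => absurd (hM ⟨v, hv, h⟩) (not_le.2 hn)⟩
  have hB : B ∈ ⨆ p : ℤ, A.wt p := by rw [A.iSup_wt]; trivial
  induction hB using Submodule.iSup_induction' with
  | mem p B hB =>
    refine ⟨(M - p - N₀ + 1).toNat, fun n hn => ?_⟩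
    ext v
    have hv : v ∈ ⨆ p : ℤ, A.wt p := by rw [A.iSup_wt]; trivial
    rw [rmul_apply]
    induction hv using Submodule.iSup_induction' with
    | mem q v hv =>
      rcases lt_or_ge q N₀ with hq | hq
      · rw [hN₀ q hq, Submodule.mem_bot] at hv
        simp [hv]
      · exact hM _ (by omega) _ (A.mode_mem_wt hB hv _)
    | zero => simp
    | add v w _ _ hv hw => rw [map_add, map_add, hv, hw, map_add]
  | zero => exact ⟨0, fun n _ => A.rmul_zero_left _ _⟩
  | add B B' _ _ h h' =>
    obtain ⟨N, hN⟩ := h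
    obtain ⟨N', hN'⟩ := h'
    refine ⟨max N N', fun n hn => ?_⟩
    have h1 := congrArg Subtype.val (hN n (by omega))
    have h2 := congrArg Subtype.val (hN' n (by omega))
    ext v
    have h1' := LinearMap.congr_fun h1 v
    have h2' := LinearMap.congr_fun h2 v
    change (A.rmul (-n - 1) B y : Module.Dual ℂ V) v = 0 at h1'
    change (A.rmul (-n - 1) B' y : Module.Dual ℂ V) v = 0 at h2'
    rw [rmul_apply] at *
    rw [map_add, LinearMap.add_apply, map_add, h1', h2']
    simp

/-- The correlation function `y(a_0(z_0) ⋯ a_{k-1}(z_{k-1}) |0⟩)`, as a rational function. The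
recursion moves the annihilation part of `a_0(z_0)` to the vacuum by commutators and the creation
part to `y`. Both sums are finite. -/
def corr : (k : ℕ) → (Fin k → ℂ) → A.restrictedDual → (Fin k → V) → ℂ
  | 0, _, y, _ => (y : Module.Dual ℂ V) A.vac
  | k + 1, z, y, a =>
    (∑ᶠ n : ℕ, z 0 ^ n * corr k (Fin.tail z) (A.rmul (-n - 1) (a 0) y) (Fin.tail a)) +
      ∑ s, ∑ᶠ j : ℕ, (z 0 - Fin.tail z s)⁻¹ ^ (j + 1) * corr k (Fin.tail z) y
        (Function.update (Fin.tail a) s (A.mode j (a 0) (Fin.tail a s)))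

/-- The insertion of `B` at the point `x` to the left of all `a_s(w_s)`, by the formula that defines
`corr`. If `x` is one of the `w_s`, then the junk value `0⁻¹ = 0` removes the singular terms of this
`s`, and what is left is the normally ordered insertion. -/
def ins {k : ℕ} (x : ℂ) (B : V) (w : Fin k → ℂ) (y : A.restrictedDual) (a : Fin k → V) : ℂ :=
  (∑ᶠ n : ℕ, x ^ n * A.corr k w (A.rmul (-n - 1) B y) a) +
    ∑ s, ∑ᶠ j : ℕ, (x - w s)⁻¹ ^ (j + 1) * A.corr k w y
      (Function.update a s (A.mode j B (a s)))

theorem corr_zero (z : Fin 0 → ℂ) (y : A.restrictedDual) (a : Fin 0 → V) :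
    A.corr 0 z y a = (y : Module.Dual ℂ V) A.vac := rfl

theorem corr_succ {k : ℕ} (z : Fin (k + 1) → ℂ) (y : A.restrictedDual) (a : Fin (k + 1) → V) :
    A.corr (k + 1) z y a = A.ins (z 0) (a 0) (Fin.tail z) y (Fin.tail a) := rfl

theorem corr_functional_zero {k : ℕ} (z : Fin k → ℂ) (a : Fin k → V) : A.corr k z 0 a = 0 := by
  induction k with
  | zero => simp [corr_zero]
  | succ k ih => simp [corr_succ, ins, rmul_zero_right, ih]

theorem corr_eq_zero {k : ℕ} (z : Fin k → ℂ) (y : A.restrictedDual) (a : Fin k → V) (t : Fin k)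
    (h : a t = 0) : A.corr k z y a = 0 := by
  induction k generalizing y with
  | zero => exact t.elim0
  | succ k ih =>
    rw [corr_succ, ins]
    induction t using Fin.cases with
    | zero =>
      rw [h]
      have : ∀ (j : ℕ) (s : Fin k), A.corr k (Fin.tail z) y
          (Function.update (Fin.tail a) s (A.mode j 0 (Fin.tail a s))) = 0 := fun j s =>
        ih _ _ _ s (by simp)
      simp only [this]
      simp [rmul_zero_left, corr_functional_zero]
    | succ t =>
      have h0 : Fin.tail a t = 0 := h
      have : ∀ (j : ℕ) (s : Fin k), A.corr k (Fin.tail z) y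
          (Function.update (Fin.tail a) s (A.mode j (a 0) (Fin.tail a s))) = 0 := by
        intro j s
        refine ih _ _ _ t ?_
        rcases eq_or_ne t s with rfl | hts
        · simp [h0]
        · rw [Function.update_of_ne hts, h0]
      simp [this, fun n => ih (Fin.tail z) (A.rmul n (a 0) y) (Fin.tail a) t h0]

/-- `ins` as a finite sum with given bounds. -/
theorem ins_eq_sum {k : ℕ} {B : V} {y : A.restrictedDual} {a : Fin k → V} {N J : ℕ}
    (hN : ∀ n : ℕ, N ≤ n → A.rmul (-n - 1) B y = 0)
    (hJ : ∀ s, ∀ j : ℕ, J ≤ j → A.mode j B (a s) = 0) (x : ℂ) (w : Fin k → ℂ) :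
    A.ins x B w y a = (∑ n ∈ Finset.range N, x ^ n * A.corr k w (A.rmul (-n - 1) B y) a) +
      ∑ s, ∑ j ∈ Finset.range J, (x - w s)⁻¹ ^ (j + 1) * A.corr k w y
        (Function.update a s (A.mode j B (a s))) := by
  rw [ins, finsum_eq_sum_of_support_subset (s := Finset.range N)]
  · congr 1
    refine Finset.sum_congr rfl fun s _ => finsum_eq_sum_of_support_subset _ ?_
    intro j hj
    by_contra h
    refine hj ?_
    beta_reduce
    rw [hJ s j (by simpa using h), A.corr_eq_zero _ _ _ s (by simp), mul_zero]
  · intro n hn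
    by_contra h
    refine hn ?_
    beta_reduce
    rw [hN n (by simpa using h), corr_functional_zero, mul_zero]

theorem exists_mode_eq_zero {k : ℕ} (B : V) (a : Fin k → V) :
    ∃ J : ℕ, ∀ s, ∀ j : ℕ, J ≤ j → A.mode j B (a s) = 0 := by
  choose J hJ using fun s => A.exists_mode_nat_eq_zero B (a s)
  refine ⟨Finset.univ.sup J, fun s j hj => hJ s j (le_trans ?_ hj)⟩
  exact Finset.le_sup (Finset.mem_univ s)

theorem corr_mem_confAlg {k : ℕ} (y : A.restrictedDual) (a : Fin k → V) :
    (fun z => A.corr k z y a) ∈ confAlg k := by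
  induction k generalizing y with
  | zero => exact const_mem_ratAlg _
  | succ k ih =>
    obtain ⟨N, hN⟩ := A.exists_rmul_eq_zero (a 0) y
    obtain ⟨J, hJ⟩ := A.exists_mode_eq_zero (a 0) (Fin.tail a)
    have ht : ∀ y a, (fun z => A.corr k (Fin.tail z) y a) ∈ confAlg (k + 1) := fun y a =>
      comp_mem_confAlg Fin.succ (Fin.succ_injective k) (ih y a)
    have e : (fun z => A.corr (k + 1) z y a) =
        (∑ n ∈ Finset.range N, (fun z : Fin (k + 1) → ℂ => z 0) ^ n *
          fun z => A.corr k (Fin.tail z) (A.rmul (-n - 1) (a 0) y) (Fin.tail a)) +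
        ∑ s : Fin k, ∑ j ∈ Finset.range J,
          (fun z : Fin (k + 1) → ℂ => (z 0 - z s.succ)⁻¹) ^ (j + 1) *
          fun z => A.corr k (Fin.tail z) y
            (Function.update (Fin.tail a) s (A.mode j (a 0) (Fin.tail a s))) := by
      ext1 z
      rw [corr_succ, A.ins_eq_sum hN hJ]
      simp [Finset.sum_apply, Fin.tail]
    rw [e]
    refine add_mem (sum_mem fun n _ => mul_mem (pow_mem (coord_mem_confAlg 0) n) (ht _ _))
      (sum_mem fun s _ => sum_mem fun j _ =>
        mul_mem (pow_mem (inv_sub_mem_confAlg 0 s.succ) _) (ht _ _))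

end BoundedConformalVertexAlgebra

/-! ### Expansion of correlation functions in the ordered region -/

/-- The expansion of `1 / (x - b)^(j+1)` in the region `|x| > |b|`. -/
theorem hasSum_binomial {x b : ℂ} (h : ‖b‖ < ‖x‖) (j : ℕ) :
    HasSum (fun p : ℕ => (p.choose j : ℂ) * b ^ (p - j) * x⁻¹ ^ (p + 1)) ((x - b)⁻¹ ^ (j + 1)) := by
  have hx : x ≠ 0 := norm_pos_iff.1 (lt_of_le_of_lt (norm_nonneg b) h)
  have hr : ‖b / x‖ < 1 := by
    rw [norm_div]; exact (div_lt_one (norm_pos_iff.2 hx)).2 h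
  have h1 := (hasSum_choose_mul_geometric_of_norm_lt_one j hr).mul_left (x⁻¹ ^ (j + 1))
  have e : x⁻¹ ^ (j + 1) * (1 / (1 - b / x) ^ (j + 1)) = (x - b)⁻¹ ^ (j + 1) := by
    rw [one_div, ← inv_pow, ← mul_pow, ← mul_inv, mul_sub, mul_one, mul_div_cancel₀ _ hx]
  rw [e] at h1
  refine ((add_left_injective j).hasSum_iff ?_).1 (h1.congr_fun ?_)
  · intro p hp
    have : p < j := by
      by_contra hc
      exact hp ⟨p - j, by simp; omega⟩
    simp [Nat.choose_eq_zero_of_lt this]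
  · intro n
    simp only [Function.comp_apply, Nat.add_sub_cancel]
    rw [div_pow, inv_pow, inv_pow, show n + j + 1 = n + (j + 1) by ring, pow_add]
    field_simp

theorem HasSum.mul_complex {ι κ : Type*} {f : ι → ℂ} {g : κ → ℂ} {s t : ℂ} (hf : HasSum f s)
    (hg : HasSum g t) : HasSum (fun x : ι × κ => f x.1 * g x.2) (s * t) :=
  hf.mul hg (summable_mul_of_summable_norm hf.summable.norm hg.summable.norm)

theorem update_add_eq {k : ℕ} (n : Fin k → ℤ) (s : Fin k) (d : ℤ) :
    Function.update n s (n s + d) = n + Pi.single s d := by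
  ext i
  rcases eq_or_ne i s with rfl | h
  · simp
  · simp [h]

/-- The monomial `∏ z_i^(-n_i-1)` that accompanies the modes `n_i`. At a point `z_i = 0` the junk
values of negative powers are zero, so that only `n_i = -1` contributes. -/
def monom {k : ℕ} (z : Fin k → ℂ) (n : Fin k → ℤ) : ℂ := ∏ i, z i ^ (-n i - 1)

theorem monom_shift {k : ℕ} (z : Fin k → ℂ) (n : Fin k → ℤ) (s : Fin k) (d : ℕ)
    (h : z s ≠ 0 ∨ n s + d < 0) :
    monom z n = z s ^ d * monom z (Function.update n s (n s + d)) := by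
  simp only [monom]
  rw [← Finset.mul_prod_erase _ _ (Finset.mem_univ s),
    ← Finset.mul_prod_erase _ (fun i => z i ^ (-Function.update n s (n s + d) i - 1))
      (Finset.mem_univ s), ← mul_assoc, Function.update_self]
  congr 1
  · have e : -n s - 1 = (d : ℤ) + (-(n s + d) - 1) := by ring
    have h' : z s ≠ 0 ∨ (d : ℤ) + (-(n s + d) - 1) ≠ 0 ∨ (d : ℤ) = 0 ∧ -(n s + d) - 1 = 0 := by
      rcases h with h | h
      · exact Or.inl h
      · right; omega
    rw [e, zpow_add' h', zpow_natCast]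
  · refine Finset.prod_congr rfl fun i hi => ?_
    rw [Function.update_of_ne (Finset.ne_of_mem_erase hi)]

namespace BoundedConformalVertexAlgebra

variable {V : Type*} [AddCommGroup V] [Module ℂ V] (A : BoundedConformalVertexAlgebra V)

/-- The vector `(a_0)_(n_0) ⋯ (a_{k-1})_(n_{k-1}) |0⟩`. -/
def modes : (k : ℕ) → (Fin k → V) → (Fin k → ℤ) → V
  | 0, _, _ => A.vac
  | k + 1, a, n => A.mode (n 0) (a 0) (modes k (Fin.tail a) (Fin.tail n))

theorem modes_succ {k : ℕ} (a : Fin (k + 1) → V) (n : Fin (k + 1) → ℤ) :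
    A.modes (k + 1) a n = A.mode (n 0) (a 0) (A.modes k (Fin.tail a) (Fin.tail n)) := rfl

/-- Nonnegative modes move through all fields to the vacuum, which they kill. -/
theorem mode_modes {k : ℕ} (B : V) (a : Fin k → V) {J : ℕ}
    (hJ : ∀ s, ∀ j : ℕ, J ≤ j → A.mode j B (a s) = 0) (p : ℕ) (n : Fin k → ℤ) :
    A.mode p B (A.modes k a n) = ∑ s, ∑ j ∈ Finset.range J, (p.choose j : ℂ) •
      A.modes k (Function.update a s (A.mode j B (a s)))
        (Function.update n s (n s + (p - j))) := by
  induction k with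
  | zero => simp [modes, A.mode_apply_vac B p (by omega)]
  | succ k ih =>
    have h := congrArg (fun T : Module.End ℂ V => T (A.modes k (Fin.tail a) (Fin.tail n)))
      (A.comm_mode B (a 0) (hJ 0) p (n 0))
    simp only [Ring.lie_def, LinearMap.sub_apply, Module.End.mul_apply, LinearMap.sum_apply,
      LinearMap.smul_apply, Ring.choose_natCast, Int.cast_natCast] at h
    rw [modes_succ, sub_eq_iff_eq_add.1 h, ih (Fin.tail a) (fun s => hJ s.succ), Fin.sum_univ_succ]
    congr 1
    · refine Finset.sum_congr rfl fun j _ => ?_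
      rw [modes_succ, Function.update_self, Function.update_self, Fin.tail_update_zero,
        Fin.tail_update_zero, add_comm (p : ℤ), add_sub_assoc]
    · rw [map_sum]
      refine Finset.sum_congr rfl fun s _ => ?_
      rw [map_sum]
      refine Finset.sum_congr rfl fun j _ => ?_
      rw [map_smul, modes_succ, Fin.tail_update_succ, Fin.tail_update_succ,
        Function.update_of_ne (Fin.succ_ne_zero s).symm,
        Function.update_of_ne (Fin.succ_ne_zero s).symm]
      rfl

theorem modes_eq_zero_of_last {k : ℕ} (a : Fin k → V) (n : Fin k → ℤ) (s : Fin k)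
    (hs : ∀ i, ¬ s < i) (hn : 0 ≤ n s) : A.modes k a n = 0 := by
  induction k with
  | zero => exact s.elim0
  | succ k ih =>
    rw [modes_succ]
    induction s using Fin.cases with
    | zero =>
      cases k with
      | zero => exact A.mode_apply_vac _ _ hn
      | succ k => exact absurd (Fin.succ_pos 0) (hs _)
    | succ s =>
      rw [ih _ _ s (fun i hi => hs i.succ (Fin.succ_lt_succ_iff.2 hi)) hn, map_zero]

/-- Absorbing a power of `z_s` into a shift of the index `n_s`. The point `z_s` may be zero only if
it is the last one; then the coefficients with `n_s ≥ 0` vanish. -/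
theorem monom_mul_modes {k : ℕ} {z : Fin k → ℂ} (hz : Ordered z) (y : A.restrictedDual)
    (a : Fin k → V) (n : Fin k → ℤ) (s : Fin k) (d : ℕ) :
    monom z n * (y : Module.Dual ℂ V) (A.modes k a (Function.update n s (n s + d))) =
      z s ^ d * (monom z (Function.update n s (n s + d)) *
        (y : Module.Dual ℂ V) (A.modes k a (Function.update n s (n s + d)))) := by
  by_cases h : z s ≠ 0 ∨ n s + d < 0
  · rw [monom_shift z n s d h, mul_assoc]
  · push Not at h
    rw [A.modes_eq_zero_of_last a _ s, map_zero]
    · simp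
    · intro i hi
      have := hz s i hi
      rw [h.1, norm_zero] at this
      exact absurd this (not_lt.2 (norm_nonneg _))
    · simpa using h.2

/-- In the region `|z_0| > |z_1| > ⋯` the correlation function is the sum of its Laurent series, as
an absolutely convergent multiple series. -/
theorem hasSum_corr {k : ℕ} {z : Fin k → ℂ} (hz : Ordered z) (y : A.restrictedDual)
    (a : Fin k → V) :
    HasSum (fun n : Fin k → ℤ => monom z n * (y : Module.Dual ℂ V) (A.modes k a n))
      (A.corr k z y a) := by
  induction k generalizing y with
  | zero =>
    simp [monom, modes, corr_zero]
  | succ k ih =>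
    obtain ⟨N, hN⟩ := A.exists_rmul_eq_zero (a 0) y
    obtain ⟨J, hJ⟩ := A.exists_mode_eq_zero (a 0) (Fin.tail a)
    set w := Fin.tail z with hw
    have hwo : Ordered w := hz.tail
    rw [corr_succ, A.ins_eq_sum hN hJ]
    rw [← (Fin.consEquiv fun _ : Fin (k + 1) => ℤ).hasSum_iff]
    -- the terms with the index `-q - 1` in the first place
    let f : ℕ → ℤ × (Fin k → ℤ) → ℂ := fun q x => if x.1 = -q - 1 then z 0 ^ q *
      (monom w x.2 * (A.rmul (-q - 1) (a 0) y : Module.Dual ℂ V)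
        (A.modes k (Fin.tail a) x.2)) else 0
    have hf : ∀ q, HasSum (f q) (z 0 ^ q * A.corr k w (A.rmul (-q - 1) (a 0) y) (Fin.tail a)) := by
      intro q
      have hi : Function.Injective fun n : Fin k → ℤ => ((-q - 1 : ℤ), n) := fun n m h =>
        (Prod.mk.inj h).2
      refine (hi.hasSum_iff ?_).1 (((ih hwo _ _).mul_left (z 0 ^ q)).congr_fun ?_)
      · rintro ⟨p, n⟩ h
        exact if_neg fun hp => h ⟨n, Prod.ext hp.symm rfl⟩
      · intro n
        simp [f]
    -- the terms with a nonnegative index in the first place, commuted through the `s`-th field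
    let u : Fin k → ℕ → ℤ → ℂ := fun s j p => if 0 ≤ p then
      (p.toNat.choose j : ℂ) * w s ^ (p.toNat - j) * (z 0)⁻¹ ^ (p.toNat + 1) else 0
    have hu : ∀ s j, HasSum (u s j) ((z 0 - w s)⁻¹ ^ (j + 1)) := by
      intro s j
      refine ((Nat.cast_injective (R := ℤ)).hasSum_iff ?_).1
        ((hasSum_binomial (hz 0 s.succ (Fin.succ_pos s)) j).congr_fun ?_)
      · intro p hp
        exact if_neg fun h0 => hp ⟨p.toNat, Int.toNat_of_nonneg h0⟩
      · intro p
        simp [u, w, Fin.tail]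
    let g : Fin k → ℕ → ℤ × (Fin k → ℤ) → ℂ := fun s j x => u s j x.1 *
      (monom w (Function.update x.2 s (x.2 s + (x.1 - j))) * (y : Module.Dual ℂ V)
        (A.modes k (Function.update (Fin.tail a) s (A.mode j (a 0) (Fin.tail a s)))
          (Function.update x.2 s (x.2 s + (x.1 - j)))))
    have hg : ∀ s j, HasSum (g s j) ((z 0 - w s)⁻¹ ^ (j + 1) * A.corr k w y
        (Function.update (Fin.tail a) s (A.mode j (a 0) (Fin.tail a s)))) := by
      intro s j
      let e : ℤ × (Fin k → ℤ) ≃ ℤ × (Fin k → ℤ) := Equiv.prodShear (Equiv.refl ℤ) fun p =>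
        Equiv.addRight (Pi.single s (p - j))
      have h1 := (hu s j).mul_complex (ih hwo y
        (Function.update (Fin.tail a) s (A.mode j (a 0) (Fin.tail a s))))
      refine ((e.hasSum_iff).2 h1).congr_fun fun x => ?_
      simp only [g, Function.comp_apply, e, Equiv.prodShear_apply, Equiv.refl_apply,
        Equiv.coe_addRight, update_add_eq]
    refine ((hasSum_sum fun q (_ : q ∈ Finset.range N) => hf q).add
      (hasSum_sum fun s (_ : s ∈ Finset.univ) =>
        hasSum_sum fun j (_ : j ∈ Finset.range J) => hg s j)).congr_fun ?_
    rintro ⟨p, n⟩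
    have hm : monom z (Fin.cons p n : Fin (k + 1) → ℤ) = z 0 ^ (-p - 1) * monom w n := by
      simp only [monom, Fin.prod_univ_succ, Fin.cons_zero, Fin.cons_succ]
      rfl
    change monom z (Fin.cons p n : Fin (k + 1) → ℤ) * (y : Module.Dual ℂ V)
      (A.modes (k + 1) a (Fin.cons p n : Fin (k + 1) → ℤ)) = _
    rw [hm, modes_succ, Fin.cons_zero, Fin.tail_cons]
    rcases lt_or_ge p 0 with hp | hp
    · have hgz : ∀ s j, g s j (p, n) = 0 := fun s j => by simp [g, u, not_le.2 hp]
      simp only [hgz, Finset.sum_const_zero, add_zero]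
      obtain ⟨q, rfl⟩ : ∃ q : ℕ, p = -q - 1 := ⟨(-p - 1).toNat, by omega⟩
      have hfz : ∀ r : ℕ, r ≠ q → f r (-q - 1, n) = 0 := fun r hr => by
        simp only [f]
        exact if_neg (by omega)
      have hfq : z 0 ^ (-(-q - 1 : ℤ) - 1) * monom w n * (y : Module.Dual ℂ V)
          (A.mode (-q - 1) (a 0) (A.modes k (Fin.tail a) n)) = f q (-q - 1, n) := by
        simp only [f, if_true, rmul_apply]
        rw [show (-(-q - 1 : ℤ) - 1) = q by ring, zpow_natCast, mul_assoc]
      rw [hfq]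
      by_cases hq : q < N
      · exact (Finset.sum_eq_single_of_mem q (by simpa using hq) fun r _ hr => hfz r hr).symm
      · rw [Finset.sum_eq_zero fun r hr => hfz r (by simp at hr; omega)]
        simp [f, hN q (by omega)]
    · lift p to ℕ using hp
      have hfz : ∀ r : ℕ, f r ((p : ℤ), n) = 0 := fun r => by
        simp only [f]
        exact if_neg (by omega)
      simp only [hfz, Finset.sum_const_zero, zero_add]
      rw [A.mode_modes _ _ hJ, map_sum, Finset.mul_sum]
      refine Finset.sum_congr rfl fun s _ => ?_
      rw [map_sum, Finset.mul_sum]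
      refine Finset.sum_congr rfl fun j _ => ?_
      rw [map_smul, smul_eq_mul]
      simp only [g, u, Int.toNat_natCast, Nat.cast_nonneg, if_true]
      rcases lt_or_ge p j with hj | hj
      · simp [Nat.choose_eq_zero_of_lt hj]
      · have := A.monom_mul_modes hwo y
          (Function.update (Fin.tail a) s (A.mode j (a 0) (Fin.tail a s))) n s (p - j)
        rw [Nat.cast_sub hj] at this
        have e : z 0 ^ (-(p : ℤ) - 1) = (z 0)⁻¹ ^ (p + 1) := by
          rw [show (-(p : ℤ) - 1) = -((p + 1 : ℕ) : ℤ) by push_cast; ring, zpow_neg, zpow_natCast,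
            inv_pow]
        rw [e, mul_assoc, mul_left_comm (monom w n), this]
        ring

end BoundedConformalVertexAlgebra

theorem choose_neg_succ (n j : ℕ) :
    ((Ring.choose (-(n : ℤ) - 1) j : ℤ) : ℂ) = (-1) ^ j * ((n + j).choose j : ℂ) := by
  have h : (n : ℤ) + 1 + j - 1 = ((n + j : ℕ) : ℤ) := by push_cast; ring
  rw [← neg_add', Ring.choose_neg, h, Ring.choose_natCast]
  simp [Units.smul_def, Int.negOnePow_def]

/-- The expansion of `-1 / (x - z)^(j+1)` in the region `|x| < |z|`. -/
theorem hasSum_binomial_neg {x z : ℂ} (h : ‖x‖ < ‖z‖) (j : ℕ) :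
    HasSum (fun n : ℕ => x ^ n * ((Ring.choose (-(n : ℤ) - 1) j : ℤ) : ℂ) * z⁻¹ ^ (n + 1 + j))
      (-(x - z)⁻¹ ^ (j + 1)) := by
  have hz : z ≠ 0 := norm_pos_iff.1 (lt_of_le_of_lt (norm_nonneg x) h)
  have hr : ‖x / z‖ < 1 := by
    rw [norm_div]; exact (div_lt_one (norm_pos_iff.2 hz)).2 h
  have h1 := (hasSum_choose_mul_geometric_of_norm_lt_one j hr).mul_left
    ((-1) ^ j * z⁻¹ ^ (j + 1))
  have e : (-1) ^ j * z⁻¹ ^ (j + 1) * (1 / (1 - x / z) ^ (j + 1)) = -(x - z)⁻¹ ^ (j + 1) := by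
    rw [mul_assoc, one_div, ← inv_pow, ← mul_pow, ← mul_inv, mul_sub, mul_one,
      mul_div_cancel₀ _ hz, ← neg_sub x z, inv_neg, neg_pow (x - z)⁻¹, pow_succ (-1 : ℂ) j]
    have : ((-1 : ℂ) ^ j) * (-1) ^ j = 1 := by rw [← mul_pow]; simp
    linear_combination (-(x - z)⁻¹ ^ (j + 1)) * this
  rw [e] at h1
  refine h1.congr_fun fun n => ?_
  rw [choose_neg_succ, div_eq_mul_inv, mul_pow, show n + 1 + j = (j + 1) + n by ring, pow_add]
  ring

namespace BoundedConformalVertexAlgebra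

variable {V : Type*} [AddCommGroup V] [Module ℂ V] (A : BoundedConformalVertexAlgebra V)

/-! ### Linearity of correlation functions -/

theorem modes_update_add {k : ℕ} (a : Fin k → V) (n : Fin k → ℤ) (t : Fin k) (b b' : V) :
    A.modes k (Function.update a t (b + b')) n =
      A.modes k (Function.update a t b) n + A.modes k (Function.update a t b') n := by
  induction k with
  | zero => exact t.elim0
  | succ k ih =>
    simp only [modes_succ]
    induction t using Fin.cases with
    | zero => simp
    | succ t => simp [Fin.tail_update_succ, Function.update_of_ne (Fin.succ_ne_zero t).symm, ih]

theorem modes_update_smul {k : ℕ} (a : Fin k → V) (n : Fin k → ℤ) (t : Fin k) (c : ℂ) (b : V) :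
    A.modes k (Function.update a t (c • b)) n = c • A.modes k (Function.update a t b) n := by
  induction k with
  | zero => exact t.elim0
  | succ k ih =>
    simp only [modes_succ]
    induction t using Fin.cases with
    | zero => simp
    | succ t => simp [Fin.tail_update_succ, Function.update_of_ne (Fin.succ_ne_zero t).symm, ih]

/-- A linear relation between Laurent coefficients holds for the correlation functions. -/
theorem corr_eq_of_modes {k : ℕ} {z : Fin k → ℂ} (hz : Function.Injective z)
    {y y₁ y₂ : A.restrictedDual} {a a₁ a₂ : Fin k → V} (c₁ c₂ : ℂ)
    (h : ∀ n, (y : Module.Dual ℂ V) (A.modes k a n) =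
      c₁ * (y₁ : Module.Dual ℂ V) (A.modes k a₁ n) +
      c₂ * (y₂ : Module.Dual ℂ V) (A.modes k a₂ n)) :
    A.corr k z y a = c₁ * A.corr k z y₁ a₁ + c₂ * A.corr k z y₂ a₂ := by
  refine eq_of_ordered (F := fun z => A.corr k z y a)
    (G := fun z => c₁ * A.corr k z y₁ a₁ + c₂ * A.corr k z y₂ a₂) (A.corr_mem_confAlg y a)
    (add_mem (mul_mem (const_mem_ratAlg c₁) (A.corr_mem_confAlg y₁ a₁))
      (mul_mem (const_mem_ratAlg c₂) (A.corr_mem_confAlg y₂ a₂))) ?_ hz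
  intro w hw _
  refine (A.hasSum_corr hw y a).unique ((((A.hasSum_corr hw y₁ a₁).mul_left c₁).add
    ((A.hasSum_corr hw y₂ a₂).mul_left c₂)).congr_fun fun n => ?_)
  rw [h]; ring

/-- At distinct points, the correlation function as a multilinear map. -/
def corrLin {k : ℕ} {z : Fin k → ℂ} (hz : Function.Injective z) :
    A.restrictedDual →ₗ[ℂ] MultilinearMap ℂ (fun _ : Fin k => V) ℂ where
  toFun y :=
    { toFun := fun a => A.corr k z y a
      map_update_add' := by
        intro inst a t b b'
        obtain rfl : inst = instDecidableEqFin k := Subsingleton.elim _ _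
        simpa using A.corr_eq_of_modes hz 1 1 (y := y) (y₁ := y) (y₂ := y)
          (a := Function.update a t (b + b')) (a₁ := Function.update a t b)
          (a₂ := Function.update a t b') fun n => by simp [modes_update_add]
      map_update_smul' := by
        intro inst a t c b
        obtain rfl : inst = instDecidableEqFin k := Subsingleton.elim _ _
        simpa using A.corr_eq_of_modes hz c 0 (y := y) (y₁ := y) (y₂ := y)
          (a := Function.update a t (c • b)) (a₁ := Function.update a t b)
          (a₂ := a) fun n => by simp [modes_update_smul] }
  map_add' y y' := by
    ext a
    simpa using A.corr_eq_of_modes hz 1 1 (y := y + y') (y₁ := y) (y₂ := y') (a := a) (a₁ := a)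
      (a₂ := a) fun n => by simp
  map_smul' c y := by
    ext a
    simpa using A.corr_eq_of_modes hz c 0 (y := c • y) (y₁ := y) (y₂ := y) (a := a) (a₁ := a)
      (a₂ := a) fun n => by simp

theorem corrLin_apply {k : ℕ} {z : Fin k → ℂ} (hz : Function.Injective z) (y : A.restrictedDual)
    (a : Fin k → V) : A.corrLin hz y a = A.corr k z y a := rfl

theorem corr_smul_functional {k : ℕ} {z : Fin k → ℂ} (hz : Function.Injective z) (c : ℂ)
    (y : A.restrictedDual) (a : Fin k → V) : A.corr k z (c • y) a = c * A.corr k z y a := by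
  simp only [← A.corrLin_apply hz, map_smul, smul_apply, smul_eq_mul]

theorem corr_update_smul {k : ℕ} {z : Fin k → ℂ} (hz : Function.Injective z) (y : A.restrictedDual)
    (a : Fin k → V) (t : Fin k) (c : ℂ) (b : V) :
    A.corr k z y (Function.update a t (c • b)) = c * A.corr k z y (Function.update a t b) := by
  simp only [← A.corrLin_apply hz, MultilinearMap.map_update_smul, smul_eq_mul]

/-! ### Ward identities for polynomials, peeling, and symmetry -/

/-- The Ward identity for the section `B ⊗ z^n`, `n ≥ 0`. -/
theorem corr_rmul_nat {k : ℕ} {z : Fin k → ℂ} (hz : Function.Injective z) (B : V)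
    (y : A.restrictedDual) (a : Fin k → V) {J : ℕ}
    (hJ : ∀ s, ∀ j : ℕ, J ≤ j → A.mode j B (a s) = 0) (n : ℕ) :
    A.corr k z (A.rmul n B y) a = ∑ s, ∑ j ∈ Finset.range J, (n.choose j : ℂ) * z s ^ (n - j) *
      A.corr k z y (Function.update a s (A.mode j B (a s))) := by
  refine eq_of_ordered (F := fun z => A.corr k z (A.rmul n B y) a)
    (G := fun z => ∑ s, ∑ j ∈ Finset.range J, (n.choose j : ℂ) * z s ^ (n - j) *
      A.corr k z y (Function.update a s (A.mode j B (a s)))) (A.corr_mem_confAlg _ a) ?_ ?_ hz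
  · have e : (fun z => ∑ s, ∑ j ∈ Finset.range J, (n.choose j : ℂ) * z s ^ (n - j) *
        A.corr k z y (Function.update a s (A.mode j B (a s)))) =
        ∑ s, ∑ j ∈ Finset.range J, ((fun _ => (n.choose j : ℂ)) *
          (fun z : Fin k → ℂ => z s) ^ (n - j) *
          fun z => A.corr k z y (Function.update a s (A.mode j B (a s)))) := by
      ext1 z; simp [Finset.sum_apply]
    rw [e]
    exact sum_mem fun s _ => sum_mem fun j _ => mul_mem (mul_mem (const_mem_ratAlg _)
      (pow_mem (coord_mem_confAlg s) _)) (A.corr_mem_confAlg _ _)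
  · intro w hw _
    refine (A.hasSum_corr hw _ a).unique ((hasSum_sum fun s (_ : s ∈ Finset.univ) =>
      hasSum_sum fun j (_ : j ∈ Finset.range J) => ?_).congr_fun
        (f := fun m => ∑ s, ∑ j ∈ Finset.range J, (n.choose j : ℂ) * (monom w m *
          (y : Module.Dual ℂ V) (A.modes k (Function.update a s (A.mode j B (a s)))
            (Function.update m s (m s + (n - j)))))) fun m => ?_)
    · rcases lt_or_ge n j with hj | hj
      · simp [Nat.choose_eq_zero_of_lt hj]
      · rw [mul_assoc]
        refine HasSum.mul_left _ ?_
        have h1 := (A.hasSum_corr hw y (Function.update a s (A.mode j B (a s)))).mul_left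
          (w s ^ (n - j))
        refine (((Equiv.addRight (Pi.single s ((n - j : ℕ) : ℤ))).hasSum_iff).2 h1).congr_fun
          fun m => ?_
        simp only [Function.comp_apply, Equiv.coe_addRight]
        rw [← update_add_eq, ← Nat.cast_sub hj,
          A.monom_mul_modes hw]
    · rw [rmul_apply, A.mode_modes B a hJ, map_sum, Finset.mul_sum]
      refine Finset.sum_congr rfl fun s _ => ?_
      rw [map_sum, Finset.mul_sum]
      refine Finset.sum_congr rfl fun j _ => ?_
      rw [map_smul, smul_eq_mul]
      ring

/-- Expansion of a correlation function in the first point only. -/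
theorem hasSum_peel {k : ℕ} {z : Fin (k + 1) → ℂ} (hz : Ordered z) (y : A.restrictedDual)
    (a : Fin (k + 1) → V) :
    HasSum (fun m : ℤ => z 0 ^ (-m - 1) * A.corr k (Fin.tail z) (A.rmul m (a 0) y) (Fin.tail a))
      (A.corr (k + 1) z y a) := by
  have h := (Fin.consEquiv fun _ : Fin (k + 1) => ℤ).hasSum_iff.2 (A.hasSum_corr hz y a)
  refine h.prod_fiberwise fun m => ?_
  refine ((A.hasSum_corr hz.tail (A.rmul m (a 0) y) (Fin.tail a)).mul_left
    (z 0 ^ (-m - 1))).congr_fun fun n => ?_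
  change monom z (Fin.cons m n : Fin (k + 1) → ℤ) * (y : Module.Dual ℂ V)
    (A.modes (k + 1) a (Fin.cons m n : Fin (k + 1) → ℤ)) = _
  rw [modes_succ, Fin.cons_zero, Fin.tail_cons, rmul_apply, ← mul_assoc]
  congr 1
  simp only [monom, Fin.prod_univ_succ, Fin.cons_zero, Fin.cons_succ]
  rfl

theorem rmul_rmul (B b : V) {J : ℕ} (hJ : ∀ j : ℕ, J ≤ j → A.mode j B b = 0) (n m : ℤ)
    (y : A.restrictedDual) :
    A.rmul n B (A.rmul m b y) = A.rmul m b (A.rmul n B y) - ∑ j ∈ Finset.range J,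
      ((Ring.choose n j : ℤ) : ℂ) • A.rmul (n + m - j) (A.mode j B b) y := by
  ext v
  have h := congrArg (fun T : Module.End ℂ V => (y : Module.Dual ℂ V) (T v))
    (A.comm_mode B b hJ n m)
  simp only [Ring.lie_def, LinearMap.sub_apply, Module.End.mul_apply, LinearMap.sum_apply,
    LinearMap.smul_apply, map_sub, map_sum, map_smul] at h
  simp only [AddSubgroupClass.coe_sub, AddSubmonoidClass.coe_finsetSum, SetLike.val_smul,
    LinearMap.sub_apply, LinearMap.sum_apply, LinearMap.smul_apply, rmul_apply]
  rw [← h]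
  abel

/-- Peeling off the first field of an insertion: the commutators of the creation part of `B(x)` with
`a_0(z_0)` sum up to the singular terms at `x = z_0`. -/
theorem hasSum_peel_ins {k : ℕ} {z : Fin (k + 1) → ℂ} (hz : Ordered z) {x : ℂ}
    (hx : ‖x‖ < ‖z 0‖) (B : V) (y : A.restrictedDual) (a : Fin (k + 1) → V) :
    HasSum (fun m : ℤ => z 0 ^ (-m - 1) *
      A.ins x B (Fin.tail z) (A.rmul m (a 0) y) (Fin.tail a)) (A.ins x B z y a) := by
  have hz0 : z 0 ≠ 0 := norm_pos_iff.1 (lt_of_le_of_lt (norm_nonneg x) hx)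
  obtain ⟨N, hN⟩ := A.exists_rmul_eq_zero B y
  obtain ⟨J, hJ⟩ := A.exists_mode_eq_zero B a
  set w := Fin.tail z with hw
  have hwi : Function.Injective w := hz.tail.injective
  rw [A.ins_eq_sum hN hJ, Fin.sum_univ_succ, ← add_assoc]
  simp only [ins, mul_add]
  refine HasSum.add ?_ ?_
  · -- the creation part, as a double series in `m` and `n`
    let c : ℕ → ℤ → ℂ := fun n m => z 0 ^ (-m - 1) *
      A.corr k w (A.rmul m (a 0) (A.rmul (-n - 1) B y)) (Fin.tail a)
    let f : ℕ → ℤ × ℕ → ℂ := fun q x' => if x'.2 = q then x ^ q * c q x'.1 else 0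
    have hf : ∀ q, HasSum (f q) (x ^ q * A.corr (k + 1) z (A.rmul (-q - 1) B y) a) := by
      intro q
      have hi : Function.Injective fun m : ℤ => (m, q) := fun n m h => (Prod.mk.inj h).1
      refine (hi.hasSum_iff ?_).1
        (((A.hasSum_peel hz (A.rmul (-q - 1) B y) a).mul_left (x ^ q)).congr_fun ?_)
      · rintro ⟨p, n⟩ h
        exact if_neg fun hp => h ⟨p, Prod.ext rfl hp.symm⟩
      · intro m
        simp [f, c, w]
    let u : ℕ → ℕ → ℂ := fun j n =>
      x ^ n * ((Ring.choose (-(n : ℤ) - 1) j : ℤ) : ℂ) * (z 0)⁻¹ ^ (n + 1 + j)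
    let v : ℕ → ℤ → ℂ := fun j m => z 0 ^ (-m - 1) *
      A.corr k w (A.rmul m (A.mode j B (a 0)) y) (Fin.tail a)
    have hv : ∀ j, HasSum (v j) (A.corr (k + 1) z y (Function.update a 0 (A.mode j B (a 0)))) := by
      intro j
      have := A.hasSum_peel hz y (Function.update a 0 (A.mode j B (a 0)))
      simpa only [Function.update_self, Fin.tail_update_zero] using this
    have hg : ∀ j, HasSum (fun p : ℤ × ℕ => u j p.2 * v j (p.1 + (-p.2 - 1 - j)))
        (-(x - z 0)⁻¹ ^ (j + 1) *
          A.corr (k + 1) z y (Function.update a 0 (A.mode j B (a 0)))) := by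
      intro j
      let e : ℕ × ℤ ≃ ℕ × ℤ := Equiv.prodShear (Equiv.refl ℕ) fun n =>
        Equiv.addRight (-(n : ℤ) - 1 - j)
      have h1 := e.hasSum_iff.2 ((hasSum_binomial_neg hx j).mul_complex (hv j))
      exact (Equiv.prodComm ℤ ℕ).hasSum_iff.2 h1
    have htot := (hasSum_sum fun q (_ : q ∈ Finset.range N) => hf q).sub
      (hasSum_sum fun j (_ : j ∈ Finset.range J) => hg j)
    have key : ∀ (m : ℤ) (n : ℕ), (∑ q ∈ Finset.range N, f q (m, n)) -
        ∑ j ∈ Finset.range J, u j n * v j (m + (-n - 1 - j)) =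
        z 0 ^ (-m - 1) * (x ^ n * A.corr k w (A.rmul (-n - 1) B (A.rmul m (a 0) y))
          (Fin.tail a)) := by
      intro m n
      have h1 : ∑ q ∈ Finset.range N, f q (m, n) = x ^ n * c n m := by
        by_cases hn : n < N
        · rw [Finset.sum_eq_single_of_mem n (by simpa using hn)]
          · simp [f]
          · intro q _ hq
            exact if_neg (Ne.symm hq)
        · rw [Finset.sum_eq_zero]
          · simp [c, hN n (by omega), rmul_zero_right, corr_functional_zero]
          · intro q hq
            exact if_neg fun h => hn (by simp at hq; simp at h; omega)
      have h2 : ∀ j, u j n * v j (m + (-n - 1 - j)) = z 0 ^ (-m - 1) * (x ^ n *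
          (((Ring.choose (-(n : ℤ) - 1) j : ℤ) : ℂ) *
            A.corr k w (A.rmul (-n - 1 + m - j) (A.mode j B (a 0)) y) (Fin.tail a))) := by
        intro j
        have e1 : (z 0)⁻¹ ^ (n + 1 + j) * z 0 ^ (-(m + (-n - 1 - j)) - 1 : ℤ) =
            z 0 ^ (-m - 1) := by
          rw [inv_pow, ← zpow_natCast, ← zpow_neg, ← zpow_add₀ hz0]
          congr 1
          push_cast; ring
        have e2 : m + (-(n : ℤ) - 1 - j) = -n - 1 + m - j := by ring
        simp only [u, v]
        rw [← e1, e2]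
        ring
      rw [h1, Finset.sum_congr rfl fun j _ => h2 j, A.rmul_rmul B (a 0) (hJ 0), ← Finset.mul_sum,
        ← Finset.mul_sum]
      simp only [← A.corrLin_apply hwi, c, map_sub, map_sum, map_smul, sub_apply,
        sum_apply, smul_apply, smul_eq_mul]
      ring
    have hres := htot.prod_fiberwise (g := fun m : ℤ => z 0 ^ (-m - 1) *
      ∑ᶠ n : ℕ, x ^ n * A.corr k w (A.rmul (-n - 1) B (A.rmul m (a 0) y)) (Fin.tail a)) (by
        intro m
        simp only [key]
        refine HasSum.mul_left _ ?_
        obtain ⟨M, hM⟩ := A.exists_rmul_eq_zero B (A.rmul m (a 0) y)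
        have hM' : ∀ n ∉ Finset.range M, x ^ n *
            A.corr k w (A.rmul (-n - 1) B (A.rmul m (a 0) y)) (Fin.tail a) = 0 := fun n hn => by
          rw [hM n (by simpa using hn), corr_functional_zero, mul_zero]
        rw [finsum_eq_sum_of_support_subset (s := Finset.range M)]
        · exact hasSum_sum_of_ne_finset_zero hM'
        · intro n hn
          by_contra h
          exact hn (hM' n h))
    rw [← sub_neg_eq_add, ← Finset.sum_neg_distrib]
    simpa only [neg_mul] using hres
  · have h0 : ∀ (s : Fin k) (y : A.restrictedDual), (∑ᶠ j : ℕ, (x - w s)⁻¹ ^ (j + 1) *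
        A.corr k w y (Function.update (Fin.tail a) s (A.mode j B (Fin.tail a s)))) =
        ∑ j ∈ Finset.range J, (x - w s)⁻¹ ^ (j + 1) *
          A.corr k w y (Function.update (Fin.tail a) s (A.mode j B (Fin.tail a s))) := by
      intro s y
      refine finsum_eq_sum_of_support_subset _ fun j hj => ?_
      by_contra h
      refine hj ?_
      beta_reduce
      rw [A.corr_eq_zero _ _ _ s, mul_zero]
      rw [Function.update_self]
      exact hJ s.succ j (by simpa using h)
    simp only [h0, Finset.mul_sum]
    refine hasSum_sum fun s _ => hasSum_sum fun j _ => ?_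
    have h1 := (A.hasSum_peel hz y
      (Function.update a s.succ (A.mode j B (a s.succ)))).mul_left ((x - w s)⁻¹ ^ (j + 1))
    rw [Fin.tail_update_succ, Function.update_of_ne (Fin.succ_ne_zero s).symm] at h1
    refine h1.congr_fun fun m => ?_
    rw [mul_left_comm]
    rfl

/-- Correlation functions are symmetric in the first two fields. -/
theorem corr_swap {k : ℕ} {z : Fin (k + 2) → ℂ} (hz : Function.Injective z)
    (y : A.restrictedDual) (a : Fin (k + 2) → V) :
    A.corr (k + 2) (fun i => z (Equiv.swap 0 1 i)) y (fun i => a (Equiv.swap 0 1 i)) =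
      A.corr (k + 2) z y a := by
  refine eq_of_ordered (F := fun z => A.corr (k + 2) (fun i => z (Equiv.swap 0 1 i)) y
    (fun i => a (Equiv.swap 0 1 i))) (G := fun z => A.corr (k + 2) z y a)
    (comp_mem_confAlg _ (Equiv.injective _) (A.corr_mem_confAlg _ _)) (A.corr_mem_confAlg _ _)
    ?_ hz
  intro w hw _
  set w' : Fin (k + 1) → ℂ := Fin.tail fun i => w (Equiv.swap 0 1 i) with hw'
  set a' : Fin (k + 1) → V := Fin.tail fun i => a (Equiv.swap 0 1 i) with ha'
  have h1 : ∀ i : Fin k, Equiv.swap (0 : Fin (k + 2)) 1 i.succ.succ = i.succ.succ := fun i =>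
    Equiv.swap_apply_of_ne_of_ne (Fin.succ_ne_zero _) (by
      rw [← Fin.succ_zero_eq_one]
      exact fun h => Fin.succ_ne_zero i (Fin.succ_injective _ h))
  have hs : Equiv.swap (0 : Fin (k + 2)) 1 (Fin.succ 0) = 0 := by
    rw [Fin.succ_zero_eq_one]; exact Equiv.swap_apply_right 0 1
  have e1 : w' 0 = w 0 := congrArg w hs
  have e2 : a' 0 = a 0 := congrArg a hs
  have e3 : Fin.tail w' = Fin.tail (Fin.tail w) := funext fun i => congrArg w (h1 i)
  have e4 : Fin.tail a' = Fin.tail (Fin.tail a) := funext fun i => congrArg a (h1 i)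
  have hord : Ordered w' := by
    intro i j hij
    obtain ⟨j, rfl⟩ := Fin.exists_succ_eq.2 (ne_of_gt (lt_of_le_of_lt (Fin.zero_le i) hij))
    have hj : w' j.succ = w j.succ.succ := congrArg w (h1 j)
    rw [hj]
    induction i using Fin.cases with
    | zero => rw [e1]; exact hw _ _ (Fin.succ_pos _)
    | succ i =>
      rw [show w' i.succ = w i.succ.succ from congrArg w (h1 i)]
      exact hw _ _ (Fin.succ_lt_succ_iff.2 hij)
  have hP := A.hasSum_peel_ins hord (x := w 1) (by rw [e1]; exact hw 0 1 Fin.zero_lt_one) (a 1) y a'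
  have hE := A.hasSum_peel hw y a
  rw [corr_succ, ← hw', ← ha', Equiv.swap_apply_left]
  refine hP.unique (hE.congr_fun fun m => ?_)
  rw [e1, e2, e3, e4, A.corr_succ (Fin.tail w)]
  rfl

end BoundedConformalVertexAlgebra

/-- A sum over a rectangle that contains the support, arranged by antidiagonals. -/
theorem sum_product_eq_sum_antidiagonal {E : Type*} [AddCommMonoid E] (f : ℕ × ℕ → E) {N M R : ℕ}
    (h : ∀ p, f p ≠ 0 → p.1 < N ∧ p.2 < M ∧ p.1 + p.2 < R) :
    ∑ p ∈ Finset.range N ×ˢ Finset.range M, f p =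
      ∑ q ∈ Finset.range R, ∑ p ∈ Finset.HasAntidiagonal.antidiagonal q, f p := by
  rw [Finset.sum_sigma']
  refine Finset.sum_bij_ne_zero (fun p _ _ => ⟨p.1 + p.2, p⟩) ?_ ?_ ?_ ?_
  · intro p _ hp
    simp [(h p hp).2.2]
  · intro p _ _ q _ _ hpq
    simpa using (Sigma.mk.inj_iff.1 hpq).2
  · rintro ⟨q, p⟩ hq hp
    simp only [Finset.mem_sigma, Finset.HasAntidiagonal.mem_antidiagonal] at hq
    refine ⟨p, ?_, hp, ?_⟩
    · simp [(h p hp).1, (h p hp).2.1]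
    · rw [← hq.2]
  · intro p _ _
    rfl

namespace BoundedConformalVertexAlgebra

variable {V : Type*} [AddCommGroup V] [Module ℂ V] (A : BoundedConformalVertexAlgebra V)

/-! ### Normally ordered insertions -/

theorem ins_mem_confAlg {k : ℕ} (t : Fin k) (B : V) (y : A.restrictedDual) (a : Fin k → V) :
    (fun z => A.ins (z t) B z y a) ∈ confAlg k := by
  obtain ⟨N, hN⟩ := A.exists_rmul_eq_zero B y
  obtain ⟨J, hJ⟩ := A.exists_mode_eq_zero B a
  have e : (fun z => A.ins (z t) B z y a) =
      (∑ n ∈ Finset.range N, (fun z : Fin k → ℂ => z t) ^ n *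
        fun z => A.corr k z (A.rmul (-n - 1) B y) a) +
      ∑ s : Fin k, ∑ j ∈ Finset.range J, (fun z : Fin k → ℂ => (z t - z s)⁻¹) ^ (j + 1) *
        fun z => A.corr k z y (Function.update a s (A.mode j B (a s))) := by
    ext1 z
    rw [A.ins_eq_sum hN hJ]
    simp [Finset.sum_apply]
  rw [e]
  exact add_mem (sum_mem fun n _ => mul_mem (pow_mem (coord_mem_confAlg t) n)
    (A.corr_mem_confAlg _ _)) (sum_mem fun s _ => sum_mem fun j _ =>
      mul_mem (pow_mem (inv_sub_mem_confAlg t s) _) (A.corr_mem_confAlg _ _))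

theorem update_comp_equiv {ι α : Type*} [DecidableEq ι] (a : ι → α) (e : Equiv.Perm ι) (s : ι)
    (b : α) : (fun i => Function.update a (e s) b (e i)) =
      Function.update (fun i => a (e i)) s b := by
  ext i
  simp [Function.update_apply]

theorem ins_swap {k : ℕ} {z : Fin (k + 2) → ℂ} (hz : Function.Injective z) (x : ℂ) (B : V)
    (y : A.restrictedDual) (a : Fin (k + 2) → V) :
    A.ins x B (fun i => z (Equiv.swap 0 1 i)) y (fun i => a (Equiv.swap 0 1 i)) =
      A.ins x B z y a := by
  simp only [ins, A.corr_swap hz]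
  congr 1
  refine Fintype.sum_equiv (Equiv.swap 0 1) _ _ fun s => ?_
  refine finsum_congr fun j => ?_
  rw [← A.corr_swap hz y (Function.update a _ _), update_comp_equiv]

/-- The case of a single field: `(B_(-1) a)(x)|0⟩ = B_+(x) a(x)|0⟩`. -/
theorem corr_one_normal (z : Fin 1 → ℂ) (B : V) (y : A.restrictedDual) (a : Fin 1 → V) :
    A.corr 1 z y (Function.update a 0 (A.mode (-1) B (a 0))) = A.ins (z 0) B z y a := by
  set x := z 0 with hx
  set C := A.mode (-1) B (a 0) with hC
  obtain ⟨N, hN⟩ := A.exists_rmul_eq_zero B y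
  obtain ⟨M, hM⟩ : ∃ M : ℕ, ∀ n < N, ∀ m : ℕ, M ≤ m →
      A.rmul (-m - 1) (a 0) (A.rmul (-n - 1) B y) = 0 := by
    choose M hM using fun n : ℕ => A.exists_rmul_eq_zero (a 0) (A.rmul (-n - 1) B y)
    exact ⟨(Finset.range N).sup M, fun n hn m hm =>
      hM n m (le_trans (Finset.le_sup (f := M) (by simpa using hn)) hm)⟩
  obtain ⟨K, hK⟩ := A.exists_rmul_eq_zero C y
  set R := max K (N + M) with hR
  let c : ℕ × ℕ → ℂ := fun p => (y : Module.Dual ℂ V)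
    (A.mode (-p.1 - 1) B (A.mode (-p.2 - 1) (a 0) A.vac))
  have hc : ∀ p, c p ≠ 0 → p.1 < N ∧ p.2 < M := by
    intro p hp
    have h1 : p.1 < N := by
      by_contra h
      have := congrArg (fun f : A.restrictedDual => (f : Module.Dual ℂ V)
        (A.mode (-p.2 - 1) (a 0) A.vac)) (hN p.1 (by omega))
      exact hp this
    refine ⟨h1, ?_⟩
    by_contra h
    have := congrArg (fun f : A.restrictedDual => (f : Module.Dual ℂ V) A.vac)
      (hM p.1 h1 p.2 (by omega))
    exact hp this
  have hfs : ∀ (D : V) (y' : A.restrictedDual) (b : Fin 1 → V), b 0 = D → ∀ L : ℕ,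
      (∀ m : ℕ, L ≤ m → A.rmul (-m - 1) D y' = 0) → A.corr 1 z y' b =
        ∑ m ∈ Finset.range L, x ^ m * (y' : Module.Dual ℂ V) (A.mode (-m - 1) D A.vac) := by
    rintro D y' b rfl L hL
    rw [corr_succ, A.ins_eq_sum (J := 0) hL (fun s => s.elim0)]
    simp [corr_zero, rmul_apply, hx]
  have hL : A.corr 1 z y (Function.update a 0 C) =
      ∑ q ∈ Finset.range R, x ^ q * ∑ p ∈ Finset.HasAntidiagonal.antidiagonal q, c p := by
    rw [hfs C y _ (by simp) R (fun m hm => hK m (by omega))]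
    refine Finset.sum_congr rfl fun q _ => ?_
    rw [hC, A.mode_mode_neg_one_vac, map_sum]
  have hR' : A.ins x B z y a =
      ∑ p ∈ Finset.range N ×ˢ Finset.range M, x ^ (p.1 + p.2) * c p := by
    obtain ⟨J, hJ⟩ := A.exists_mode_eq_zero B a
    rw [A.ins_eq_sum hN hJ, Finset.sum_product]
    have h0 : ∀ (s : Fin 1) (j : ℕ), (x - z s)⁻¹ ^ (j + 1) = 0 := by
      intro s j
      rw [Subsingleton.elim s 0, ← hx]; simp
    simp only [h0, zero_mul, Finset.sum_const_zero, add_zero]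
    refine Finset.sum_congr rfl fun n hn => ?_
    rw [hfs (a 0) _ a rfl M (hM n (by simpa using hn)), Finset.mul_sum]
    refine Finset.sum_congr rfl fun m _ => ?_
    rw [rmul_apply, ← mul_assoc, ← pow_add]
  rw [hL, hR', sum_product_eq_sum_antidiagonal (R := R)]
  · refine Finset.sum_congr rfl fun q _ => ?_
    rw [Finset.mul_sum]
    refine Finset.sum_congr rfl fun p hp => ?_
    rw [Finset.HasAntidiagonal.mem_antidiagonal.1 hp]
  · intro p hp
    have := hc p (right_ne_zero_of_mul hp)
    exact ⟨this.1, this.2, by omega⟩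

/-- The field of `B_(-1) a_t` at `z_t` is the normally ordered insertion of `B` at `z_t`. Fields to
the left of `a_t` are peeled off; if `a_t` is the leftmost field, it is first swapped with its
neighbour. -/
theorem corr_normal {k : ℕ} {z : Fin k → ℂ} (hz : Function.Injective z) (t : Fin k) (B : V)
    (y : A.restrictedDual) (a : Fin k → V) :
    A.corr k z y (Function.update a t (A.mode (-1) B (a t))) = A.ins (z t) B z y a := by
  induction k generalizing y with
  | zero => exact t.elim0
  | succ k ih =>
    have hsucc : ∀ (t : Fin k) (z : Fin (k + 1) → ℂ) (a : Fin (k + 1) → V),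
        Function.Injective z → A.corr (k + 1) z y
          (Function.update a t.succ (A.mode (-1) B (a t.succ))) = A.ins (z t.succ) B z y a := by
      intro t z a hz
      refine eq_of_ordered (F := fun z => A.corr (k + 1) z y
        (Function.update a t.succ (A.mode (-1) B (a t.succ))))
        (G := fun z => A.ins (z t.succ) B z y a) (A.corr_mem_confAlg _ _)
        (A.ins_mem_confAlg _ _ _ _) ?_ hz
      intro w hw _
      have hE := A.hasSum_peel hw y (Function.update a t.succ (A.mode (-1) B (a t.succ)))
      have hP := A.hasSum_peel_ins hw (hw 0 t.succ (Fin.succ_pos t)) B y a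
      refine hE.unique (hP.congr_fun fun m => ?_)
      rw [Fin.tail_update_succ, Function.update_of_ne (Fin.succ_ne_zero t).symm]
      exact congrArg _ (ih (z := Fin.tail w) hw.tail.injective t _ (Fin.tail a))
    induction t using Fin.cases with
    | succ t => exact hsucc t z a hz
    | zero =>
      cases k with
      | zero => exact A.corr_one_normal z B y a
      | succ k =>
        have h := hsucc 0 (fun i => z (Equiv.swap 0 1 i)) (fun i => a (Equiv.swap 0 1 i))
          (hz.comp (Equiv.injective _))
        have e : Equiv.swap (0 : Fin (k + 2)) 1 1 = 0 := Equiv.swap_apply_right 0 1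
        rw [Fin.succ_zero_eq_one, A.ins_swap hz, e] at h
        rw [← h, ← A.corr_swap hz]
        congr 1
        have := update_comp_equiv a (Equiv.swap 0 1) 1 (A.mode (-1) B (a 0))
        rw [e] at this
        exact this

/-- The field of `B_(-m-1) a_t` at `z_t` is the `m`-th Taylor coefficient of the normally ordered
insertion of `B`. Since `(∂B)_(-m-1) = (m + 1) B_(-m-2)`, this follows from `corr_normal` by
induction, with `∂B` in place of `B`. -/
theorem corr_mode_neg {k : ℕ} {z : Fin k → ℂ} (hz : Function.Injective z) (t : Fin k) (m : ℕ)
    (B : V) (y : A.restrictedDual) (a : Fin k → V) {N J : ℕ}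
    (hN : ∀ n : ℕ, N ≤ n → A.rmul (-n - 1) B y = 0)
    (hJ : ∀ s, ∀ j : ℕ, J ≤ j → A.mode j B (a s) = 0) :
    A.corr k z y (Function.update a t (A.mode (-m - 1) B (a t))) =
      (∑ n ∈ Finset.range N, (n.choose m : ℂ) * z t ^ (n - m) *
        A.corr k z (A.rmul (-n - 1) B y) a) +
      ∑ s, ∑ j ∈ Finset.range J, (-1) ^ m * ((m + j).choose m : ℂ) *
        (z t - z s)⁻¹ ^ (j + 1 + m) *
          A.corr k z y (Function.update a s (A.mode j B (a s))) := by
  induction m generalizing B N J with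
  | zero =>
    rw [Nat.cast_zero, neg_zero, zero_sub, A.corr_normal hz, A.ins_eq_sum hN hJ]
    simp
  | succ m ih =>
    have hm : ((m : ℂ) + 1) ≠ 0 := by exact_mod_cast Nat.succ_ne_zero m
    have r1 : ∀ n : ℕ, A.rmul (-n - 1) (A.del B) y =
        ((n : ℂ) + 1) • A.rmul (-(n + 1 : ℕ) - 1) B y := by
      intro n
      ext v
      have e : (-(n : ℤ) - 1 - 1) = -((n + 1 : ℕ) : ℤ) - 1 := by push_cast; ring
      simp only [SetLike.val_smul, LinearMap.smul_apply, rmul_apply, A.mode_del, e, map_smul]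
      congr 1
      push_cast; ring
    have r2 : ∀ (j : ℕ) (v : V), A.mode (j + 1 : ℕ) (A.del B) v =
        (-((j : ℂ) + 1)) • A.mode j B v := by
      intro j v
      rw [A.mode_del, LinearMap.smul_apply]
      push_cast
      rw [add_sub_cancel_right]
    have r3 : ∀ v : V, A.mode (0 : ℕ) (A.del B) v = 0 := by
      intro v
      rw [A.mode_del]; simp
    have h := ih (A.del B) (N := N) (J := J + 1)
      (fun n hn => by rw [r1, hN _ (by omega), smul_zero])
      (fun s j hj => by
        obtain ⟨j, rfl⟩ : ∃ i, j = i + 1 := ⟨j - 1, by omega⟩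
        rw [r2, hJ s j (by omega), smul_zero])
    have l1 : A.mode (-m - 1) (A.del B) (a t) =
        ((m : ℂ) + 1) • A.mode (-(m + 1 : ℕ) - 1) B (a t) := by
      have e : (-(m : ℤ) - 1 - 1) = -((m + 1 : ℕ) : ℤ) - 1 := by push_cast; ring
      rw [A.mode_del, LinearMap.smul_apply, e]
      congr 1
      push_cast; ring
    rw [l1, A.corr_update_smul hz] at h
    refine mul_left_cancel₀ hm (h.trans ?_)
    rw [mul_add]
    congr 1
    · set f : ℕ → ℂ := fun n => ((m : ℂ) + 1) * ((n.choose (m + 1) : ℂ) * z t ^ (n - (m + 1)) *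
        A.corr k z (A.rmul (-n - 1) B y) a) with hf
      have h1 : ∑ n ∈ Finset.range N, f n = ∑ n ∈ Finset.range N, f (n + 1) := by
        have h2 := Finset.sum_range_succ' f N
        rw [Finset.sum_range_succ] at h2
        simpa [hf, hN N le_rfl, corr_functional_zero] using h2
      rw [Finset.mul_sum, h1]
      refine Finset.sum_congr rfl fun n _ => ?_
      have hch : ((n : ℂ) + 1) * (n.choose m : ℂ) = ((n + 1).choose (m + 1) : ℂ) * ((m : ℂ) + 1) := by
        exact_mod_cast Nat.add_one_mul_choose_eq n m
      simp only [hf]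
      rw [r1, A.corr_smul_functional hz, Nat.add_sub_add_right]
      linear_combination (z t ^ (n - m) * A.corr k z (A.rmul (-(n + 1 : ℕ) - 1) B y) a) * hch
    · rw [Finset.mul_sum]
      refine Finset.sum_congr rfl fun s _ => ?_
      rw [Finset.sum_range_succ', Finset.mul_sum, r3, A.corr_eq_zero _ _ _ s (by simp), mul_zero,
        add_zero]
      refine Finset.sum_congr rfl fun j _ => ?_
      have hch : ((m + 1 + j).choose (m + 1) : ℂ) * ((m : ℂ) + 1) =
          ((m + 1 + j).choose m : ℂ) * ((j : ℂ) + 1) := by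
        have := Nat.choose_succ_right_eq (m + 1 + j) m
        rw [show m + 1 + j - m = j + 1 by omega] at this
        exact_mod_cast this
      rw [r2, A.corr_update_smul hz, show m + (j + 1) = m + 1 + j by ring,
        show j + 1 + 1 + m = j + 1 + (m + 1) by ring, pow_succ (-1 : ℂ) m]
      linear_combination ((-1 : ℂ) ^ m * (z t - z s)⁻¹ ^ (j + 1 + (m + 1)) *
        A.corr k z y (Function.update a s (A.mode j B (a s)))) * hch

/-! ### Horizontality -/

theorem mode_vac_nat (j : ℕ) (v : V) : A.mode j v A.vac = 0 := A.mode_apply_vac v j (by omega)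

/-- The position of a vacuum insertion is irrelevant. -/
theorem corr_vac_indep {k : ℕ} (z : Fin k → ℂ) (t : Fin k) (x : ℂ) (y : A.restrictedDual)
    (a : Fin k → V) (ha : a t = A.vac) :
    A.corr k (Function.update z t x) y a = A.corr k z y a := by
  induction k generalizing y with
  | zero => exact t.elim0
  | succ k ih =>
    rw [corr_succ, corr_succ, ins, ins]
    induction t using Fin.cases with
    | zero =>
      have h0 : ∀ (j : ℕ) (v : V), A.mode j (a 0) v = 0 := by
        intro j v
        rw [ha, A.mode_vac, if_neg (by omega)]; rfl
      have h1 : ∀ n : ℕ, n ≠ 0 → A.rmul (-n - 1) (a 0) y = 0 := by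
        intro n hn
        ext v
        rw [rmul_apply, ha, A.mode_vac, if_neg (by omega)]
        simp
      have h2 : ∀ (c w : Fin k → V) (u : Fin k → ℂ) (s : Fin k) (j : ℕ),
          A.corr k u y (Function.update c s (A.mode j (a 0) (w s))) = 0 := fun c w u s j =>
        A.corr_eq_zero _ _ _ s (by rw [Function.update_self, h0])
      rw [Fin.tail_update_zero]
      congr 1
      · refine finsum_congr fun n => ?_
        rcases eq_or_ne n 0 with rfl | hn
        · simp
        · simp only [h1 n hn, corr_functional_zero, mul_zero]
      · simp only [h2, mul_zero]
    | succ t =>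
      have ht : Fin.tail a t = A.vac := ha
      rw [Fin.tail_update_succ, Function.update_of_ne (Fin.succ_ne_zero t).symm]
      congr 1
      · exact finsum_congr fun n => by rw [ih _ _ _ _ ht]
      · refine Finset.sum_congr rfl fun s _ => finsum_congr fun j => ?_
        rcases eq_or_ne s t with rfl | hs
        · rw [ht, mode_vac_nat, A.corr_eq_zero _ _ _ s (by simp), A.corr_eq_zero _ _ _ s (by simp),
            mul_zero, mul_zero]
        · rw [Function.update_of_ne hs, ih _ _ _ _ (by rw [Function.update_of_ne hs.symm, ht])]

theorem update_injective_of_forall_ne {k : ℕ} {z : Fin k → ℂ} (hz : Function.Injective z)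
    (t : Fin k) {w : ℂ} (h : ∀ s, s ≠ t → w ≠ z s) : Function.Injective (Function.update z t w) := by
  intro i j hij
  by_cases hi : i = t <;> by_cases hj : j = t
  · rw [hi, hj]
  · subst hi
    rw [Function.update_self, Function.update_of_ne hj] at hij
    exact absurd hij (h j hj)
  · subst hj
    rw [Function.update_self, Function.update_of_ne hi] at hij
    exact absurd hij.symm (h i hi)
  · rw [Function.update_of_ne hi, Function.update_of_ne hj] at hij
    exact hz hij

/-- The derivative with respect to `z_t` is the insertion of `∂a_t`. As `a_t(z_t) = (a_t)_(-1)|0⟩`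
and the position of a vacuum is irrelevant, the dependence on `z_t` is explicit in the formula for
the normally ordered insertion. -/
theorem hasDerivAt_corr {k : ℕ} {z : Fin k → ℂ} (hz : Function.Injective z) (t : Fin k)
    (y : A.restrictedDual) (a : Fin k → V) :
    HasDerivAt (fun w => A.corr k (Function.update z t w) y a)
      (A.corr k z y (Function.update a t (A.del (a t)))) (z t) := by
  set B := a t with hB
  set b := Function.update a t A.vac with hb
  have hbt : b t = A.vac := by simp [hb]
  obtain ⟨N, hN⟩ := A.exists_rmul_eq_zero B y
  obtain ⟨J, hJ⟩ := A.exists_mode_eq_zero B b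
  have ev : ∀ᶠ w in nhds (z t), ∀ s, s ≠ t → w ≠ z s := by
    refine Filter.eventually_all.2 fun s => ?_
    by_cases hs : s = t
    · exact Filter.Eventually.of_forall fun w h => absurd hs h
    · filter_upwards [isOpen_ne.mem_nhds (hz.ne (Ne.symm hs))] with w hw _ using hw
  have hvan : ∀ (x : ℂ) (j : ℕ), x * A.corr k z y
      (Function.update b t (A.mode j B (b t))) = 0 := fun x j => by
    rw [A.corr_eq_zero _ _ _ t (by rw [Function.update_self, hbt, mode_vac_nat]), mul_zero]
  have hF : (fun w => A.corr k (Function.update z t w) y a) =ᶠ[nhds (z t)] fun w =>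
      (∑ n ∈ Finset.range N, w ^ n * A.corr k z (A.rmul (-n - 1) B y) b) +
      ∑ s, ∑ j ∈ Finset.range J, (w - z s)⁻¹ ^ (j + 1) *
        A.corr k z y (Function.update b s (A.mode j B (b s))) := by
    filter_upwards [ev] with w hw
    have hi := update_injective_of_forall_ne hz t hw
    have h := A.corr_normal hi t B y b
    rw [hbt, A.mode_neg_one_vac, hb, Function.update_idem, hB, Function.update_eq_self, ← hb, ← hB,
      A.ins_eq_sum hN hJ, Function.update_self] at h
    rw [h]
    congr 1
    · refine Finset.sum_congr rfl fun n _ => ?_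
      rw [A.corr_vac_indep z t w _ b hbt]
    · refine Finset.sum_congr rfl fun s _ => Finset.sum_congr rfl fun j _ => ?_
      by_cases hs : s = t
      · subst hs
        rw [A.corr_eq_zero _ _ _ s (by rw [Function.update_self, hbt, mode_vac_nat]),
          A.corr_eq_zero _ _ _ s (by rw [Function.update_self, hbt, mode_vac_nat]), mul_zero,
          mul_zero]
      · rw [Function.update_of_ne hs, A.corr_vac_indep z t w]
        rw [Function.update_of_ne (Ne.symm hs), hbt]
  have hD : A.corr k z y (Function.update a t (A.del B)) =
      (∑ n ∈ Finset.range N, ((n : ℂ) * z t ^ (n - 1)) * A.corr k z (A.rmul (-n - 1) B y) b) +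
      ∑ s, ∑ j ∈ Finset.range J, (-((j : ℂ) + 1) * (z t - z s)⁻¹ ^ (j + 1 + 1)) *
        A.corr k z y (Function.update b s (A.mode j B (b s))) := by
    have h := A.corr_mode_neg hz t 1 B y b hN hJ
    have hd : A.mode (-(1 : ℕ) - 1) B (b t) = A.del B := by
      have := A.del_mode_vac B (-1)
      rw [A.mode_neg_one_vac] at this
      rw [hbt, this]
      simp
    rw [hd, hb, Function.update_idem, ← hb] at h
    rw [h]
    congr 1
    · simp
    · refine Finset.sum_congr rfl fun s _ => Finset.sum_congr rfl fun j _ => ?_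
      rw [Nat.choose_one_right]
      push_cast
      ring
  rw [hD]
  refine HasDerivAt.congr_of_eventuallyEq ?_ hF
  refine HasDerivAt.add (HasDerivAt.fun_sum fun n _ => (hasDerivAt_pow n (z t)).mul_const _)
    (HasDerivAt.fun_sum fun s _ => HasDerivAt.fun_sum fun j _ => ?_)
  by_cases hs : s = t
  · subst hs
    simp only [hvan]
    exact hasDerivAt_const _ _
  · have hne : z t - z s ≠ 0 := sub_ne_zero.2 (hz.ne (Ne.symm hs))
    have h1 := (((hasDerivAt_id (z t)).sub_const (z s)).inv hne).pow (j + 1)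
    refine (h1.mul_const _).congr_deriv ?_
    congr 1
    simp only [id, Nat.add_sub_cancel, Pi.inv_apply]
    push_cast
    rw [show j + 1 + 1 = j + 2 by ring, pow_add, inv_pow _ 2, neg_div, one_div]
    ring

end BoundedConformalVertexAlgebra

namespace BoundedConformalVertexAlgebra

variable {V : Type*} [AddCommGroup V] [Module ℂ V] (A : BoundedConformalVertexAlgebra V)

/-! ### The anti-involution is an involution -/

theorem comp_mem_wt (n : ℤ) (v : V) : A.comp n v ∈ A.wt n :=
  ((LinearEquiv.ofBijective (DirectSum.coeLinearMap A.wt) A.isInternal_wt).symm v n).2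

theorem comp_add (n : ℤ) (v w : V) : A.comp n (v + w) = A.comp n v + A.comp n w := by
  simp [comp]

theorem comp_zero (n : ℤ) : A.comp n 0 = 0 := by simp [comp]

theorem comp_of_mem {p : ℤ} {v : V} (hv : v ∈ A.wt p) (n : ℤ) :
    A.comp n v = if n = p then v else 0 := by
  have h : (LinearEquiv.ofBijective (DirectSum.coeLinearMap A.wt) A.isInternal_wt).symm v =
      DirectSum.of (fun n => A.wt n) p ⟨v, hv⟩ := by
    rw [LinearEquiv.symm_apply_eq]
    exact (DirectSum.coeLinearMap_lof A.wt p ⟨v, hv⟩).symm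
  rw [comp, h]
  split_ifs with hn
  · subst hn
    rw [DirectSum.of_eq_same]
  · rw [DirectSum.of_eq_of_ne _ _ _ hn]
    rfl

theorem finite_comp (v : V) : {n : ℤ | A.comp n v ≠ 0}.Finite := by
  classical
  refine ((LinearEquiv.ofBijective (DirectSum.coeLinearMap A.wt)
    A.isInternal_wt).symm v).support.finite_toSet.subset fun n hn => ?_
  simp only [Finset.mem_coe, DFinsupp.mem_support_toFun]
  intro h
  exact hn (by rw [comp, h]; rfl)

theorem vir_one_mem_wt {p : ℤ} {v : V} (hv : v ∈ A.wt p) : A.vir 1 v ∈ A.wt (p - 1) := by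
  have h0 := congrArg (fun T : Module.End ℂ V => T v) (A.virasoro 0 1)
  rw [ConformalVertexAlgebra.mem_wt] at hv ⊢
  have h1 : ¬ ((0 : ℤ) = -1) := by norm_num
  simp only [Ring.lie_def, LinearMap.sub_apply, Module.End.mul_apply, LinearMap.smul_apply, zero_add,
    h1, if_false, zero_smul, add_zero, hv, map_smul] at h0
  rw [sub_eq_iff_eq_add] at h0
  rw [ConformalVertexAlgebra.vir, h0]
  push_cast
  module

theorem vir_one_pow_mem_wt {p : ℤ} {v : V} (hv : v ∈ A.wt p) (j : ℕ) :
    ((A.vir 1) ^ j) v ∈ A.wt (p - j) := by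
  induction j with
  | zero => simpa using hv
  | succ j ih =>
    rw [pow_succ', Module.End.mul_apply]
    have := A.vir_one_mem_wt ih
    rwa [sub_sub, ← Nat.cast_succ] at this

theorem exists_vir_one_pow_eq_zero {p : ℤ} :
    ∃ J : ℕ, ∀ j : ℕ, J ≤ j → ∀ v ∈ A.wt p, ((A.vir 1) ^ j) v = 0 := by
  obtain ⟨N, hN⟩ := A.wt_eq_bot_of_lt
  refine ⟨(p - N + 1).toNat, fun j hj v hv => ?_⟩
  have := A.vir_one_pow_mem_wt hv j
  rwa [hN _ (by omega), Submodule.mem_bot] at this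

theorem finite_vir_one_pow_comp (v : V) :
    {r : ℤ × ℕ | ((A.vir 1) ^ r.2) (A.comp r.1 v) ≠ 0}.Finite := by
  choose J hJ using fun p : ℤ => A.exists_vir_one_pow_eq_zero (p := p)
  refine ((A.finite_comp v).biUnion fun p _ =>
    (Set.finite_singleton p).prod (Set.finite_lt_nat (J p))).subset ?_
  rintro ⟨p, j⟩ h
  refine Set.mem_biUnion (x := p) (fun h0 => h ?_) ⟨rfl, ?_⟩
  · rw [h0, map_zero]
  · by_contra hj
    exact h (hJ p j (not_lt.1 hj) _ (A.comp_mem_wt p v))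

/-- The value of `η` on a single mode. -/
def etaMode (n : ℤ) : V →+ A.Modes where
  toFun b := ∑ᶠ r : ℤ × ℕ, Finsupp.single (2 * r.1 - r.2 - n - 2)
    (((-1 : ℂ) ^ r.1 / (r.2.factorial : ℂ)) • ((A.vir 1) ^ r.2) (A.comp r.1 b))
  map_zero' := by simp [comp_zero]
  map_add' b b' := by
    have hfin : ∀ b : V, (Function.support fun r : ℤ × ℕ =>
        (Finsupp.single (2 * r.1 - r.2 - n - 2) (((-1 : ℂ) ^ r.1 / (r.2.factorial : ℂ)) •
          ((A.vir 1) ^ r.2) (A.comp r.1 b)) : A.Modes)).Finite := fun b =>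
      (A.finite_vir_one_pow_comp b).subset fun r hr h0 => hr (by simp [h0])
    rw [← finsum_add_distrib (hfin b) (hfin b')]
    refine finsum_congr fun r => ?_
    rw [comp_add, map_add, smul_add, Finsupp.single_add]

theorem eta_eq_liftAddHom (X : A.Modes) : A.eta X = Finsupp.liftAddHom A.etaMode X := rfl

theorem eta_single_of_mem {p : ℤ} {b : V} (hb : b ∈ A.wt p) {J : ℕ}
    (hJ : ∀ j : ℕ, J ≤ j → ((A.vir 1) ^ j) b = 0) (n : ℤ) :
    A.eta (Finsupp.single n b) = ∑ j ∈ Finset.range J, Finsupp.single (2 * p - j - n - 2)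
      (((-1 : ℂ) ^ p / (j.factorial : ℂ)) • ((A.vir 1) ^ j) b) := by
  rw [eta_eq_liftAddHom, Finsupp.liftAddHom_apply_single]
  change (∑ᶠ r : ℤ × ℕ, _) = _
  rw [finsum_eq_sum_of_support_subset (s := {p} ×ˢ Finset.range J)]
  · rw [Finset.sum_product, Finset.sum_singleton]
    refine Finset.sum_congr rfl fun j _ => ?_
    rw [A.comp_of_mem hb, if_pos rfl]
  · rintro ⟨q, j⟩ h
    by_contra hc
    refine h ?_
    beta_reduce
    rw [A.comp_of_mem hb]
    split_ifs with hq
    · subst hq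
      rw [hJ j (by simpa using hc)]
      simp
    · simp

theorem op_single (n : ℤ) (b : V) : A.op (Finsupp.single n b) = A.mode n b := by
  simp [op]

/-- `op` as an additive map. -/
def opHom : A.Modes →+ Module.End ℂ V :=
  Finsupp.liftAddHom fun n => (A.mode n).toAddMonoidHom

theorem op_eq_opHom (X : A.Modes) : A.op X = A.opHom X := rfl

/-- `η` is an involution: this reduces to `∑_{i+j=s} (-1)^j / (i! j!) = 0` for `s > 0`. -/
theorem op_eta_eta_single (n : ℤ) (b : V) :
    A.op (A.eta (A.eta (Finsupp.single n b))) = A.mode n b := by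
  have hb : b ∈ ⨆ p : ℤ, A.wt p := by rw [A.iSup_wt]; trivial
  induction hb using Submodule.iSup_induction' with
  | zero => simp [eta_eq_liftAddHom, op_eq_opHom]
  | add b b' _ _ h h' =>
    simp only [eta_eq_liftAddHom, op_eq_opHom, Finsupp.single_add, map_add] at h h' ⊢
    rw [h, h']
  | mem p b hb =>
    obtain ⟨J, hJ⟩ : ∃ J : ℕ, ∀ j : ℕ, J ≤ j → ((A.vir 1) ^ j) b = 0 := by
      obtain ⟨J, hJ⟩ := A.exists_vir_one_pow_eq_zero (p := p)
      exact ⟨J, fun j hj => hJ j hj b hb⟩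
    let f : ℕ × ℕ → Module.End ℂ V := fun r =>
      ((-1 : ℂ) ^ r.1 / ((r.1.factorial : ℂ) * (r.2.factorial : ℂ))) •
        A.mode (n - (r.1 + r.2 : ℕ)) (((A.vir 1) ^ (r.1 + r.2)) b)
    have hf : ∀ r, f r ≠ 0 → r.1 + r.2 < J := by
      intro r hr
      by_contra h
      exact hr (by simp [f, hJ _ (not_lt.1 h)])
    have h1 : A.op (A.eta (A.eta (Finsupp.single n b))) =
        ∑ r ∈ Finset.range J ×ˢ Finset.range J, f r := by
      rw [A.eta_single_of_mem hb hJ, Finset.sum_product, eta_eq_liftAddHom, map_sum, op_eq_opHom,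
        map_sum]
      refine Finset.sum_congr rfl fun j _ => ?_
      rw [← eta_eq_liftAddHom, A.eta_single_of_mem (J := J)
        ((A.wt (p - j)).smul_mem _ (A.vir_one_pow_mem_wt hb j)), map_sum]
      · refine Finset.sum_congr rfl fun i _ => ?_
        rw [← op_eq_opHom, op_single]
        have e1 : 2 * (p - (j : ℤ)) - i - (2 * p - j - n - 2) - 2 = n - (j + i : ℕ) := by
          push_cast; ring
        have e2 : ((-1 : ℂ) ^ (p - (j : ℤ))) * (-1) ^ p = (-1) ^ j := by
          have h : (-1 : ℂ) ≠ 0 := by norm_num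
          rw [← zpow_add₀ h, show p - (j : ℤ) + p = 2 * (p - j) + j by ring, zpow_add₀ h,
            zpow_mul, zpow_natCast]
          norm_num
        simp only [e1, map_smul, smul_smul, f]
        rw [← Module.End.mul_apply, ← pow_add, add_comm i j, div_mul_div_comm, e2, mul_comm (i.factorial : ℂ)]
      · intro i hi
        rw [map_smul, ← Module.End.mul_apply, ← pow_add, hJ _ (by omega), smul_zero]
    have h2 : ∀ q : ℕ, ∑ r ∈ Finset.HasAntidiagonal.antidiagonal q, f r =
        if q = 0 then A.mode n b else 0 := by
      intro q
      have h3 : ∀ r ∈ Finset.HasAntidiagonal.antidiagonal q, f r =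
          ((q.factorial : ℂ)⁻¹ * (q.choose r.1 • ((-1 : ℂ) ^ r.1 * 1 ^ r.2))) •
            A.mode (n - q) (((A.vir 1) ^ q) b) := by
        intro r hr
        rw [Finset.HasAntidiagonal.mem_antidiagonal] at hr
        subst hr
        have hc : (((r.1 + r.2).choose r.1 : ℕ) : ℂ) * (r.1.factorial : ℂ) * (r.2.factorial : ℂ) =
            ((r.1 + r.2).factorial : ℂ) := by
          rw [Nat.choose_symm_add]
          exact_mod_cast Nat.add_choose_mul_factorial_mul_factorial r.1 r.2
        have n1 : (r.1.factorial : ℂ) ≠ 0 := by exact_mod_cast Nat.factorial_ne_zero _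
        have n2 : (r.2.factorial : ℂ) ≠ 0 := by exact_mod_cast Nat.factorial_ne_zero _
        have n3 : ((r.1 + r.2).factorial : ℂ) ≠ 0 := by exact_mod_cast Nat.factorial_ne_zero _
        simp only [f]
        congr 1
        rw [one_pow, mul_one, nsmul_eq_mul]
        field_simp
        rw [← hc]
        ring
      rw [Finset.sum_congr rfl h3, ← Finset.sum_smul, ← Finset.mul_sum,
        ← (Commute.all (-1 : ℂ) 1).add_pow']
      split_ifs with hq
      · subst hq; simp
      · simp [hq]
    rw [h1]
    rcases Nat.eq_zero_or_pos J with hJ0 | hJ0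
    · have : b = 0 := by simpa using hJ 0 (by omega)
      rw [hJ0, this]
      simp
    · rw [sum_product_eq_sum_antidiagonal (R := J) f fun r hr => ⟨?_, ?_, hf r hr⟩]
      · simp [h2, hJ0]
      · have := hf r hr; omega
      · have := hf r hr; omega

/-- The action of `i_∞(B ⊗ f)` on `D(V)`: since `η` is an involution, `-η(B_(k))` acts by
`y ↦ -y ∘ B_(k)`. -/
theorem dualAct_neg_eta_single (k : ℤ) (B : V) (y : A.restrictedDual) :
    A.dualAct (-A.eta (Finsupp.single k B)) y = -A.rmul k B y := by
  ext v
  have h : A.op (A.eta (-A.eta (Finsupp.single k B))) = -A.mode k B := by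
    rw [← A.op_eta_eta_single]
    simp only [eta_eq_liftAddHom, op_eq_opHom, map_neg]
  change (y : Module.Dual ℂ V) (A.op (A.eta (-A.eta (Finsupp.single k B))) v) = _
  rw [h]
  simp [rmul_apply]

end BoundedConformalVertexAlgebra

/-! ### Laurent expansions of rational functions -/

section Expansion

open BoundedConformalVertexAlgebra

theorem aeval_ne_zero_of_ne_algebraMap {L : Type*} [Field L] [Algebra ℂ L] {x : L}
    (hx : ∀ c : ℂ, x ≠ algebraMap ℂ L c) {P : Polynomial ℂ} (hP : P ≠ 0) :
    Polynomial.aeval x P ≠ 0 := by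
  intro h
  have hi : IsIntegral ℂ x := IsAlgebraic.isIntegral ⟨P, hP, h⟩
  obtain ⟨c, hc⟩ := minpoly.mem_range_of_degree_eq_one ℂ x
    (IsAlgClosed.degree_eq_one_of_irreducible ℂ (minpoly.irreducible hi))
  exact hx c hc.symm

theorem nonZeroDivisors_le_comap_aeval {L : Type} [Field L] [Algebra ℂ L] (x : L)
    (hx : ∀ c : ℂ, x ≠ algebraMap ℂ L c) :
    nonZeroDivisors (Polynomial ℂ) ≤
      Submonoid.comap (Polynomial.aeval (R := ℂ) x) (nonZeroDivisors L) := fun _ hP =>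
  mem_nonZeroDivisors_of_ne_zero (aeval_ne_zero_of_ne_algebraMap hx (nonZeroDivisors.ne_zero hP))

/-- Substitution of a nonconstant element `x` of a field for the variable of rational functions.
Such an `x` is transcendental over `ℂ`, so no denominator vanishes and the values of `RatFunc.eval`
at `x`, which need not be multiplicative in general, form an algebra homomorphism. -/
def substHom {L : Type} [Field L] [Algebra ℂ L] (x : L) (hx : ∀ c : ℂ, x ≠ algebraMap ℂ L c) :
    RatFunc ℂ →ₐ[ℂ] L :=
  RatFunc.liftAlgHom (Polynomial.aeval x) (nonZeroDivisors_le_comap_aeval x hx)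

theorem eval_eq_substHom {L : Type} [Field L] [Algebra ℂ L] (x : L)
    (hx : ∀ c : ℂ, x ≠ algebraMap ℂ L c) (f : RatFunc ℂ) :
    f.eval (algebraMap ℂ L) x = substHom x hx f := by
  conv_rhs => rw [← RatFunc.num_div_denom f]
  rw [substHom, RatFunc.liftAlgHom_apply_div]
  rfl

theorem substHom_X {L : Type} [Field L] [Algebra ℂ L] (x : L)
    (hx : ∀ c : ℂ, x ≠ algebraMap ℂ L c) : substHom x hx RatFunc.X = x := by
  rw [← eval_eq_substHom, RatFunc.eval_X]

theorem substHom_C {L : Type} [Field L] [Algebra ℂ L] (x : L)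
    (hx : ∀ c : ℂ, x ≠ algebraMap ℂ L c) (c : ℂ) :
    substHom x hx (RatFunc.C c) = algebraMap ℂ L c := by
  rw [← eval_eq_substHom, RatFunc.eval_C]

theorem algebraMap_laurentSeries (c : ℂ) :
    algebraMap ℂ (LaurentSeries ℂ) c = HahnSeries.single 0 c := by
  rw [HahnSeries.algebraMap_apply', PowerSeries.algebraMap_apply, HahnSeries.ofPowerSeries_C]
  rfl

theorem coordAt_ne (p c : ℂ) :
    (HahnSeries.single 1 1 + algebraMap ℂ (LaurentSeries ℂ) p) ≠ algebraMap ℂ _ c := by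
  intro h
  have := congrArg (fun F : LaurentSeries ℂ => F.coeff 1) h
  simp [algebraMap_laurentSeries, HahnSeries.coeff_single_of_ne] at this

theorem coordInfty_ne (c : ℂ) :
    (HahnSeries.single (-1) 1 : LaurentSeries ℂ) ≠ algebraMap ℂ _ c := by
  intro h
  have := congrArg (fun F : LaurentSeries ℂ => F.coeff (-1)) h
  simp [algebraMap_laurentSeries, HahnSeries.coeff_single_of_ne] at this

theorem expandAt_eq (p : ℂ) (f : RatFunc ℂ) : expandAt p f = substHom _ (coordAt_ne p) f :=
  eval_eq_substHom _ _ f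

theorem expandInfty_eq (f : RatFunc ℂ) : expandInfty f = substHom _ coordInfty_ne f :=
  eval_eq_substHom _ _ f

open HahnSeries in
theorem coe_X_add_C (c : ℂ) : ((PowerSeries.X + PowerSeries.C c : PowerSeries ℂ) :
    LaurentSeries ℂ) = single 1 1 + algebraMap ℂ (LaurentSeries ℂ) c := by
  rw [map_add, ofPowerSeries_X, ofPowerSeries_C, algebraMap_laurentSeries]
  rfl

/-- The Taylor expansion of `(T + c)^(-m-1)`. -/
def invPowSeries (c : ℂ) (m : ℕ) : PowerSeries ℂ :=
  PowerSeries.mk fun j => (-1) ^ j * ((m + j).choose m : ℂ) * c⁻¹ ^ (j + 1 + m)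

theorem invPowSeries_zero_mul {c : ℂ} (hc : c ≠ 0) :
    invPowSeries c 0 * (PowerSeries.X + PowerSeries.C c) = 1 := by
  ext n
  rw [mul_add, map_add, PowerSeries.coeff_mul_C]
  cases n with
  | zero => simp [invPowSeries, hc]
  | succ n =>
    rw [PowerSeries.coeff_succ_mul_X, PowerSeries.coeff_one, if_neg (Nat.succ_ne_zero n)]
    simp only [invPowSeries, PowerSeries.coeff_mk, Nat.choose_zero_right, Nat.cast_one, mul_one,
      add_zero]
    rw [pow_succ c⁻¹ (n + 1), mul_assoc, mul_assoc, inv_mul_cancel₀ hc, pow_succ (-1 : ℂ) n]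
    ring

theorem invPowSeries_succ_mul {c : ℂ} (hc : c ≠ 0) (m : ℕ) :
    invPowSeries c (m + 1) * (PowerSeries.X + PowerSeries.C c) = invPowSeries c m := by
  ext n
  rw [mul_add, map_add, PowerSeries.coeff_mul_C]
  have e : ∀ i : ℕ, c⁻¹ ^ (i + 1 + (m + 1)) * c = c⁻¹ ^ (i + 1 + m) := fun i => by
    rw [← add_assoc, pow_succ, mul_assoc, inv_mul_cancel₀ hc, mul_one]
  cases n with
  | zero =>
    simp only [invPowSeries, PowerSeries.coeff_zero_mul_X, PowerSeries.coeff_mk, mul_assoc, e]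
    simp
  | succ n =>
    simp only [invPowSeries, PowerSeries.coeff_succ_mul_X, PowerSeries.coeff_mk, mul_assoc, e]
    have h : ((m + 1 + (n + 1)).choose (m + 1) : ℂ) =
        ((m + (n + 1)).choose m : ℂ) + ((m + 1 + n).choose (m + 1) : ℂ) := by
      rw [show m + 1 + (n + 1) = (m + (n + 1)) + 1 by ring, Nat.choose_succ_succ,
        show m + (n + 1) = m + 1 + n by ring]
      push_cast
      rfl
    rw [h, show n + 1 + (m + 1) = n + 1 + 1 + m by ring, pow_succ (-1 : ℂ) n]
    ring

theorem coe_invPowSeries {c : ℂ} (hc : c ≠ 0) (m : ℕ) :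
    ((invPowSeries c m : PowerSeries ℂ) : LaurentSeries ℂ) =
      (HahnSeries.single 1 1 + algebraMap ℂ (LaurentSeries ℂ) c)⁻¹ ^ (m + 1) := by
  set u := HahnSeries.single 1 1 + algebraMap ℂ (LaurentSeries ℂ) c with hu
  have hu0 : u ≠ 0 := by simpa using coordAt_ne c 0
  induction m with
  | zero =>
    rw [zero_add, pow_one]
    refine eq_inv_of_mul_eq_one_left ?_
    rw [hu, ← coe_X_add_C, ← map_mul, invPowSeries_zero_mul hc, map_one]
  | succ m ih =>
    rw [pow_succ, ← ih, eq_mul_inv_iff_mul_eq₀ hu0, hu, ← coe_X_add_C, ← map_mul,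
      invPowSeries_succ_mul hc]

/-- The expansion of `(z - p)^(-m-1)` in `T = 1/z`. -/
def inftySeries (p : ℂ) (m : ℕ) : PowerSeries ℂ :=
  PowerSeries.mk fun i => if i = 0 then 0 else ((i - 1).choose m : ℂ) * p ^ (i - 1 - m)

theorem inftySeries_zero_mul (p : ℂ) :
    inftySeries p 0 * (1 - PowerSeries.C p * PowerSeries.X) = PowerSeries.X := by
  ext n
  rw [mul_sub, mul_one, mul_left_comm, map_sub, PowerSeries.coeff_C_mul]
  rcases n with _ | _ | n
  · simp [inftySeries]
  · simp [inftySeries, PowerSeries.coeff_X]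
  · rw [PowerSeries.coeff_succ_mul_X]
    simp [inftySeries, PowerSeries.coeff_X, pow_succ']

theorem inftySeries_succ_mul (p : ℂ) (m : ℕ) :
    inftySeries p (m + 1) * (1 - PowerSeries.C p * PowerSeries.X) =
      PowerSeries.X * inftySeries p m := by
  ext n
  rw [mul_sub, mul_one, mul_left_comm, map_sub, PowerSeries.coeff_C_mul,
    mul_comm PowerSeries.X (inftySeries p m)]
  rcases n with _ | _ | n
  · simp [inftySeries]
  · simp [inftySeries, PowerSeries.coeff_succ_mul_X]
  · rw [PowerSeries.coeff_succ_mul_X, PowerSeries.coeff_succ_mul_X]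
    simp only [inftySeries, PowerSeries.coeff_mk, Nat.add_sub_cancel, Nat.succ_ne_zero, if_false]
    rw [Nat.add_sub_add_right, Nat.choose_succ_succ]
    rcases lt_or_ge n (m + 1) with h | h
    · rw [Nat.choose_eq_zero_of_lt h]; simp
    · rw [show n - m = (n - (m + 1)) + 1 by omega, pow_succ']
      push_cast
      ring

theorem coe_inftySeries (p : ℂ) (m : ℕ) :
    ((inftySeries p m : PowerSeries ℂ) : LaurentSeries ℂ) =
      (HahnSeries.single (-1) 1 - algebraMap ℂ (LaurentSeries ℂ) p)⁻¹ ^ (m + 1) := by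
  set u := HahnSeries.single (-1) 1 - algebraMap ℂ (LaurentSeries ℂ) p with hu
  have hu0 : u ≠ 0 := sub_ne_zero.2 (coordInfty_ne p)
  have hT : (HahnSeries.single (-1) 1 : LaurentSeries ℂ) * HahnSeries.single 1 1 = 1 := by
    rw [HahnSeries.single_mul_single]; simp
  have hX : ((1 - PowerSeries.C p * PowerSeries.X : PowerSeries ℂ) : LaurentSeries ℂ) =
      HahnSeries.single 1 1 * u := by
    rw [map_sub, map_one, map_mul, HahnSeries.ofPowerSeries_X, HahnSeries.ofPowerSeries_C, hu,
      mul_sub, algebraMap_laurentSeries, mul_comm (HahnSeries.single 1 1), hT, mul_comm]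
    rfl
  have hTu : ∀ F : PowerSeries ℂ, (F : LaurentSeries ℂ) * u = HahnSeries.single (-1) 1 *
      ((F * (1 - PowerSeries.C p * PowerSeries.X) : PowerSeries ℂ) : LaurentSeries ℂ) := by
    intro F
    rw [map_mul, hX, mul_left_comm, ← mul_assoc (HahnSeries.single (-1) 1), hT, one_mul]
  induction m with
  | zero =>
    rw [zero_add, pow_one]
    refine eq_inv_of_mul_eq_one_left ?_
    rw [hTu, inftySeries_zero_mul, HahnSeries.ofPowerSeries_X, hT]
  | succ m ih =>
    rw [pow_succ, ← ih, eq_mul_inv_iff_mul_eq₀ hu0, hTu, inftySeries_succ_mul, map_mul,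
      HahnSeries.ofPowerSeries_X, ← mul_assoc, hT, one_mul]

theorem expandAt_X_sub_C_inv_pow (p q : ℂ) (m : ℕ) :
    expandAt q ((RatFunc.X - RatFunc.C p)⁻¹ ^ (m + 1)) =
      (HahnSeries.single 1 1 + algebraMap ℂ (LaurentSeries ℂ) (q - p))⁻¹ ^ (m + 1) := by
  rw [expandAt_eq, map_pow, map_inv₀, map_sub, substHom_X, substHom_C, map_sub, add_sub_assoc]

theorem expandAt_X_pow_coeff (q : ℂ) (n : ℕ) (k : ℤ) :
    (expandAt q (RatFunc.X ^ n)).coeff k =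
      if k < 0 then 0 else (n.choose k.natAbs : ℂ) * q ^ (n - k.natAbs) := by
  rw [expandAt_eq, map_pow, substHom_X, ← coe_X_add_C, ← map_pow, PowerSeries.coeff_coe]
  congr 1
  have : (PowerSeries.X + PowerSeries.C q : PowerSeries ℂ) ^ n =
      ((Polynomial.X + Polynomial.C q) ^ n : Polynomial ℂ) := by simp
  rw [this, Polynomial.coeff_coe, Polynomial.coeff_X_add_C_pow, mul_comm]

theorem expandInfty_X_pow (n : ℕ) :
    expandInfty (RatFunc.X ^ n) = HahnSeries.single (-n : ℤ) 1 := by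
  rw [expandInfty_eq, map_pow, substHom_X, HahnSeries.single_pow]
  simp

theorem expandInfty_X_sub_C_inv_pow (p : ℂ) (m : ℕ) :
    expandInfty ((RatFunc.X - RatFunc.C p)⁻¹ ^ (m + 1)) = inftySeries p m := by
  rw [expandInfty_eq, map_pow, map_inv₀, map_sub, substHom_X, substHom_C, coe_inftySeries]

end Expansion

/-! ### Partial fractions -/

section PartialFractions

open RatFunc

/-- The span of the polynomials and of the principal parts at the points `p_t`. -/
def partialFractions {ι : Type*} (p : ι → ℂ) : Submodule ℂ (RatFunc ℂ) :=
  Submodule.span ℂ (Set.range (fun n : ℕ => (X : RatFunc ℂ) ^ n) ∪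
    Set.range fun r : ι × ℕ => (X - C (p r.1) : RatFunc ℂ)⁻¹ ^ (r.2 + 1))

variable {ι : Type*} {p : ι → ℂ}

theorem X_sub_C_ne_zero (c : ℂ) : (X - C c : RatFunc ℂ) ≠ 0 := by
  rw [← algebraMap_X, ← algebraMap_C, ← map_sub]
  exact algebraMap_ne_zero (Polynomial.X_sub_C_ne_zero c)

theorem X_pow_mem_partialFractions (n : ℕ) : (X : RatFunc ℂ) ^ n ∈ partialFractions p :=
  Submodule.subset_span (Or.inl ⟨n, rfl⟩)

theorem inv_pow_mem_partialFractions (t : ι) (m : ℕ) :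
    (X - C (p t) : RatFunc ℂ)⁻¹ ^ (m + 1) ∈ partialFractions p :=
  Submodule.subset_span (Or.inr ⟨(t, m), rfl⟩)

theorem C_mul_mem_partialFractions (c : ℂ) {f : RatFunc ℂ} (hf : f ∈ partialFractions p) :
    C c * f ∈ partialFractions p := by
  rw [← smul_eq_C_mul]
  exact Submodule.smul_mem _ _ hf

theorem inv_mul_mem_partialFractions (t : ι) {f : RatFunc ℂ} (hf : f ∈ partialFractions p) :
    (X - C (p t))⁻¹ * f ∈ partialFractions p := by
  induction hf using Submodule.span_induction with
  | zero => simp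
  | add f g _ _ hf hg => rw [mul_add]; exact add_mem hf hg
  | smul c f _ hf => rw [mul_smul_comm]; exact Submodule.smul_mem _ _ hf
  | mem f hf =>
    have h0 := X_sub_C_ne_zero (p t)
    rcases hf with ⟨n, rfl⟩ | ⟨⟨s, m⟩, rfl⟩
    · induction n with
      | zero => simpa using inv_pow_mem_partialFractions (p := p) t 0
      | succ n ih =>
        have e : (X - C (p t))⁻¹ * X ^ (n + 1) =
            X ^ n + C (p t) * ((X - C (p t))⁻¹ * X ^ n) := by
          field_simp
          ring
        beta_reduce at ih ⊢
        rw [e]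
        exact add_mem (X_pow_mem_partialFractions n) (C_mul_mem_partialFractions _ ih)
    · beta_reduce
      by_cases hst : p s = p t
      · rw [hst, ← pow_succ']
        exact inv_pow_mem_partialFractions (p := p) t (m + 1)
      · have h1 := X_sub_C_ne_zero (p s)
        have hc : (C (p t) - C (p s) : RatFunc ℂ) ≠ 0 := by
          rw [← map_sub]
          exact (map_ne_zero _).2 (sub_ne_zero.2 (Ne.symm hst))
        have e : (X - C (p t))⁻¹ * (X - C (p s))⁻¹ =
            C ((p t - p s)⁻¹) * ((X - C (p t))⁻¹ - (X - C (p s))⁻¹) := by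
          rw [map_inv₀, map_sub]
          field_simp
          ring
        have hstep : ∀ m : ℕ, (X - C (p t))⁻¹ * (X - C (p s))⁻¹ ^ (m + 1) ∈
            partialFractions p := by
          intro m
          induction m with
          | zero =>
            rw [zero_add, pow_one, e]
            exact C_mul_mem_partialFractions _ (sub_mem
              (by simpa using inv_pow_mem_partialFractions (p := p) t 0)
              (by simpa using inv_pow_mem_partialFractions (p := p) s 0))
          | succ m ih =>
            rw [pow_succ', ← mul_assoc, e, mul_assoc, sub_mul, ← pow_succ']
            exact C_mul_mem_partialFractions _
              (sub_mem ih (inv_pow_mem_partialFractions s (m + 1)))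
        exact hstep m

/-- A rational function whose poles lie among `∞` and the points `p_t` is a combination of
polynomials and principal parts. -/
theorem mem_partialFractions {f : RatFunc ℂ}
    (hf : ∀ x : ℂ, f.denom.eval x = 0 → x ∈ Set.range p) : f ∈ partialFractions p := by
  have hpoly : ∀ P : Polynomial ℂ, algebraMap (Polynomial ℂ) (RatFunc ℂ) P ∈
      partialFractions p := by
    intro P
    rw [P.as_sum_range_C_mul_X_pow, map_sum]
    refine sum_mem fun n _ => ?_
    rw [map_mul, map_pow, algebraMap_C, algebraMap_X]
    exact C_mul_mem_partialFractions _ (X_pow_mem_partialFractions n)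
  have hprod : ∀ S : Multiset ℂ, (∀ x ∈ S, x ∈ Set.range p) → ∀ g ∈ partialFractions p,
      (algebraMap (Polynomial ℂ) (RatFunc ℂ)
        (S.map fun x => Polynomial.X - Polynomial.C x).prod)⁻¹ * g ∈ partialFractions p := by
    intro S
    induction S using Multiset.induction_on with
    | empty => intro _ g hg; simpa using hg
    | cons x S ih =>
      intro hS g hg
      obtain ⟨t, rfl⟩ := hS _ (Multiset.mem_cons_self _ _)
      rw [Multiset.map_cons, Multiset.prod_cons, map_mul, mul_inv, mul_assoc, map_sub, algebraMap_X,
        algebraMap_C]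
      exact inv_mul_mem_partialFractions t (ih (fun y hy => hS y (Multiset.mem_cons_of_mem hy)) g hg)
  have hd : f.denom = (f.denom.roots.map fun x => Polynomial.X - Polynomial.C x).prod :=
    (IsAlgClosed.splits f.denom).eq_prod_roots_of_monic f.monic_denom
  rw [← num_div_denom f, div_eq_inv_mul, hd]
  refine hprod _ (fun x hx => hf x ?_) _ (hpoly _)
  exact (Polynomial.mem_roots'.1 hx).2

end PartialFractions

namespace BoundedConformalVertexAlgebra

variable {V : Type*} [AddCommGroup V] [Module ℂ V] (A : BoundedConformalVertexAlgebra V)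

/-! ### Ward identities for rational sections -/

/-- The operator `∑_k F_k B_(k)` for a Laurent series `F`. -/
def laurentAct (F : LaurentSeries ℂ) (B v : V) : V := ∑ᶠ k : ℤ, F.coeff k • A.mode k B v

theorem finite_laurentAct (F : LaurentSeries ℂ) (B v : V) :
    (Function.support fun k : ℤ => F.coeff k • A.mode k B v).Finite := by
  obtain ⟨N, hN⟩ := A.field B v
  refine (Set.finite_Ico F.order N).subset fun k hk => ⟨?_, ?_⟩
  · exact HahnSeries.order_le_of_coeff_ne_zero fun h => hk (by simp [h])
  · by_contra h
    exact hk (by simp [hN k (not_lt.1 h)])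

theorem laurentAct_add (F G : LaurentSeries ℂ) (B v : V) :
    A.laurentAct (F + G) B v = A.laurentAct F B v + A.laurentAct G B v := by
  rw [laurentAct, laurentAct, laurentAct,
    ← finsum_add_distrib (A.finite_laurentAct F B v) (A.finite_laurentAct G B v)]
  exact finsum_congr fun k => by rw [HahnSeries.coeff_add, add_smul]

theorem laurentAct_algebraMap_mul (c : ℂ) (F : LaurentSeries ℂ) (B v : V) :
    A.laurentAct (algebraMap ℂ _ c * F) B v = c • A.laurentAct F B v := by
  rw [laurentAct, laurentAct, smul_finsum]
  exact finsum_congr fun k => by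
    rw [algebraMap_laurentSeries, HahnSeries.coeff_single_zero_mul, mul_smul]

theorem laurentAct_zero (B v : V) : A.laurentAct 0 B v = 0 := by simp [laurentAct]

theorem laurentAct_of_nonneg {F : LaurentSeries ℂ} {B v : V} {J : ℕ}
    (hF : ∀ k : ℤ, k < 0 → F.coeff k = 0) (hJ : ∀ j : ℕ, J ≤ j → A.mode j B v = 0) :
    A.laurentAct F B v = ∑ j ∈ Finset.range J, F.coeff j • A.mode j B v := by
  rw [laurentAct, finsum_eq_sum_of_support_subset (s := (Finset.range J).map Nat.castEmbedding)]
  · simp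
  · intro k hk
    rcases lt_or_ge k 0 with h | h
    · exact absurd (by simp [hF k h]) hk
    · lift k to ℕ using h
      simp only [Finset.coe_map, Set.mem_image, Finset.coe_range, Set.mem_Iio]
      refine ⟨k, ?_, rfl⟩
      by_contra hc
      exact hk (by simp [hJ k (not_lt.1 hc)])

theorem laurentAct_single (n : ℤ) (B v : V) :
    A.laurentAct (HahnSeries.single n 1) B v = A.mode n B v := by
  rw [laurentAct, finsum_eq_single _ n]
  · simp
  · intro k hk
    rw [HahnSeries.coeff_single_of_ne hk, zero_smul]

theorem actAt_eq (p : ℂ) (B : V) (f : RatFunc ℂ) (v : V) :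
    A.actAt p B f v = A.laurentAct (substHom _ (coordAt_ne p) f) B v := by
  rw [← expandAt_eq]; rfl

/-- The functional `∑_k F_{-k} y ∘ B_(k)` for a Laurent series `F` in `1/z`. -/
def laurentDualAct (F : LaurentSeries ℂ) (B : V) (y : A.restrictedDual) : A.restrictedDual :=
  ∑ᶠ k : ℤ, F.coeff (-k) • A.rmul k B y

theorem finite_laurentDualAct (F : LaurentSeries ℂ) (B : V) (y : A.restrictedDual) :
    (Function.support fun k : ℤ => F.coeff (-k) • A.rmul k B y).Finite := by
  obtain ⟨N, hN⟩ := A.exists_rmul_eq_zero B y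
  refine (Set.finite_Ioc (-(N : ℤ) - 1) (-F.order)).subset fun k hk => ⟨?_, ?_⟩
  · by_contra h
    obtain ⟨n, rfl⟩ : ∃ n : ℕ, k = -n - 1 := ⟨(-k - 1).toNat, by omega⟩
    refine hk ?_
    beta_reduce
    rw [hN n (by omega), smul_zero]
  · have : F.order ≤ -k := HahnSeries.order_le_of_coeff_ne_zero fun h => hk (by simp [h])
    omega

theorem laurentDualAct_add (F G : LaurentSeries ℂ) (B : V) (y : A.restrictedDual) :
    A.laurentDualAct (F + G) B y = A.laurentDualAct F B y + A.laurentDualAct G B y := by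
  rw [laurentDualAct, laurentDualAct, laurentDualAct,
    ← finsum_add_distrib (A.finite_laurentDualAct F B y) (A.finite_laurentDualAct G B y)]
  exact finsum_congr fun k => by rw [HahnSeries.coeff_add, add_smul]

theorem laurentDualAct_algebraMap_mul (c : ℂ) (F : LaurentSeries ℂ) (B : V) (y : A.restrictedDual) :
    A.laurentDualAct (algebraMap ℂ _ c * F) B y = c • A.laurentDualAct F B y := by
  rw [laurentDualAct, laurentDualAct, smul_finsum]
  exact finsum_congr fun k => by
    rw [algebraMap_laurentSeries, HahnSeries.coeff_single_zero_mul, mul_smul]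

theorem laurentDualAct_zero (B : V) (y : A.restrictedDual) : A.laurentDualAct 0 B y = 0 := by
  simp [laurentDualAct]

theorem laurentDualAct_single (n : ℤ) (B : V) (y : A.restrictedDual) :
    A.laurentDualAct (HahnSeries.single (-n) 1) B y = A.rmul n B y := by
  rw [laurentDualAct, finsum_eq_single _ n]
  · simp
  · intro k hk
    rw [HahnSeries.coeff_single_of_ne (fun h => hk (neg_injective h)), zero_smul]

theorem laurentDualAct_inftySeries (p : ℂ) (m : ℕ) {B : V} {y : A.restrictedDual} {N : ℕ}
    (hN : ∀ n : ℕ, N ≤ n → A.rmul (-n - 1) B y = 0) :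
    A.laurentDualAct (inftySeries p m) B y =
      ∑ n ∈ Finset.range N, ((n.choose m : ℂ) * p ^ (n - m)) • A.rmul (-n - 1) B y := by
  have hinj : Function.Injective fun n : ℕ => (-(n : ℤ) - 1) := fun a b h => by
    simpa using h
  have hc : ∀ k : ℤ, (inftySeries p m : LaurentSeries ℂ).coeff (-k) ≠ 0 →
      ∃ n : ℕ, k = -n - 1 := by
    intro k hk
    rw [PowerSeries.coeff_coe] at hk
    refine ⟨(-k - 1).toNat, ?_⟩
    by_contra h
    refine hk ?_
    split_ifs with h0
    · rfl
    · have : k = 0 := by omega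
      simp [this, inftySeries]
  rw [laurentDualAct, finsum_eq_sum_of_support_subset (s := (Finset.range N).map ⟨_, hinj⟩)]
  · rw [Finset.sum_map]
    refine Finset.sum_congr rfl fun n _ => ?_
    congr 1
    rw [Function.Embedding.coeFn_mk, show -(-(n : ℤ) - 1) = ((n + 1 : ℕ) : ℤ) by push_cast; ring,
      LaurentSeries.coeff_coe_powerSeries]
    simp [inftySeries]
  · intro k hk
    obtain ⟨n, rfl⟩ := hc k fun h => hk (by simp [h])
    simp only [Finset.coe_map, Set.mem_image, Finset.coe_range, Set.mem_Iio]
    refine ⟨n, ?_, rfl⟩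
    by_contra h
    refine hk ?_
    beta_reduce
    rw [hN n (not_lt.1 h), smul_zero]

theorem actInfty_eq (B : V) (f : RatFunc ℂ) (y : A.restrictedDual) :
    A.actInfty B f y = -A.laurentDualAct (substHom _ coordInfty_ne f) B y := by
  rw [← expandInfty_eq, actInfty, laurentDualAct, ← finsum_neg_distrib]
  exact finsum_congr fun k => by rw [dualAct_neg_eta_single, smul_neg]

/-- The Ward identity for the section `B ⊗ f`: the correlation function is invariant under all
sections that are regular outside of `∞` and the points `z_t`. -/
theorem ward {k : ℕ} {z : Fin k → ℂ} (hz : Function.Injective z) (B : V) {f : RatFunc ℂ}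
    (hf : ∀ x : ℂ, f.denom.eval x = 0 → x ∈ Set.range z) (y : A.restrictedDual) (a : Fin k → V) :
    A.corr k z (A.actInfty B f y) a +
      ∑ t, A.corr k z y (Function.update a t (A.actAt (z t) B f (a t))) = 0 := by
  have hf' := mem_partialFractions hf
  simp only [actInfty_eq, actAt_eq, ← A.corrLin_apply hz, map_neg, neg_apply]
  rw [neg_add_eq_zero]
  clear hf
  induction hf' using Submodule.span_induction with
  | zero =>
    simp only [map_zero, laurentAct_zero, laurentDualAct_zero, zero_apply]
    refine (Finset.sum_eq_zero fun t _ => ?_).symm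
    exact MultilinearMap.map_coord_zero _ t (Function.update_self _ _ _)
  | add f g _ _ hf hg =>
    simp only [map_add, laurentAct_add, laurentDualAct_add, MultilinearMap.map_update_add,
      add_apply, Finset.sum_add_distrib, hf, hg]
  | smul c f _ hf =>
    simp only [Algebra.smul_def c f, map_mul, AlgHom.commutes, laurentAct_algebraMap_mul,
      laurentDualAct_algebraMap_mul, map_smul, MultilinearMap.map_update_smul,
      smul_apply, ← Finset.smul_sum, hf]
  | mem f hf =>
    obtain ⟨J, hJ⟩ := A.exists_mode_eq_zero B a
    simp only [corrLin_apply, ← expandAt_eq, ← expandInfty_eq]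
    have hsum : ∀ (s : Fin k) (F : LaurentSeries ℂ), (∀ k : ℤ, k < 0 → F.coeff k = 0) →
        A.corr k z y (Function.update a s (A.laurentAct F B (a s))) = ∑ j ∈ Finset.range J,
          F.coeff j * A.corr k z y (Function.update a s (A.mode j B (a s))) := by
      intro s F hF
      rw [A.laurentAct_of_nonneg hF (hJ s)]
      simp only [← A.corrLin_apply hz, MultilinearMap.map_update_sum,
        MultilinearMap.map_update_smul, smul_eq_mul]
    rcases hf with ⟨n, rfl⟩ | ⟨⟨t, m⟩, rfl⟩
    · beta_reduce
      rw [expandInfty_X_pow, laurentDualAct_single, A.corr_rmul_nat hz B y a hJ]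
      refine Finset.sum_congr rfl fun s _ => ?_
      rw [hsum s _ fun k hk => by rw [expandAt_X_pow_coeff, if_pos hk]]
      refine Finset.sum_congr rfl fun j _ => ?_
      rw [expandAt_X_pow_coeff, if_neg (by omega), Int.natAbs_natCast]
    · obtain ⟨N, hN⟩ := A.exists_rmul_eq_zero B y
      have h := A.corr_mode_neg hz t m B y a hN hJ
      beta_reduce
      rw [expandInfty_X_sub_C_inv_pow, A.laurentDualAct_inftySeries _ _ hN]
      have h1 : A.corr k z (∑ n ∈ Finset.range N,
          ((n.choose m : ℂ) * z t ^ (n - m)) • A.rmul (-n - 1) B y) a =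
          ∑ n ∈ Finset.range N, (n.choose m : ℂ) * z t ^ (n - m) *
            A.corr k z (A.rmul (-n - 1) B y) a := by
        simp only [← A.corrLin_apply hz, map_sum, map_smul, sum_apply, smul_apply, smul_eq_mul]
      rw [h1, ← sub_eq_iff_eq_add.2 h, sub_eq_iff_eq_add, ← Finset.add_sum_erase _ _
        (Finset.mem_univ t), ← Finset.add_sum_erase (a := t) _ (fun s => ∑ j ∈ Finset.range J,
        (-1 : ℂ) ^ m * ((m + j).choose m : ℂ) * (z t - z s)⁻¹ ^ (j + 1 + m) *
          A.corr k z y (Function.update a s (A.mode j B (a s)))) (Finset.mem_univ t)]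
      have h2 : expandAt (z t) ((RatFunc.X - RatFunc.C (z t))⁻¹ ^ (m + 1)) =
          HahnSeries.single (-m - 1 : ℤ) 1 := by
        rw [expandAt_X_sub_C_inv_pow, sub_self, map_zero, add_zero, HahnSeries.inv_single,
          HahnSeries.single_pow]
        congr 1
        · exact congrArg _ (by rw [nsmul_eq_mul]; push_cast; ring)
        · simp
      rw [h2, laurentAct_single, add_assoc]
      simp only [sub_self, inv_zero, ne_eq, Nat.add_eq_zero_iff, one_ne_zero, and_false, false_and,
        not_false_eq_true, zero_pow, mul_zero, zero_mul, Finset.sum_const_zero, zero_add]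
      rw [left_eq_add, ← Finset.sum_add_distrib]
      refine Finset.sum_eq_zero fun s hs => ?_
      have hne : z s - z t ≠ 0 := sub_ne_zero.2 (hz.ne (Finset.ne_of_mem_erase hs))
      rw [expandAt_X_sub_C_inv_pow, ← coe_invPowSeries hne, hsum s _ fun k hk => by
        rw [PowerSeries.coeff_coe, if_pos hk], ← Finset.sum_add_distrib]
      refine Finset.sum_eq_zero fun j _ => ?_
      rw [LaurentSeries.coeff_coe_powerSeries, invPowSeries, PowerSeries.coeff_mk, ← add_mul]
      convert zero_mul _
      rw [← neg_sub (z s), inv_neg, neg_pow (z s - z t)⁻¹, pow_add (-1 : ℂ), pow_succ (-1 : ℂ) j]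
      have : (-1 : ℂ) ^ m * (-1) ^ m = 1 := by rw [← mul_pow]; simp
      linear_combination (-(-1 : ℂ) ^ j * ((m + j).choose m : ℂ) *
        (z s - z t)⁻¹ ^ (j + 1 + m)) * this

end BoundedConformalVertexAlgebra

/-! ### The family of functionals -/

section Points

open MvPolynomial

variable {k : ℕ}

theorem markedPts_castSucc (z : Fin k → ℂ) (i : Fin k) : markedPts z i.castSucc = z i :=
  Fin.snoc_castSucc (α := fun _ => ℂ) _ _ _

theorem markedPts_last (z : Fin k → ℂ) : markedPts z (Fin.last k) = 0 :=
  Fin.snoc_last (α := fun _ => ℂ) _ _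

theorem markedPts_update (z : Fin k → ℂ) (t : Fin k) (w : ℂ) :
    markedPts (Function.update z t w) = Function.update (markedPts z) t.castSucc w := by
  rw [markedPts, markedPts, Fin.snoc_update]

theorem markedPts_injective {z : Fin k → ℂ} (hz : z ∈ Config k) :
    Function.Injective (markedPts z) := by
  intro i j
  induction i using Fin.lastCases with
  | last =>
    induction j using Fin.lastCases with
    | last => exact fun _ => rfl
    | cast j =>
      rw [markedPts_last, markedPts_castSucc]
      exact fun h => absurd h.symm (hz.2 j)
  | cast i =>
    induction j using Fin.lastCases with
    | last =>
      rw [markedPts_last, markedPts_castSucc]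
      exact fun h => absurd h (hz.2 i)
    | cast j =>
      rw [markedPts_castSucc, markedPts_castSucc]
      exact fun h => congrArg _ (hz.1 h)

theorem ordered_markedPts {z : Fin k → ℂ} (hz : z ∈ OrderedRegion k) : Ordered (markedPts z) := by
  intro i j hij
  induction i using Fin.lastCases with
  | last => exact absurd hij (Fin.not_lt.2 (Fin.le_last j))
  | cast i =>
    induction j using Fin.lastCases with
    | last =>
      rw [markedPts_last, markedPts_castSucc, norm_zero]
      exact norm_pos_iff.2 (hz.2 i)
    | cast j =>
      rw [markedPts_castSucc, markedPts_castSucc]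
      exact hz.1 i j (Fin.castSucc_lt_castSucc_iff.1 hij)

theorem orderedRegion_subset_config : OrderedRegion k ⊆ Config k := fun _ hz =>
  ⟨Ordered.injective hz.1, hz.2⟩

theorem eventually_update_mem_config {z : Fin k → ℂ} (hz : z ∈ Config k) (t : Fin k) :
    ∀ᶠ w in nhds (z t), Function.update z t w ∈ Config k := by
  have h1 : ∀ᶠ w in nhds (z t), ∀ s, s ≠ t → w ≠ z s := by
    rw [Filter.eventually_all]
    intro s
    by_cases hs : s = t
    · exact Filter.Eventually.of_forall fun _ h => absurd hs h
    · exact (eventually_ne_nhds (hz.1.ne (Ne.symm hs))).mono fun _ h _ => h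
  filter_upwards [h1, eventually_ne_nhds (hz.2 t)] with w hw hw0
  refine ⟨BoundedConformalVertexAlgebra.update_injective_of_forall_ne hz.1 t hw, fun i => ?_⟩
  by_cases hi : i = t
  · subst hi
    rwa [Function.update_self]
  · rw [Function.update_of_ne hi]
    exact hz.2 i

/-- The polynomial `∏ z_i ∏_{i < j} (z_i - z_j)`, whose nonvanishing defines the configuration
space of points of `ℂ \ {0}`. -/
def configPoly (k : ℕ) : MvPolynomial (Fin k) ℂ :=
  (∏ i, X i) * ∏ i, ∏ j ∈ Finset.Ioi i, (X i - X j)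

theorem eval_configPoly_pow (z : Fin k → ℂ) (N : ℕ) : eval z (configPoly k) ^ N =
    (∏ i, z i ^ N) * ∏ i, ∏ j ∈ Finset.Ioi i, (z i - z j) ^ N := by
  simp only [configPoly, map_mul, map_prod, map_sub, eval_X, mul_pow, Finset.prod_pow]

theorem eval_configPoly_ne_zero {z : Fin k → ℂ} : eval z (configPoly k) ≠ 0 ↔ z ∈ Config k := by
  rw [configPoly, map_mul, mul_ne_zero_iff, and_comm]
  simp only [map_prod, map_sub, eval_X, Finset.prod_ne_zero_iff, Finset.mem_univ, true_imp_iff,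
    Finset.mem_Ioi, sub_ne_zero, Config, Set.mem_ofPred_eq]
  refine and_congr_left fun _ => ⟨fun h => ?_, fun h i j hij => h.ne hij.ne⟩
  intro i j hij
  rcases lt_trichotomy i j with hlt | rfl | hlt
  · exact absurd hij (h i j hlt)
  · rfl
  · exact absurd hij.symm (h j i hlt)

theorem X_dvd_configPoly (i : Fin k) : X i ∣ configPoly k :=
  Dvd.dvd.mul_right (Finset.dvd_prod_of_mem _ (Finset.mem_univ i)) _

theorem X_sub_X_dvd_configPoly {i j : Fin k} (h : i ≠ j) : (X i - X j) ∣ configPoly k := by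
  wlog hij : i < j generalizing i j
  · rw [← neg_sub, neg_dvd]
    exact this h.symm (lt_of_le_of_ne (not_lt.1 hij) h.symm)
  exact Dvd.dvd.mul_left ((Finset.dvd_prod_of_mem _ (Finset.mem_Ioi.2 hij)).trans
    (Finset.dvd_prod_of_mem (fun i => ∏ j ∈ Finset.Ioi i, (X i - X j : MvPolynomial (Fin k) ℂ))
      (Finset.mem_univ i))) _

theorem comp_markedPts_mem_ratAlg {F : (Fin (k + 1) → ℂ) → ℂ} (hF : F ∈ confAlg (k + 1)) :
    (fun z => F (markedPts z)) ∈ ratAlg (configPoly k) := by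
  have h := comp_mem_ratAlg (D' := configPoly k) (Fin.snoc X 0 : Fin (k + 1) → MvPolynomial _ ℂ)
    (bind_discr_dvd _ ?_) hF
  · convert h using 3 with z
    ext i
    induction i using Fin.lastCases with
    | last => rw [markedPts_last, Fin.snoc_last, map_zero]
    | cast i => rw [markedPts_castSucc, Fin.snoc_castSucc, eval_X]
  · intro i j hij
    induction i using Fin.lastCases with
    | last =>
      induction j using Fin.lastCases with
      | last => exact absurd rfl hij
      | cast j =>
        rw [Fin.snoc_last, Fin.snoc_castSucc, zero_sub, neg_dvd]
        exact X_dvd_configPoly j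
    | cast i =>
      induction j using Fin.lastCases with
      | last =>
        rw [Fin.snoc_last, Fin.snoc_castSucc, sub_zero]
        exact X_dvd_configPoly i
      | cast j =>
        rw [Fin.snoc_castSucc, Fin.snoc_castSucc]
        exact X_sub_X_dvd_configPoly fun h => hij (congrArg _ h)

end Points

namespace BoundedConformalVertexAlgebra

variable {V : Type*} [AddCommGroup V] [Module ℂ V] (A : BoundedConformalVertexAlgebra V) {k : ℕ}

open Classical in
/-- The functional on `D(V) ⊗ V^{⊗(k+1)}` given by the correlation function of `k + 1` fields at
the marked points `z_0, …, z_{k-1}, 0`, and by `0` outside of the configuration space. -/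
def matrixElement (z : Fin k → ℂ) : Module.Dual ℂ (A.Tens k) :=
  if hz : z ∈ Config k then
    TensorProduct.lift
      ((PiTensorProduct.lift (R := ℂ) (s := fun _ : Fin (k + 1) => V) (E := ℂ)).toLinearMap ∘ₗ
        A.corrLin (markedPts_injective hz))
  else 0

theorem matrixElement_pure {z : Fin k → ℂ} (hz : z ∈ Config k) (y : A.restrictedDual)
    (a : Fin (k + 1) → V) :
    A.matrixElement z (A.pure y a) = A.corr (k + 1) (markedPts z) y a := by
  rw [matrixElement, dif_pos hz, pure, TensorProduct.lift.tmul, LinearMap.comp_apply,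
    LinearEquiv.coe_coe, PiTensorProduct.lift.tprod, corrLin_apply]

theorem tens_induction {p : A.Tens k → Prop} (hpure : ∀ y a, p (A.pure y a))
    (hsmul : ∀ (c : ℂ) ξ, p ξ → p (c • ξ)) (hadd : ∀ ξ ξ', p ξ → p ξ' → p (ξ + ξ')) (ξ : A.Tens k) :
    p ξ := by
  induction ξ using TensorProduct.induction_on with
  | zero => simpa using hsmul 0 _ (hpure 0 0)
  | tmul y x =>
    induction x using PiTensorProduct.induction_on with
    | smul_tprod c a =>
      rw [TensorProduct.tmul_smul]
      exact hsmul c _ (hpure y a)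
    | add x x' h h' =>
      rw [TensorProduct.tmul_add]
      exact hadd _ _ h h'
  | add ξ ξ' h h' => exact hadd _ _ h h'

theorem iterMode_eq_modes (a : Fin (k + 1) → V) (n : Fin k → ℤ) :
    A.iterMode a n = A.modes (k + 1) a (Fin.snoc n (-1) : Fin (k + 1) → ℤ) := by
  induction k with
  | zero =>
    rw [modes_succ, modes]
    simp [iterMode, Fin.snoc, A.mode_neg_one_vac]
  | succ k ih =>
    have e : A.iterMode a n = A.mode (n 0) (a 0) (A.iterMode (Fin.tail a) (Fin.tail n)) := by
      rw [iterMode, List.ofFn_succ, List.prod_cons]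
      rfl
    have h0 : (Fin.snoc n (-1) : Fin (k + 2) → ℤ) 0 = n 0 :=
      Fin.snoc_castSucc (α := fun _ => ℤ) (-1) n 0
    have ht : Fin.tail (Fin.snoc n (-1) : Fin (k + 2) → ℤ) =
        (Fin.snoc (Fin.tail n) (-1) : Fin (k + 1) → ℤ) := by
      ext i
      induction i using Fin.lastCases with
      | last =>
        rw [Fin.tail, Fin.succ_last, Fin.snoc_last, Fin.snoc_last]
      | cast i =>
        rw [Fin.tail, Fin.succ_castSucc, Fin.snoc_castSucc, Fin.snoc_castSucc, Fin.tail]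
    rw [e, ih, A.modes_succ a, h0, ht]

/-- At the point `0` only the mode `(a_k)_(-1)` contributes, and it creates `a_k` from the
vacuum. -/
theorem hasSum_iterMode {z : Fin k → ℂ} (hz : z ∈ OrderedRegion k) (y : A.restrictedDual)
    (a : Fin (k + 1) → V) :
    HasSum (fun n : Fin k → ℤ => (∏ i, z i ^ (-n i - 1)) * (y : Module.Dual ℂ V) (A.iterMode a n))
      (A.corr (k + 1) (markedPts z) y a) := by
  have h := A.hasSum_corr (ordered_markedPts hz) y a
  have hinj : Function.Injective fun n : Fin k → ℤ => (Fin.snoc n (-1) : Fin (k + 1) → ℤ) :=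
    fun n n' e => by
      have := congrArg Fin.init e
      simpa [Fin.init_snoc] using this
  rw [← hinj.hasSum_iff] at h
  · convert h using 2 with n
    rw [Function.comp_apply, ← iterMode_eq_modes, monom, Fin.prod_univ_castSucc]
    simp [markedPts_castSucc, markedPts_last]
  · intro n hn
    rcases lt_or_ge (n (Fin.last k)) 0 with hl | hl
    · have hne : -n (Fin.last k) - 1 ≠ 0 := by
        intro h0
        refine hn ⟨Fin.init n, ?_⟩
        beta_reduce
        rw [show (-1 : ℤ) = n (Fin.last k) by omega, Fin.snoc_init_self]
      rw [monom, Finset.prod_eq_zero (Finset.mem_univ (Fin.last k)), zero_mul]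
      rw [markedPts_last, zero_zpow _ hne]
    · rw [A.modes_eq_zero_of_last a n (Fin.last k) (fun i => not_lt.2 (Fin.le_last i)) hl,
        map_zero, mul_zero]

theorem isMatrixElement_matrixElement : A.IsMatrixElement (A.matrixElement (k := k)) where
  hasSum z hz y a := by
    rw [A.matrixElement_pure (orderedRegion_subset_config hz)]
    exact A.hasSum_iterMode hz y a
  rational y a := by
    obtain ⟨N, P, h⟩ := comp_markedPts_mem_ratAlg (A.corr_mem_confAlg (k := k + 1) y a)
    refine ⟨N, P, fun z hz => ?_⟩
    rw [A.matrixElement_pure hz, ← eval_configPoly_pow]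
    exact h z (eval_configPoly_ne_zero.2 hz)

theorem IsMatrixElement.mem_ratAlg {A : BoundedConformalVertexAlgebra V}
    {Φ : (Fin k → ℂ) → Module.Dual ℂ (A.Tens k)} (hΦ : A.IsMatrixElement Φ) (y : A.restrictedDual)
    (a : Fin (k + 1) → V) : (fun z => Φ z (A.pure y a)) ∈ ratAlg (configPoly k) := by
  obtain ⟨N, P, h⟩ := hΦ.rational y a
  refine ⟨N, P, fun z hz => ?_⟩
  rw [eval_configPoly_pow]
  exact h z (eval_configPoly_ne_zero.1 hz)

/-- The matrix element is determined on the configuration space by its Laurent series on the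
ordered region. -/
theorem IsMatrixElement.eq {A : BoundedConformalVertexAlgebra V}
    {Φ Ψ : (Fin k → ℂ) → Module.Dual ℂ (A.Tens k)} (hΦ : A.IsMatrixElement Φ)
    (hΨ : A.IsMatrixElement Ψ) {z : Fin k → ℂ} (hz : z ∈ Config k) : Φ z = Ψ z := by
  obtain ⟨x, hx⟩ := exists_ordered k
  have hne : configPoly k ≠ 0 := fun h =>
    eval_configPoly_ne_zero.2 (orderedRegion_subset_config hx) (by rw [h, map_zero])
  refine LinearMap.ext fun ξ => ?_
  induction ξ using A.tens_induction with
  | hpure y a =>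
    refine eqOn_of_mem_ratAlg hne (hΦ.mem_ratAlg y a) (hΨ.mem_ratAlg y a) _ infinite_orderedBox
      (fun x hx _ => ?_) (eval_configPoly_ne_zero.2 hz)
    exact (hΦ.hasSum x (ordered_of_mem_box hx) y a).unique
      (hΨ.hasSum x (ordered_of_mem_box hx) y a)
  | hsmul c ξ h => rw [map_smul, map_smul, h]
  | hadd ξ ξ' h h' => rw [map_add, map_add, h, h']

theorem virNegOneAt_pure (t : Fin k) (y : A.restrictedDual) (a : Fin (k + 1) → V) :
    A.virNegOneAt t (A.pure y a) =
      A.pure y (Function.update a t.castSucc (A.del (a t.castSucc))) := by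
  rw [virNegOneAt, pure, LinearMap.lTensor_tmul, PiTensorProduct.map_tprod, pure]
  congr 2
  ext i
  by_cases hi : i = t.castSucc
  · subst hi
    simp [ConformalVertexAlgebra.vir, A.conf_zero]
  · simp [Function.update_of_ne hi]

theorem isHorizontalSection_matrixElement :
    A.IsHorizontalSection (A.matrixElement (k := k)) where
  mem z hz B f hf y a := by
    simp only [A.matrixElement_pure hz]
    exact A.ward (markedPts_injective hz) B hf y a
  horizontal z hz t ξ := by
    induction ξ using A.tens_induction with
    | hpure y a =>
      rw [virNegOneAt_pure, A.matrixElement_pure hz]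
      have h := A.hasDerivAt_corr (markedPts_injective hz) t.castSucc y a
      rw [markedPts_castSucc] at h
      refine h.congr_of_eventuallyEq ?_
      filter_upwards [eventually_update_mem_config hz t] with w hw
      rw [A.matrixElement_pure hw, markedPts_update]
    | hsmul c ξ h =>
      simp only [map_smul, smul_eq_mul]
      exact h.const_mul c
    | hadd ξ ξ' h h' =>
      simp only [map_add]
      exact h.add h'

end BoundedConformalVertexAlgebra

end

theorem mainTheorem8 {V : Type*} [AddCommGroup V] [Module ℂ V]
    (A : BoundedConformalVertexAlgebra V) (k : ℕ) :
    ∃ Φ : (Fin k → ℂ) → Module.Dual ℂ (A.Tens k),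
      A.IsMatrixElement Φ ∧
      (∀ Ψ : (Fin k → ℂ) → Module.Dual ℂ (A.Tens k), A.IsMatrixElement Ψ →
        ∀ z ∈ Config k, Ψ z = Φ z) ∧
      A.IsHorizontalSection Φ :=
  ⟨A.matrixElement, A.isMatrixElement_matrixElement,
    fun _ hΨ _ hz => hΨ.eq A.isMatrixElement_matrixElement hz,
    A.isHorizontalSection_matrixElement⟩
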